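/- Setting. Let $n,p,d$ be non-negative integers, $a\in\mathbb R$, let $X$ be a real $n\times p$ matrix with rows $x_i^T$ and $y$ a real $n\times d$ matrix with rows $y_i^T$. Let $h:(0,\infty)\to[0,\infty)$ be a mixing density, i.e. a probability density on $(0,\infty)$. Assume (S1) $\mathrm{rank}\,(X:y)=p+d$; (S2) $n>p+2d-2a$; (S3) $\int_0^\infty u^{d/2}h(u)\,du<\infty$; (S4) $\int_0^\infty u^{-\frac{n-p+2a-2d-1}{2}}h(u)\,du<\infty$. Let $\mathcal S_d$ be the set of positive definite $d\times d$ matrices, viewed as a subset of $\mathbb R^{d(d+1)/2}$, let $\mathsf X=\mathbb R^{p\times d}\times\mathcal S_d$ with Lebesgue measure $d\beta\,d\Sigma$, and put $r_i(\beta,\Sigma)=(\beta^Tx_i-y_i)^T\Sigma^{-1}(\beta^Tx_i-y_i)$. The posterior density on $\mathsf X$ is $$\pi(\beta,\Sigma|y)=\frac{1}{m(y)}\,|\Sigma|^{-a}\prod_{i=1}^n\int_0^\infty\frac{u^{d/2}}{(2\pi)^{d/2}|\Sigma|^{1/2}}e^{-\frac u2 r_i(\beta,\Sigma)}h(u)\,du,$$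 with $m(y)$ the normalizing constant. For $s\ge 0$ let $\psi(u;s)=b(s)\,u^{d/2}e^{-su/2}h(u)$, where $b(s)$ makes $\psi(\cdot;s)$ a probability density on $(0,\infty)$. For $z\in(0,\infty)^n$ let $Q$ be the diagonal matrix with entries $z_i^{-1}$, $\Omega=(X^TQ^{-1}X)^{-1}$ and $\mu=\Omega X^TQ^{-1}y$. Let $$k\big((\beta',\Sigma')\,\big|\,(\beta,\Sigma)\big)=\int_{(0,\infty)^n}\pi(\beta'|\Sigma',z,y)\,\pi(\Sigma'|z,y)\prod_{i=1}^n\psi\big(z_i;r_i(\beta,\Sigma)\big)\,dz$$ be the transition density of the data augmentation Markov chain. Here $\pi(\cdot|\Sigma',z,y)$ is the matrix normal $\mathrm N_{p,d}(\mu,\Omega,\Sigma')$ density, where $\mathrm N_{r,c}(\theta,A,B)$ has density $$\frac{\exp\left[-\frac12\mathrm{tr}\{A^{-1}(w-\theta)B^{-1}(w-\theta)^T\}\right]}{(2\pi)^{rc/2}|A|^{c/2}|B|^{r/2}},$$ and $\pi(\cdot|z,y)$ is the inverse Wishart $\mathrm{IW}_d\big(n-p+2a-d-1,(y^TQ^{-1}y-\mu^T\Omega^{-1}\mu)^{-1}\big)$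 density, where $\mathrm{IW}_r(m,\Theta)$ has density $$\frac{|w|^{-\frac{m+r+1}{2}}\exp\{-\frac12\mathrm{tr}(\Theta^{-1}w^{-1})\}}{2^{mr/2}\pi^{r(r-1)/4}|\Theta|^{m/2}\prod_{i=1}^r\Gamma(\frac{m+1-i}{2})}$$ on the positive definite matrices $w$. Let $L_0^2$ be the Hilbert space of real functions on $\mathsf X$ that are square integrable with respect to $\pi(\cdot|y)$ and have mean zero under it, and let $$(Kf)(\beta,\Sigma)=\int_{\mathsf X}f(\beta',\Sigma')\,k\big((\beta',\Sigma')\,\big|\,(\beta,\Sigma)\big)\,d\beta'\,d\Sigma'.$$ Lemma. Suppose there exist $\zeta<2$ and $\nu:(0,\infty)\to[0,\infty)$ with $\int_0^\infty\nu(u)\,du<\infty$ such that $$\psi(u;s)\le\exp\Big\{\frac{(\zeta-1)us}{2}\Big\}\,\nu(u)\qquad\text{for all }u>0\text{ and all }s\ge 0.$$ Then $K$ is a well-defined bounded operator on $L_0^2$ that is self-adjoint, positive and trace-class, i.e. it is compact and its eigenvalues, counted with multiplicity, are summable. -/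

import Mathlib

open MeasureTheory Set
open scoped Matrix ENNReal

noncomputable section

namespace DAReg

/-! ### Mixing densities and the univariate densities `ψ(·; s)` -/

/-- A mixing density: a probability density on `(0, ∞)`.  Only the values of `h` on `(0, ∞)`
are ever used. -/
structure IsMixingDensity (h : ℝ → ℝ) : Prop where
  measurable : Measurable h
  nonneg : ∀ u, 0 < u → 0 ≤ h u
  integrable : IntegrableOn h (Ioi 0)
  integral_eq_one : ∫ u in Ioi (0 : ℝ), h u = 1

/-- The normalizing constant `b(s)` of `u ^ (d/2) * exp (-s u / 2) * h u` on `(0, ∞)`. -/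
def psiConst (d : ℕ) (h : ℝ → ℝ) (s : ℝ) : ℝ :=
  (∫ u in Ioi (0 : ℝ), u ^ ((d : ℝ) / 2) * Real.exp (-(s * u) / 2) * h u)⁻¹

/-- `ψ(u; s) = b(s) u ^ (d/2) exp (-s u / 2) h(u)`. -/
def psi (d : ℕ) (h : ℝ → ℝ) (u s : ℝ) : ℝ :=
  psiConst d h s * u ^ ((d : ℝ) / 2) * Real.exp (-(s * u) / 2) * h u

/-! ### The matrix normal and the inverse Wishart densities -/

/-- The density of `N_{r,c}(θ, A, B)` on `r × c` matrices. -/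
def matrixNormalPDF {r c : ℕ} (θ : Matrix (Fin r) (Fin c) ℝ) (A : Matrix (Fin r) (Fin r) ℝ)
    (B : Matrix (Fin c) (Fin c) ℝ) (z : Matrix (Fin r) (Fin c) ℝ) : ℝ :=
  1 / ((2 * Real.pi) ^ ((r : ℝ) * c / 2) * A.det ^ ((c : ℝ) / 2) * B.det ^ ((r : ℝ) / 2)) *
    Real.exp (-(1 / 2) * (A⁻¹ * (z - θ) * B⁻¹ * (z - θ)ᵀ).trace)

/-- The density of `IW_r(m, Θ)` on symmetric `r × r` matrices, with respect to Lebesgue measure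
in the `r (r + 1) / 2` coordinates; it vanishes off the positive definite matrices. -/
def invWishartPDF {r : ℕ} (m : ℝ) (Θ w : Matrix (Fin r) (Fin r) ℝ) : ℝ :=
  Set.indicator {w : Matrix (Fin r) (Fin r) ℝ | w.PosDef}
    (fun w => w.det ^ (-(m + r + 1) / 2) * Real.exp (-(1 / 2) * (Θ⁻¹ * w⁻¹).trace) /
      ((2 : ℝ) ^ (m * r / 2) * Real.pi ^ ((r : ℝ) * (r - 1) / 4) * Θ.det ^ (m / 2) *
        ∏ i ∈ Finset.Icc 1 r, Real.Gamma ((m + 1 - i) / 2))) w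

/-! ### The state space `ℝ^{p × d} × 𝒮_d` -/

/-- The symmetric `d × d` matrix with prescribed entries; `Sym2 (Fin d)`, the set of unordered
pairs of indices, has `d (d + 1) / 2` elements, so `Sym2 (Fin d) → ℝ` is `ℝ^{d (d + 1) / 2}`. -/
def symMat {d : ℕ} (σ : Sym2 (Fin d) → ℝ) : Matrix (Fin d) (Fin d) ℝ :=
  Matrix.of fun i j => σ s(i, j)

/-- The ambient space of the pairs `(β, Σ)`, where `Σ` is given by its coordinates. -/
abbrev State (p d : ℕ) : Type := (Fin p → Fin d → ℝ) × (Sym2 (Fin d) → ℝ)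

/-- The component `β` of a state, as a `p × d` matrix. -/
def State.beta {p d : ℕ} (x : State p d) : Matrix (Fin p) (Fin d) ℝ := Matrix.of x.1

/-- The component `Σ` of a state, as a symmetric `d × d` matrix. -/
def State.scale {p d : ℕ} (x : State p d) : Matrix (Fin d) (Fin d) ℝ := symMat x.2

/-- The state space `ℝ^{p × d} × 𝒮_d`. -/
def stateSpace (p d : ℕ) : Set (State p d) := {x | (State.scale x).PosDef}

/-- The measure `dβ dΣ` on the state space. -/
def stateVolume (p d : ℕ) : Measure (State p d) := volume.restrict (stateSpace p d)

/-! ### The posterior distribution -/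

section model

variable {n p d : ℕ} (a : ℝ) (X : Matrix (Fin n) (Fin p) ℝ) (y : Matrix (Fin n) (Fin d) ℝ)
  (h : ℝ → ℝ)

/-- `r_i(β, Σ) = (βᵀ x_i - y_i)ᵀ Σ⁻¹ (βᵀ x_i - y_i)`, with `x_i`, `y_i` the rows of `X`, `y`. -/
def resid (x : State p d) (i : Fin n) : ℝ :=
  ((State.beta x)ᵀ *ᵥ X i - y i) ⬝ᵥ ((State.scale x)⁻¹ *ᵥ ((State.beta x)ᵀ *ᵥ X i - y i))

/-- The likelihood `f(y | β, Σ)`. -/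
def likelihood (x : State p d) : ℝ :=
  ∏ i : Fin n, ∫ u in Ioi (0 : ℝ),
    u ^ ((d : ℝ) / 2) / ((2 * Real.pi) ^ ((d : ℝ) / 2) * (State.scale x).det ^ ((1 : ℝ) / 2)) *
      Real.exp (-(u / 2) * resid X y x i) * h u

/-- The improper prior `ω(β, Σ) = |Σ| ^ (-a)` on the state space. -/
def prior (x : State p d) : ℝ := (State.scale x).det ^ (-a)

/-- `m(y)`, the integral of likelihood times prior. -/
def marginal : ℝ≥0∞ :=
  ∫⁻ x, ENNReal.ofReal (likelihood X y h x * prior a x) ∂(stateVolume p d)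

/-- The posterior density `π(β, Σ | y)`. -/
def posteriorDensity (x : State p d) : ℝ≥0∞ :=
  ENNReal.ofReal (likelihood X y h x * prior a x) / marginal a X y h

/-- The posterior distribution `π(β, Σ | y) dβ dΣ`. -/
def posterior : Measure (State p d) :=
  (stateVolume p d).withDensity (posteriorDensity a X y h)

/-! ### The data augmentation algorithm -/

/-- `Q(z)`, the diagonal matrix with entries `1 / z_i`. -/
def matQ (z : Fin n → ℝ) : Matrix (Fin n) (Fin n) ℝ := Matrix.diagonal fun i => (z i)⁻¹

/-- `Ω = (Xᵀ Q⁻¹ X)⁻¹`. -/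
def matOmega (z : Fin n → ℝ) : Matrix (Fin p) (Fin p) ℝ := (Xᵀ * (matQ z)⁻¹ * X)⁻¹

/-- `μ = (Xᵀ Q⁻¹ X)⁻¹ Xᵀ Q⁻¹ y`. -/
def matMu (z : Fin n → ℝ) : Matrix (Fin p) (Fin d) ℝ :=
  (Xᵀ * (matQ z)⁻¹ * X)⁻¹ * Xᵀ * (matQ z)⁻¹ * y

/-- Step 1: the density `π(z | β, Σ, y)` on `(0, ∞)^n`. -/
def condZ (z : Fin n → ℝ) (x : State p d) : ℝ := ∏ i : Fin n, psi d h (z i) (resid X y x i)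

/-- Step 2: the density `π(Σ | z, y)`. -/
def condScale (x : State p d) (z : Fin n → ℝ) : ℝ :=
  invWishartPDF ((n : ℝ) - p + 2 * a - d - 1)
    (yᵀ * (matQ z)⁻¹ * y - (matMu X y z)ᵀ * (matOmega X z)⁻¹ * matMu X y z)⁻¹ (State.scale x)

/-- Step 3: the density `π(β | Σ, z, y)`. -/
def condBeta (x : State p d) (z : Fin n → ℝ) : ℝ :=
  matrixNormalPDF (matMu X y z) (matOmega X z) (State.scale x) (State.beta x)

/-- The Markov transition density `k(x' | x)` of the data augmentation chain. -/
def mtd (x' x : State p d) : ℝ :=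
  ∫ z in {z : Fin n → ℝ | ∀ i, 0 < z i},
    condBeta X y x' z * condScale a X y x' z * condZ X y h z x

end model

/-! ### `L²₀` and trace-class operators -/

/-- The space `L²₀` of a probability measure: the square integrable real functions with integral
zero, as a subspace of `L²`.  (For a finite measure the integrability condition is automatic.) -/
def L2Zero {α : Type*} [MeasurableSpace α] (P : Measure α) : Submodule ℝ (Lp ℝ 2 P) where
  carrier := {f | Integrable f P ∧ ∫ x, f x ∂P = 0}
  zero_mem' := by
    refine ⟨(integrable_congr (Lp.coeFn_zero ℝ 2 P)).2 (integrable_zero _ _ _), ?_⟩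
    rw [integral_congr_ae (Lp.coeFn_zero ℝ 2 P)]
    simp
  add_mem' := by
    rintro f g ⟨hf, hf0⟩ ⟨hg, hg0⟩
    refine ⟨(integrable_congr (Lp.coeFn_add f g)).2 (hf.add hg), ?_⟩
    rw [integral_congr_ae (Lp.coeFn_add f g)]
    simp only [Pi.add_apply]
    rw [integral_add hf hg, hf0, hg0, add_zero]
  smul_mem' := by
    rintro c f ⟨hf, hf0⟩
    refine ⟨(integrable_congr (Lp.coeFn_smul c f)).2 (hf.smul c), ?_⟩
    rw [integral_congr_ae (Lp.coeFn_smul c f)]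
    simp only [Pi.smul_apply]
    rw [integral_smul, hf0, smul_zero]

/-- `K` is the operator `(K f)(x) = ∫ f(x') k(x' | x) dx'` on `L²₀` of the posterior, the integral
being absolutely convergent for almost every `x`. -/
def IsDAOperator {n p d : ℕ} (a : ℝ) (X : Matrix (Fin n) (Fin p) ℝ)
    (y : Matrix (Fin n) (Fin d) ℝ) (h : ℝ → ℝ)
    (K : L2Zero (posterior a X y h) →L[ℝ] L2Zero (posterior a X y h)) : Prop :=
  ∀ f : L2Zero (posterior a X y h),
    (∀ᵐ x ∂(posterior a X y h),
      Integrable (fun x' => (f : Lp ℝ 2 (posterior a X y h)) x' * mtd a X y h x' x)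
        (stateVolume p d)) ∧
    ((K f : Lp ℝ 2 (posterior a X y h)) : State p d → ℝ) =ᵐ[posterior a X y h]
      fun x => ∫ x', (f : Lp ℝ 2 (posterior a X y h)) x' * mtd a X y h x' x ∂(stateVolume p d)

/-- Trace-class, for self-adjoint positive operators: compact, with summable eigenvalues, where
each eigenvalue is counted with its multiplicity.  (The nonzero eigenvalues of a compact operator
have finite multiplicity, and the term of the eigenvalue zero is zero.) -/
structure IsPositiveTraceClass {E : Type*} [NormedAddCommGroup E] [InnerProductSpace ℝ E]
    (T : E →L[ℝ] E) : Prop where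
  isPositive : T.IsPositive
  isCompact : IsCompactOperator T
  summable_eigenvalues : Summable fun l : ℝ =>
    (Module.finrank ℝ (Module.End.eigenspace (T : E →ₗ[ℝ] E) l) : ℝ) * |l|

end DAReg

end

/-! Write x for the pair (β, Σ). One step of the chain draws z from π(z|x) and then x' from π(x'|z).
By Bayes' rule π(x'|z) = π(x') π(z|x') / π(z), so k(x'|x) = π(x') ∫ F(x,z) F(x',z) dz with F(x,z) =
π(z|x) / √π(z). Hence K = A*A, where A is the integral operator with kernel F from L²(π) to L²(dz).
Such an operator is positive and self-adjoint; the constant function is an eigenvector, so K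
preserves its orthogonal complement L²₀. By Bessel's inequality the diagonal sums of K over
orthonormal families are at most ∫∫ F² dπ dz = ∫ k(x|x) dx (`sum_inner_gramOp_le`). A positive
operator with bounded diagonal sums is compact with summable eigenvalues
(`isPositiveTraceClass_of_trace_le`), so only the finiteness of this double integral is at stake.

Given z, the density of x is a z-dependent factor times a power of |Σ| times exp(-½ ∑ z_i r_i). The
hypothesis on ψ bounds π(z|x) by exp(½(ζ-1) ∑ z_i r_i) ∏ ν(z_i), which leaves exp(-½(2-ζ) ∑ z_i
r_i). Since ζ < 2 this is the same integrand with z rescaled by 2-ζ, and rescaling costs a factor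
free of z. The integral over x is therefore at most a constant times ∏ ν(z_i), which is integrable
(`lintegral_condNorm_mul_expKernel_mul_condZ_le`). Of the matrix normal and inverse Wishart
integrals one needs the dependence on the scale matrices, obtained by linear substitutions, and
finiteness; the numerical constants do not matter.

The posterior must also be proper, 0 < m(y) < ∞. For finiteness, keep p+d linearly independent
observations. The resulting determinants are bounded by finitely many monomials in z, whose
exponents are matched by (S3), (S4) and the integrability of h (`marginal_ne_top`). -/

namespace DAReg

/-! ### Positive operators with bounded diagonal sums -/

section TraceClass

open scoped InnerProductSpace

variable {E : Type*} [NormedAddCommGroup E] [InnerProductSpace ℝ E]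

/-- Cauchy–Schwarz for the semi-definite form ⟪T ·, ·⟫: its value at x + t y is a nonnegative
quadratic polynomial in t, so the discriminant is not positive. -/
lemma sq_inner_le_of_isPositive {T : E →L[ℝ] E} (hT : T.IsPositive) (x y : E) :
    ⟪T x, y⟫_ℝ ^ 2 ≤ ⟪T x, x⟫_ℝ * ⟪T y, y⟫_ℝ := by
  have hpos : ∀ v : E, 0 ≤ ⟪T v, v⟫_ℝ := fun v => hT.2 v
  have hsym : ⟪T y, x⟫_ℝ = ⟪T x, y⟫_ℝ := by
    rw [real_inner_comm]; exact (hT.1 x y).symm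
  have key : ∀ t : ℝ, 0 ≤ ⟪T y, y⟫_ℝ * (t * t) + (2 * ⟪T x, y⟫_ℝ) * t + ⟪T x, x⟫_ℝ := by
    intro t
    have := hpos (x + t • y)
    simp only [map_add, map_smul, inner_add_left, inner_add_right, real_inner_smul_left,
      real_inner_smul_right, hsym] at this
    linarith
  have := discrim_le_zero key
  rw [discrim] at this
  nlinarith

/-- Cauchy–Schwarz with y = T x, followed by cancelling ‖T x‖². It converts smallness of the
quadratic form into smallness of T in norm. -/
lemma norm_sq_apply_le_of_isPositive {T : E →L[ℝ] E} (hT : T.IsPositive) (x : E) :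
    ‖T x‖ ^ 2 ≤ ‖T‖ * ⟪T x, x⟫_ℝ := by
  have h1 := sq_inner_le_of_isPositive hT x (T x)
  rw [real_inner_self_eq_norm_sq] at h1
  have h2 : ⟪T (T x), T x⟫_ℝ ≤ ‖T‖ * ‖T x‖ ^ 2 := by
    calc ⟪T (T x), T x⟫_ℝ ≤ ‖T (T x)‖ * ‖T x‖ := real_inner_le_norm _ _
      _ ≤ (‖T‖ * ‖T x‖) * ‖T x‖ := by gcongr; exact T.le_opNorm _
      _ = _ := by ring
  have h0 : 0 ≤ ⟪T x, x⟫_ℝ := hT.2 x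
  rcases (sq_nonneg ‖T x‖).eq_or_lt with h | h
  · rw [← h]; positivity
  · refine le_of_mul_le_mul_right ?_ h
    calc ‖T x‖ ^ 2 * ‖T x‖ ^ 2 = (‖T x‖ ^ 2) ^ 2 := by ring
      _ ≤ _ := h1
      _ ≤ ⟪T x, x⟫_ℝ * (‖T‖ * ‖T x‖ ^ 2) := by gcongr
      _ = _ := by ring

lemma orthonormal_option_elim {ι : Type} {e : ι → E} (he : Orthonormal ℝ e) {w : E}
    (hw : ‖w‖ = 1) (horth : ∀ i, ⟪e i, w⟫_ℝ = 0) :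
    Orthonormal ℝ (fun o : Option ι => o.elim w e) := by
  refine ⟨fun o => ?_, fun o o' hne => ?_⟩
  · cases o
    · exact hw
    · exact he.1 _
  · cases o <;> cases o'
    · exact absurd rfl hne
    · simpa [real_inner_comm] using horth _
    · simpa using horth _
    · exact he.2 fun h => hne (congrArg some h)

/-- For an operator of trace at most `M`, the quadratic form is uniformly small off a
finite dimensional subspace. -/
lemma exists_orthonormal_tail_le {T : E →L[ℝ] E} {M : ℝ}
    (hM : ∀ (ι : Type) [Fintype ι] (e : ι → E), Orthonormal ℝ e → ∑ i, ⟪T (e i), e i⟫_ℝ ≤ M)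
    {ε : ℝ} (hε : 0 < ε) :
    ∃ V : Submodule ℝ E, FiniteDimensional ℝ V ∧ ∀ w ∈ Vᗮ, ⟪T w, w⟫_ℝ ≤ ε * ‖w‖ ^ 2 := by
  let S : Set ℝ := {r | ∃ (n : ℕ) (e : Fin n → E), Orthonormal ℝ e ∧ r = ∑ i, ⟪T (e i), e i⟫_ℝ}
  have hne : S.Nonempty := ⟨0, 0, Fin.elim0, ⟨fun i => i.elim0, fun i => i.elim0⟩, by simp⟩
  have hbdd : BddAbove S := ⟨M, by rintro r ⟨n, e, he, rfl⟩; exact hM _ e he⟩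
  -- The family comes within ε of the supremum of all diagonal sums, so one more unit vector
  -- orthogonal to it can contribute at most ε.
  obtain ⟨r, ⟨n, e, he, rfl⟩, hr⟩ := exists_lt_of_lt_csSup hne (sub_lt_self (sSup S) hε)
  refine ⟨Submodule.span ℝ (Set.range e), FiniteDimensional.span_of_finite ℝ (Set.finite_range e),
    fun w hw => ?_⟩
  rcases eq_or_ne w 0 with rfl | hw0
  · simp
  have hnw : 0 < ‖w‖ := norm_pos_iff.2 hw0
  have hunit : ‖(‖w‖⁻¹ • w)‖ = 1 := by
    rw [norm_smul, norm_inv, norm_norm, inv_mul_cancel₀ hnw.ne']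
  have horth : ∀ i, ⟪e i, ‖w‖⁻¹ • w⟫_ℝ = 0 := by
    intro i
    rw [real_inner_smul_right,
      (Submodule.mem_orthogonal _ _).1 hw _ (Submodule.subset_span ⟨i, rfl⟩), mul_zero]
  have hon := orthonormal_option_elim he hunit horth
  have hmem : ∑ o : Option (Fin n), ⟪T (o.elim (‖w‖⁻¹ • w) e), o.elim (‖w‖⁻¹ • w) e⟫_ℝ ∈ S := by
    refine ⟨n + 1, _, hon.comp _ (finSuccEquiv n).injective, ?_⟩
    exact (Equiv.sum_comp (finSuccEquiv n)
      (fun o => ⟪T (o.elim (‖w‖⁻¹ • w) e), o.elim (‖w‖⁻¹ • w) e⟫_ℝ)).symm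
  have hle := le_csSup hbdd hmem
  rw [Fintype.sum_option] at hle
  simp only [Option.elim_none, Option.elim_some, map_smul, real_inner_smul_left,
    real_inner_smul_right] at hle
  have h1 : ‖w‖⁻¹ * (‖w‖⁻¹ * ⟪T w, w⟫_ℝ) ≤ ε := by linarith
  calc ⟪T w, w⟫_ℝ = ‖w‖⁻¹ * (‖w‖⁻¹ * ⟪T w, w⟫_ℝ) * ‖w‖ ^ 2 := by field_simp
    _ ≤ _ := by gcongr

/-- T is a norm limit of the finite rank operators T ∘ P_V, where V is a subspace off which the
quadratic form is at most ε: on Vᗮ one has ‖T w‖² ≤ ‖T‖ ⟪T w, w⟫ ≤ ‖T‖ ε ‖w‖². -/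
lemma isCompactOperator_of_trace_le [CompleteSpace E] {T : E →L[ℝ] E} (hT : T.IsPositive) {M : ℝ}
    (hM : ∀ (ι : Type) [Fintype ι] (e : ι → E), Orthonormal ℝ e →
      ∑ i, ⟪T (e i), e i⟫_ℝ ≤ M) : IsCompactOperator T := by
  suffices h : T ∈ closure {f : E →L[ℝ] E | IsCompactOperator f} by
    have hc := isClosed_setOfPred_isCompactOperator (σ₁₂ := RingHom.id ℝ) (M₁ := E) (M₂ := E)
    exact hc.closure_eq.subset h
  rw [Metric.mem_closure_iff]
  intro δ hδ
  obtain ⟨ε, hε, hεδ⟩ : ∃ ε : ℝ, 0 < ε ∧ ‖T‖ * ε ≤ (δ / 2) ^ 2 := by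
    -- The added 1 covers T = 0.
    refine ⟨(δ / 2) ^ 2 / (‖T‖ + 1), by positivity, ?_⟩
    rw [← mul_div_assoc, div_le_iff₀ (by positivity)]
    nlinarith [sq_nonneg (δ / 2), norm_nonneg T]
  obtain ⟨V, hV, hVε⟩ := exists_orthonormal_tail_le hM hε
  refine ⟨T ∘L V.starProjection, ?_, ?_⟩
  · have : ProperSpace V := FiniteDimensional.proper ℝ V
    have h1 : IsCompactOperator (T ∘L V.subtypeL) :=
      isCompactOperator_of_locallyCompactSpace_rng (T ∘L V.subtypeL)
    exact h1.comp_clm (V.orthogonalProjectionOnto)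
  · rw [dist_eq_norm]
    refine lt_of_le_of_lt (ContinuousLinearMap.opNorm_le_bound _ (half_pos hδ).le fun x => ?_)
      (half_lt_self hδ)
    have hx : (T - T ∘L V.starProjection) x = T (x - V.starProjection x) := by simp
    have hmem : x - V.starProjection x ∈ Vᗮ := Submodule.sub_starProjection_mem_orthogonal x
    have hnorm : ‖x - V.starProjection x‖ ≤ ‖x‖ := by
      have h2 := Submodule.norm_sq_eq_add_norm_sq_starProjection x V
      rw [Submodule.starProjection_orthogonal_val] at h2
      exact le_of_sq_le_sq (by nlinarith [sq_nonneg ‖V.starProjection x‖]) (norm_nonneg _)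
    rw [hx]
    refine le_of_sq_le_sq ?_ (by positivity)
    calc ‖T (x - V.starProjection x)‖ ^ 2
        ≤ ‖T‖ * ⟪T (x - V.starProjection x), x - V.starProjection x⟫_ℝ :=
          norm_sq_apply_le_of_isPositive hT _
      _ ≤ ‖T‖ * (ε * ‖x - V.starProjection x‖ ^ 2) := by gcongr; exact hVε _ hmem
      _ ≤ ‖T‖ * (ε * ‖x‖ ^ 2) := by gcongr
      _ = (‖T‖ * ε) * ‖x‖ ^ 2 := by ring
      _ ≤ (δ / 2) ^ 2 * ‖x‖ ^ 2 := by gcongr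
      _ = _ := by ring

/-- In infinite dimension `finrank` is 0 and the empty family serves, so the eigenspace of 0 needs
no separate treatment below. -/
lemma exists_orthonormal_fin_finrank (V : Submodule ℝ E) :
    ∃ v : Fin (Module.finrank ℝ V) → V, Orthonormal ℝ v := by
  by_cases hV : FiniteDimensional ℝ V
  · exact ⟨stdOrthonormalBasis ℝ V, (stdOrthonormalBasis ℝ V).orthonormal⟩
  · have h0 : Module.finrank ℝ V = 0 := Module.finrank_of_not_finite hV
    have : IsEmpty (Fin (Module.finrank ℝ V)) := by rw [h0]; infer_instance
    exact ⟨isEmptyElim, ⟨isEmptyElim, fun i => isEmptyElim i⟩⟩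

/-- Eigenspaces of a symmetric operator are mutually orthogonal, so orthonormal bases of finitely
many of them form one orthonormal family, whose diagonal sum is the partial sum of multiplicity
times eigenvalue. -/
lemma summable_eigenvalues_of_trace_le {T : E →L[ℝ] E} (hT : T.IsPositive) {M : ℝ}
    (hM : ∀ (ι : Type) [Fintype ι] (e : ι → E), Orthonormal ℝ e →
      ∑ i, ⟪T (e i), e i⟫_ℝ ≤ M) :
    Summable fun l : ℝ =>
      (Module.finrank ℝ (Module.End.eigenspace (T : E →ₗ[ℝ] E) l) : ℝ) * |l| := by
  refine summable_of_sum_le (c := M) (fun l => by positivity) fun u => ?_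
  choose v hv using fun l : u =>
    exists_orthonormal_fin_finrank (Module.End.eigenspace (T : E →ₗ[ℝ] E) (l : ℝ))
  have hfam : OrthogonalFamily ℝ
      (fun l : u => Module.End.eigenspace (T : E →ₗ[ℝ] E) (l : ℝ))
      fun l => (Module.End.eigenspace (T : E →ₗ[ℝ] E) (l : ℝ)).subtypeₗᵢ :=
    (LinearMap.IsSymmetric.orthogonalFamily_eigenspaces (T := (T : E →ₗ[ℝ] E)) hT.1).comp
      Subtype.coe_injective
  have hon := hfam.orthonormal_sigma_orthonormal hv
  have hval : ∀ (l : u) (i), ⟪T (v l i : E), (v l i : E)⟫_ℝ = |(l : ℝ)| := by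
    intro l i
    have h1 : T (v l i : E) = (l : ℝ) • (v l i : E) :=
      Module.End.mem_eigenspace_iff.1 (v l i).2
    have h2 : ⟪T (v l i : E), (v l i : E)⟫_ℝ = l := by
      rw [h1, real_inner_smul_left, real_inner_self_eq_norm_sq]
      have : ‖(v l i : E)‖ = 1 := (hv l).1 i
      rw [this]; ring
    have h3 : 0 ≤ ⟪T (v l i : E), (v l i : E)⟫_ℝ := hT.2 _
    rw [h2] at h3 ⊢
    exact (abs_of_nonneg h3).symm
  refine le_trans (le_of_eq ?_) (hM _ _ hon)
  rw [Fintype.sum_sigma, ← Finset.sum_coe_sort u]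
  refine Finset.sum_congr rfl fun l _ => ?_
  exact ((Finset.sum_congr rfl fun i _ => hval l i).trans (by simp)).symm

/-- A positive operator whose diagonal sums over finite orthonormal families are bounded is
trace-class. -/
theorem isPositiveTraceClass_of_trace_le [CompleteSpace E] {T : E →L[ℝ] E} (hT : T.IsPositive)
    {M : ℝ} (hM : ∀ (ι : Type) [Fintype ι] (e : ι → E), Orthonormal ℝ e →
      ∑ i, ⟪T (e i), e i⟫_ℝ ≤ M) : IsPositiveTraceClass T where
  isPositive := hT
  isCompact := isCompactOperator_of_trace_le hT hM
  summable_eigenvalues := summable_eigenvalues_of_trace_le hT hM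

end TraceClass

/-! ### Integral operators with square integrable kernel, and their Gram operators -/

section HilbertSchmidt

open scoped InnerProductSpace

variable {α β : Type*} [MeasurableSpace α] [MeasurableSpace β]

lemma norm_sq_eq_integral_sq {P : Measure α} (f : Lp ℝ 2 P) : ‖f‖ ^ 2 = ∫ x, f x ^ 2 ∂P := by
  rw [← real_inner_self_eq_norm_sq, L2.inner_def]
  refine integral_congr_ae (Filter.Eventually.of_forall fun x => ?_)
  simp [sq]

lemma inner_toLp_eq_integral {P : Measure α} (f : Lp ℝ 2 P) {g : α → ℝ} (hg : MemLp g 2 P) :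
    ⟪f, hg.toLp g⟫_ℝ = ∫ x, f x * g x ∂P := by
  rw [L2.inner_def]
  refine integral_congr_ae ?_
  filter_upwards [hg.coeFn_toLp] with x hx
  simp [hx, mul_comm]

lemma norm_sq_toLp {P : Measure α} {g : α → ℝ} (hg : MemLp g 2 P) :
    ‖hg.toLp g‖ ^ 2 = ∫ x, g x ^ 2 ∂P := by
  rw [norm_sq_eq_integral_sq]
  refine integral_congr_ae ?_
  filter_upwards [hg.coeFn_toLp] with x hx
  simp [hx]

lemma sq_integral_mul_le {P : Measure α} (f : Lp ℝ 2 P) {g : α → ℝ} (hg : MemLp g 2 P) :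
    (∫ x, f x * g x ∂P) ^ 2 ≤ ‖f‖ ^ 2 * ∫ x, g x ^ 2 ∂P := by
  rw [← inner_toLp_eq_integral f hg, ← norm_sq_toLp hg, ← mul_pow]
  exact sq_le_sq' (by linarith [neg_le_of_abs_le (abs_real_inner_le_norm f (hg.toLp g))])
    (real_inner_le_norm _ _)

lemma sum_sq_integral_mul_le {P : Measure α} {ι : Type*} [Fintype ι] {e : ι → Lp ℝ 2 P}
    (he : Orthonormal ℝ e) {g : α → ℝ} (hg : MemLp g 2 P) :
    ∑ i, (∫ x, e i x * g x ∂P) ^ 2 ≤ ∫ x, g x ^ 2 ∂P := by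
  have := he.sum_inner_products_le (hg.toLp g) (s := Finset.univ)
  rw [norm_sq_toLp] at this
  refine le_trans (le_of_eq (Finset.sum_congr rfl fun i _ => ?_)) this
  rw [inner_toLp_eq_integral, Real.norm_eq_abs, sq_abs]

/-- Seen as the orthogonal complement of the constant 1, the space is closed, hence complete, and
invariant under every symmetric operator with eigenvector 1. -/
lemma mem_L2Zero_iff {P : Measure α} [IsFiniteMeasure P] (f : Lp ℝ 2 P) :
    f ∈ L2Zero P ↔ ⟪(memLp_const (1 : ℝ)).toLp (fun _ : α => (1 : ℝ)), f⟫_ℝ = 0 := by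
  rw [real_inner_comm, inner_toLp_eq_integral]
  simp only [mul_one]
  exact ⟨fun h => h.2, fun h => ⟨(Lp.memLp f).integrable (by norm_num), h⟩⟩

lemma isClosed_L2Zero {P : Measure α} [IsFiniteMeasure P] : IsClosed (L2Zero P : Set (Lp ℝ 2 P)) := by
  have : (L2Zero P : Set (Lp ℝ 2 P)) =
      {f | ⟪(memLp_const (1 : ℝ)).toLp (fun _ : α => (1 : ℝ)), f⟫_ℝ = 0} := by
    ext f; exact mem_L2Zero_iff f
  rw [this]
  exact isClosed_eq (by fun_prop) continuous_const

/-- The tensor product f ⊗ g is square integrable on the product space, so its product with F is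
integrable. This licenses every exchange of integrals below. -/
lemma integrable_mul_mul_kernel {P : Measure α} {lam : Measure β} [SFinite lam]
    {F : α × β → ℝ} (hF : Measurable F)
    (hF2 : Integrable (fun w => F w ^ 2) (P.prod lam)) {f : α → ℝ} {g : β → ℝ}
    (hf : MemLp f 2 P) (hg : MemLp g 2 lam) :
    Integrable (fun w : α × β => f w.1 * g w.2 * F w) (P.prod lam) := by
  have h1 : MemLp (fun w : α × β => f w.1 * g w.2) 2 (P.prod lam) := by
    refine (memLp_two_iff_integrable_sq (hf.1.comp_fst.mul hg.1.comp_snd)).2 ?_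
    refine ((hf.integrable_sq).mul_prod (hg.integrable_sq)).congr
      (Filter.Eventually.of_forall fun w => ?_)
    simp [mul_pow]
  exact h1.integrable_mul ((memLp_two_iff_integrable_sq hF.aestronglyMeasurable).2 hF2)

variable {P : Measure α} {lam : Measure β} [SFinite P] [SFinite lam] {F : α × β → ℝ}

lemma ae_memLp_section (hF : Measurable F)
    (hF2 : Integrable (fun w => F w ^ 2) (P.prod lam)) :
    ∀ᵐ z ∂lam, MemLp (fun x => F (x, z)) 2 P := by
  have h := ((integrable_prod_iff' hF2.1).1 hF2).1
  filter_upwards [h] with z hz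
  exact (memLp_two_iff_integrable_sq
    (hF.comp (measurable_id.prodMk measurable_const)).aestronglyMeasurable).2 hz

lemma stronglyMeasurable_integral_mul (hF : Measurable F) (f : Lp ℝ 2 P) :
    StronglyMeasurable fun z => ∫ x, f x * F (x, z) ∂P := by
  have h : StronglyMeasurable fun w : β × α => f w.2 * F (w.2, w.1) :=
    ((Lp.stronglyMeasurable f).comp_measurable measurable_snd).mul
      (hF.comp measurable_swap).stronglyMeasurable
  exact h.integral_prod_right'

lemma integrable_sq_integral_mul (hF : Measurable F)
    (hF2 : Integrable (fun w => F w ^ 2) (P.prod lam)) (f : Lp ℝ 2 P) :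
    Integrable (fun z => (∫ x, f x * F (x, z) ∂P) ^ 2) lam := by
  refine Integrable.mono' (hF2.integral_prod_right.const_mul (‖f‖ ^ 2))
    ((stronglyMeasurable_integral_mul hF f).pow 2).aestronglyMeasurable ?_
  filter_upwards [ae_memLp_section hF hF2] with z hz
  rw [Real.norm_eq_abs, abs_of_nonneg (sq_nonneg _)]
  exact sq_integral_mul_le f hz

lemma memLp_integral_mul (hF : Measurable F)
    (hF2 : Integrable (fun w => F w ^ 2) (P.prod lam)) (f : Lp ℝ 2 P) :
    MemLp (fun z => ∫ x, f x * F (x, z) ∂P) 2 lam :=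
  (memLp_two_iff_integrable_sq (stronglyMeasurable_integral_mul hF f).aestronglyMeasurable).2
    (integrable_sq_integral_mul hF hF2 f)

/-- The integral operator `f ↦ ∫ f x * F (x, ·)` with a square integrable kernel. -/
noncomputable def hilbertSchmidtOp (hF : Measurable F) (hF2 : Integrable (fun w => F w ^ 2) (P.prod lam)) :
    Lp ℝ 2 P →L[ℝ] Lp ℝ 2 lam :=
  LinearMap.mkContinuous
    { toFun := fun f => (memLp_integral_mul hF hF2 f).toLp _
      map_add' := fun f g => by
        rw [← MemLp.toLp_add, MemLp.toLp_eq_toLp_iff]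
        filter_upwards [ae_memLp_section hF hF2] with z hz
        rw [Pi.add_apply, ← inner_toLp_eq_integral (f + g) hz, inner_add_left,
          inner_toLp_eq_integral, inner_toLp_eq_integral]
      map_smul' := fun c f => by
        rw [RingHom.id_apply, ← MemLp.toLp_const_smul, MemLp.toLp_eq_toLp_iff]
        filter_upwards [ae_memLp_section hF hF2] with z hz
        rw [Pi.smul_apply, ← inner_toLp_eq_integral (c • f) hz, real_inner_smul_left,
          inner_toLp_eq_integral, smul_eq_mul] }
    -- The Hilbert–Schmidt norm of the kernel: Cauchy–Schwarz in x for almost every z, then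
    -- integration over z.
    (Real.sqrt (∫ w, F w ^ 2 ∂(P.prod lam))) fun f => by
      refine le_of_sq_le_sq ?_ (by positivity)
      have h0 : 0 ≤ ∫ w, F w ^ 2 ∂(P.prod lam) := integral_nonneg fun w => sq_nonneg _
      rw [mul_pow, Real.sq_sqrt h0]
      simp only [LinearMap.coe_mk, AddHom.coe_mk]
      rw [norm_sq_toLp, integral_prod_symm _ hF2, mul_comm, ← integral_const_mul]
      refine integral_mono_ae (integrable_sq_integral_mul hF hF2 f)
        (hF2.integral_prod_right.const_mul _) ?_
      filter_upwards [ae_memLp_section hF hF2] with z hz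
      exact sq_integral_mul_le f hz

lemma coeFn_hilbertSchmidtOp (hF : Measurable F)
    (hF2 : Integrable (fun w => F w ^ 2) (P.prod lam)) (f : Lp ℝ 2 P) :
    hilbertSchmidtOp hF hF2 f =ᵐ[lam] fun z => ∫ x, f x * F (x, z) ∂P :=
  (memLp_integral_mul hF hF2 f).coeFn_toLp

lemma integrable_sq_swap (hF2 : Integrable (fun w => F w ^ 2) (P.prod lam)) :
    Integrable (fun w : β × α => (F ∘ Prod.swap) w ^ 2) (lam.prod P) := hF2.swap

lemma adjoint_hilbertSchmidtOp (hF : Measurable F)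
    (hF2 : Integrable (fun w => F w ^ 2) (P.prod lam)) :
    ContinuousLinearMap.adjoint (hilbertSchmidtOp hF hF2) =
      hilbertSchmidtOp (hF.comp measurable_swap) (integrable_sq_swap hF2) := by
  symm
  rw [ContinuousLinearMap.eq_adjoint_iff]
  intro g f
  rw [L2.inner_def, L2.inner_def]
  have hint := integrable_mul_mul_kernel hF hF2 (Lp.memLp f) (Lp.memLp g)
  calc _ = ∫ x, ∫ z, f x * g z * F (x, z) ∂lam ∂P := by
        refine integral_congr_ae ?_
        filter_upwards [coeFn_hilbertSchmidtOp (hF.comp measurable_swap)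
          (integrable_sq_swap hF2) g] with x hx
        rw [hx]
        simp only [RCLike.inner_apply, conj_trivial, Function.comp_apply, Prod.swap_prod_mk]
        rw [← integral_const_mul]
        congr 1; ext z; ring
    _ = ∫ z, ∫ x, f x * g z * F (x, z) ∂P ∂lam := integral_integral_swap hint
    _ = _ := by
        refine integral_congr_ae ?_
        filter_upwards [coeFn_hilbertSchmidtOp hF hF2 f] with z hz
        rw [hz]
        simp only [RCLike.inner_apply, conj_trivial]
        rw [← integral_mul_const]
        congr 1; ext x; ring

/-- The symmetric kernel `(x, x') ↦ ∫ F (x, z) F (x', z) dz`. -/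
noncomputable def symmKernel (lam : Measure β) (F : α × β → ℝ) (x x' : α) : ℝ := ∫ z, F (x, z) * F (x', z) ∂lam

/-- The positive integral operator with kernel `symmKernel lam F`. -/
noncomputable def gramOp (hF : Measurable F) (hF2 : Integrable (fun w => F w ^ 2) (P.prod lam)) :
    Lp ℝ 2 P →L[ℝ] Lp ℝ 2 P :=
  ContinuousLinearMap.adjoint (hilbertSchmidtOp hF hF2) ∘L hilbertSchmidtOp hF hF2

lemma ae_integrable_mul_symmKernel (hF : Measurable F)
    (hF2 : Integrable (fun w => F w ^ 2) (P.prod lam)) (f : Lp ℝ 2 P) :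
    ∀ᵐ x ∂P, Integrable (fun x' => f x' * symmKernel lam F x x') P := by
  filter_upwards [ae_memLp_section (hF.comp measurable_swap) (integrable_sq_swap hF2)] with x hx
  have h := (integrable_mul_mul_kernel hF hF2 (Lp.memLp f) hx).integral_prod_left
  refine h.congr (Filter.Eventually.of_forall fun x' => ?_)
  simp only [symmKernel]
  rw [← integral_const_mul]
  congr 1; ext z
  simp only [Function.comp_apply, Prod.swap_prod_mk]; ring

lemma coeFn_gramOp (hF : Measurable F)
    (hF2 : Integrable (fun w => F w ^ 2) (P.prod lam)) (f : Lp ℝ 2 P) :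
    gramOp hF hF2 f =ᵐ[P] fun x => ∫ x', f x' * symmKernel lam F x x' ∂P := by
  rw [gramOp, adjoint_hilbertSchmidtOp, ContinuousLinearMap.comp_apply]
  filter_upwards [coeFn_hilbertSchmidtOp (hF.comp measurable_swap) (integrable_sq_swap hF2)
      (hilbertSchmidtOp hF hF2 f),
    ae_memLp_section (hF.comp measurable_swap) (integrable_sq_swap hF2)] with x hx hx2
  rw [hx]
  have hint := integrable_mul_mul_kernel hF hF2 (Lp.memLp f) hx2
  calc _ = ∫ z, ∫ x', f x' * F (x, z) * F (x', z) ∂P ∂lam := by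
        refine integral_congr_ae ?_
        filter_upwards [coeFn_hilbertSchmidtOp hF hF2 f] with z hz
        rw [hz]
        simp only [Function.comp_apply, Prod.swap_prod_mk]
        rw [← integral_mul_const]
        congr 1; ext x'; ring
    _ = ∫ x', ∫ z, f x' * F (x, z) * F (x', z) ∂lam ∂P := (integral_integral_swap hint).symm
    _ = _ := by
        congr 1; ext x'
        rw [symmKernel, ← integral_const_mul]
        congr 1; ext z; ring

lemma gramOp_isPositive (hF : Measurable F)
    (hF2 : Integrable (fun w => F w ^ 2) (P.prod lam)) : (gramOp hF hF2).IsPositive :=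
  ContinuousLinearMap.isPositive_adjoint_comp_self _

/-- Each diagonal term is ∫ ⟪e_i, F(·, z)⟫² dz. For almost every z Bessel's inequality bounds the
sum over i by ‖F(·, z)‖², and integration over z gives the trace bound. -/
lemma sum_inner_gramOp_le (hF : Measurable F)
    (hF2 : Integrable (fun w => F w ^ 2) (P.prod lam)) {ι : Type*} [Fintype ι]
    {e : ι → Lp ℝ 2 P} (he : Orthonormal ℝ e) :
    ∑ i, ⟪gramOp hF hF2 (e i), e i⟫_ℝ ≤ ∫ w, F w ^ 2 ∂(P.prod lam) := by
  have h1 : ∀ i, ⟪gramOp hF hF2 (e i), e i⟫_ℝ = ∫ z, (∫ x, e i x * F (x, z) ∂P) ^ 2 ∂lam := by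
    intro i
    rw [gramOp, ContinuousLinearMap.comp_apply, ContinuousLinearMap.adjoint_inner_left,
      real_inner_self_eq_norm_sq, norm_sq_eq_integral_sq]
    refine integral_congr_ae ?_
    filter_upwards [coeFn_hilbertSchmidtOp hF hF2 (e i)] with z hz
    rw [hz]
  simp_rw [h1]
  rw [← integral_finsetSum _ fun i _ => integrable_sq_integral_mul hF hF2 (e i),
    integral_prod_symm _ hF2]
  refine integral_mono_ae (integrable_finsetSum _ fun i _ => integrable_sq_integral_mul hF hF2 _)
    hF2.integral_prod_right ?_
  filter_upwards [ae_memLp_section hF hF2] with z hz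
  exact sum_sq_integral_mul_le he hz

/-- If `symmKernel lam F` is, up to a constant, a Markov kernel density with respect to `P`, then
its integral operator restricts to a positive trace-class operator on `L2Zero P`. -/
theorem exists_isPositiveTraceClass_symmKernel [IsFiniteMeasure P] (hF : Measurable F)
    (hF2 : Integrable (fun w => F w ^ 2) (P.prod lam)) {C : ℝ}
    (hC : ∀ᵐ x ∂P, ∫ x', symmKernel lam F x x' ∂P = C) :
    ∃ K : L2Zero P →L[ℝ] L2Zero P, IsPositiveTraceClass K ∧ ∀ f : L2Zero P,
      (∀ᵐ x ∂P, Integrable (fun x' => (f : Lp ℝ 2 P) x' * symmKernel lam F x x') P) ∧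
      ((K f : Lp ℝ 2 P) : α → ℝ) =ᵐ[P]
        fun x => ∫ x', (f : Lp ℝ 2 P) x' * symmKernel lam F x x' ∂P := by
  set one : Lp ℝ 2 P := (memLp_const (1 : ℝ)).toLp (fun _ : α => (1 : ℝ)) with hone
  -- The constant function is an eigenvector. The value of C plays no role, so conditional densities
  -- need not be shown to integrate to one.
  have hK1 : gramOp hF hF2 one = C • one := by
    refine Lp.ext ?_
    filter_upwards [coeFn_gramOp hF hF2 one, hC, Lp.coeFn_smul C one,
      (memLp_const (p := 2) (μ := P) (1 : ℝ)).coeFn_toLp] with x h1 h2 h3 h4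
    rw [h1, h3, Pi.smul_apply, hone, h4, ← hone, smul_eq_mul, mul_one, ← h2]
    refine integral_congr_ae ?_
    filter_upwards [(memLp_const (p := 2) (μ := P) (1 : ℝ)).coeFn_toLp] with x' h5
    rw [hone, h5, one_mul]
  -- By symmetry ⟪1, G f⟫ = ⟪G 1, f⟫ = C ⟪1, f⟫ = 0.
  have hmap : ∀ f ∈ L2Zero P, gramOp hF hF2 f ∈ L2Zero P := by
    intro f hf
    rw [mem_L2Zero_iff] at hf ⊢
    have := (gramOp_isPositive hF hF2).1 one f
    simp only [ContinuousLinearMap.coe_coe] at this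
    rw [← hone] at hf ⊢
    rw [← this, hK1, real_inner_smul_left, hf, mul_zero]
  have : CompleteSpace (L2Zero P) := isClosed_L2Zero.completeSpace_coe
  let K : L2Zero P →L[ℝ] L2Zero P :=
    ((gramOp hF hF2) ∘L (L2Zero P).subtypeL).codRestrict (L2Zero P) fun f => hmap f f.2
  have hK : ∀ f : L2Zero P, (K f : Lp ℝ 2 P) = gramOp hF hF2 f := fun f => rfl
  refine ⟨K, isPositiveTraceClass_of_trace_le (M := ∫ w, F w ^ 2 ∂(P.prod lam)) ⟨?_, ?_⟩ ?_, ?_⟩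
  · intro f g
    exact (gramOp_isPositive hF hF2).1 f g
  · intro f
    exact (gramOp_isPositive hF hF2).2 f
  · intro ι _ e he
    exact sum_inner_gramOp_le hF hF2 (he.comp_linearIsometry (L2Zero P).subtypeₗᵢ)
  · intro f
    exact ⟨ae_integrable_mul_symmKernel hF hF2 f, coeFn_gramOp hF hF2 f⟩

end HilbertSchmidt

/-! ### Symmetric matrices in coordinates, and Jacobians -/

section Jacobian

variable {d p : ℕ}

/-- The coordinates of the symmetric part of a square matrix. -/
noncomputable def symCoord : Matrix (Fin d) (Fin d) ℝ →ₗ[ℝ] (Sym2 (Fin d) → ℝ) where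
  toFun A q := Sym2.lift ⟨fun i j => (A i j + A j i) / 2, fun i j => by simp only [add_comm]⟩ q
  map_add' A B := by
    ext q; induction q with | _ i j => simp; ring
  map_smul' c A := by
    ext q; induction q with | _ i j => simp; ring

@[simp] lemma symCoord_mk (A : Matrix (Fin d) (Fin d) ℝ) (i j : Fin d) :
    symCoord A s(i, j) = (A i j + A j i) / 2 := rfl

@[simp] lemma symMat_apply (σ : Sym2 (Fin d) → ℝ) (i j : Fin d) : symMat σ i j = σ s(i, j) := rfl

lemma symMat_transpose (σ : Sym2 (Fin d) → ℝ) : (symMat σ)ᵀ = symMat σ := by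
  ext i j; simp [Sym2.eq_swap]

lemma symMat_symCoord {A : Matrix (Fin d) (Fin d) ℝ} (hA : Aᵀ = A) : symMat (symCoord A) = A := by
  ext i j
  have : A j i = A i j := congrFun (congrFun hA i) j
  simp [this]

/-- The linear map `Σ ↦ R Σ Rᵀ` in coordinates. -/
noncomputable def symConj (R : Matrix (Fin d) (Fin d) ℝ) : (Sym2 (Fin d) → ℝ) →ₗ[ℝ] (Sym2 (Fin d) → ℝ) where
  toFun σ := symCoord (R * symMat σ * Rᵀ)
  map_add' σ τ := by
    rw [← map_add, ← Matrix.add_mul, ← Matrix.mul_add]; rfl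
  map_smul' c σ := by
    rw [RingHom.id_apply, ← map_smul, ← Matrix.smul_mul, ← Matrix.mul_smul]; rfl

lemma symMat_symConj (R : Matrix (Fin d) (Fin d) ℝ) (σ : Sym2 (Fin d) → ℝ) :
    symMat (symConj R σ) = R * symMat σ * Rᵀ := by
  refine symMat_symCoord ?_
  simp [Matrix.transpose_mul, symMat_transpose, Matrix.mul_assoc]

lemma symConj_mul (A B : Matrix (Fin d) (Fin d) ℝ) :
    symConj (A * B) = symConj A ∘ₗ symConj B := by
  ext1; ext1
  rw [LinearMap.comp_apply, LinearMap.comp_apply, LinearMap.comp_apply]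
  conv_rhs => rw [symConj, LinearMap.coe_mk, AddHom.coe_mk, symMat_symConj]
  simp [symConj, Matrix.mul_assoc]

/-- Among the pairs i ≤ j, a given index is the smaller entry d - i times and the larger entry i + 1
times (indices start at 0), so it is counted d + 1 times, the diagonal pair counting twice. -/
lemma prod_sym2_mul (r : Fin d → ℝ) :
    ∏ q : Sym2 (Fin d), Sym2.lift ⟨fun i j => r i * r j, fun _ _ => mul_comm _ _⟩ q =
      (∏ i, r i) ^ (d + 1) := by
  rw [← Equiv.prod_comp Sym2.sortEquiv.symm]
  have h1 : ∀ x : {x : Fin d × Fin d // x.1 ≤ x.2},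
      Sym2.lift ⟨fun i j => r i * r j, fun i j => mul_comm _ _⟩ (Sym2.sortEquiv.symm x) =
        r x.1.1 * r x.1.2 := fun x => rfl
  simp_rw [h1]
  rw [← Finset.prod_subtype (Finset.univ.filter fun x : Fin d × Fin d => x.1 ≤ x.2) (by simp)
    (fun x => r x.1 * r x.2), Finset.prod_mul_distrib, Finset.prod_filter, Finset.prod_filter,
    Fintype.prod_prod_type, Fintype.prod_prod_type_right, ← Finset.prod_mul_distrib,
    ← Finset.prod_pow]
  refine Finset.prod_congr rfl fun i _ => ?_
  rw [← Finset.prod_filter, ← Finset.prod_filter]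
  simp only [Finset.prod_const, ← pow_add]
  congr 1
  have h2 : (Finset.univ.filter fun j : Fin d => i ≤ j) = Finset.Ici i := by ext; simp
  have h3 : (Finset.univ.filter fun j : Fin d => j ≤ i) = Finset.Iic i := by ext; simp
  rw [h2, h3, Fin.card_Ici, Fin.card_Iic]
  omega

lemma det_symConj_diagonal (r : Fin d → ℝ) :
    LinearMap.det (symConj (Matrix.diagonal r)) = (Matrix.diagonal r).det ^ (d + 1) := by
  have : symConj (Matrix.diagonal r) = Matrix.toLin' (Matrix.diagonal fun q : Sym2 (Fin d) =>
      Sym2.lift ⟨fun i j => r i * r j, fun i j => mul_comm _ _⟩ q) := by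
    refine LinearMap.ext fun σ => ?_
    ext q
    induction q with | _ i j =>
    simp [symConj, Matrix.mulVec_diagonal, Matrix.diagonal_transpose, Sym2.eq_swap (a := j)]
    ring
  rw [this, LinearMap.det_toLin', Matrix.det_diagonal, Matrix.det_diagonal, prod_sym2_mul]

lemma det_symConj_mul (A B : Matrix (Fin d) (Fin d) ℝ) :
    LinearMap.det (symConj (A * B)) = LinearMap.det (symConj A) * LinearMap.det (symConj B) := by
  rw [symConj_mul, LinearMap.det_comp]

lemma det_symConj_one : LinearMap.det (symConj (1 : Matrix (Fin d) (Fin d) ℝ)) = 1 := by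
  rw [← Matrix.diagonal_one, det_symConj_diagonal]; simp

/-- Let D be diagonal with entry 2 at i and 1 elsewhere. Conjugation by D doubles the off-diagonal
entry c, so it maps the transvection to its own square. By multiplicativity the determinant δ
satisfies δ = δ², and δ ≠ 0 because transvections are invertible. -/
lemma det_symConj_transvection (i j : Fin d) (hij : i ≠ j) (c : ℝ) :
    LinearMap.det (symConj (Matrix.transvection i j c)) = 1 := by
  let D : Matrix (Fin d) (Fin d) ℝ := Matrix.diagonal (Function.update 1 i 2)
  let D' : Matrix (Fin d) (Fin d) ℝ := Matrix.diagonal (Function.update 1 i (1 / 2))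
  have hDD : D * D' = 1 := by
    rw [Matrix.diagonal_mul_diagonal, ← Matrix.diagonal_one]
    congr 1; ext k
    rcases eq_or_ne k i with rfl | hk
    · simp
    · simp [hk]
  have hconj : D * Matrix.transvection i j c * D' =
      Matrix.transvection i j c * Matrix.transvection i j c := by
    rw [Matrix.transvection_mul_transvection_same _ _ hij]
    ext k l
    simp only [D, D', Matrix.mul_diagonal, Matrix.diagonal_mul, Matrix.transvection,
      Matrix.add_apply, Matrix.one_apply, Matrix.single_apply, Function.update_apply]
    rcases eq_or_ne k i with rfl | hk
    · rcases eq_or_ne l k with rfl | hl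
      · simp [hij.symm]
      · simp [hl, hl.symm]; split_ifs <;> ring
    · simp only [hk, hk.symm, if_false, false_and]
      rcases eq_or_ne k l with rfl | hl
      · simp [hk]
      · simp [hl]
  have h1 := congrArg (fun A => LinearMap.det (symConj A)) hconj
  have h2 := congrArg (fun A => LinearMap.det (symConj A)) hDD
  have h3 : Matrix.transvection i j c * Matrix.transvection i j (-c) = 1 := by
    rw [Matrix.transvection_mul_transvection_same _ _ hij]; simp
  have h4 := congrArg (fun A => LinearMap.det (symConj A)) h3
  simp only [det_symConj_mul, det_symConj_one] at h1 h2 h4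
  have h5 : LinearMap.det (symConj (Matrix.transvection i j c)) ≠ 0 := left_ne_zero_of_mul_eq_one h4
  have h6 : LinearMap.det (symConj (Matrix.transvection i j c)) *
      (LinearMap.det (symConj D) * LinearMap.det (symConj D')) =
      LinearMap.det (symConj (Matrix.transvection i j c)) *
        LinearMap.det (symConj (Matrix.transvection i j c)) := by rw [← h1]; ring
  rw [h2] at h6
  exact (mul_left_cancel₀ h5 h6).symm

/-- The Jacobian of `Σ ↦ R Σ Rᵀ` on symmetric matrices is `|R| ^ (d + 1)`. -/
theorem det_symConj (R : Matrix (Fin d) (Fin d) ℝ) :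
    LinearMap.det (symConj R) = R.det ^ (d + 1) := by
  -- Both sides are multiplicative in R, and every matrix is a product of transvections and a
  -- diagonal matrix.
  refine Matrix.diagonal_transvection_induction
    (fun R => LinearMap.det (symConj R) = R.det ^ (d + 1)) R (fun r _ => det_symConj_diagonal r)
    (fun t => ?_) fun A B hA hB => ?_
  · rw [t.det, one_pow]
    exact det_symConj_transvection t.i t.j t.hij t.c
  · rw [det_symConj_mul, hA, hB, Matrix.det_mul, mul_pow]

/-- The linear map `β ↦ M β Rᵀ`. -/
noncomputable def matConj (M : Matrix (Fin p) (Fin p) ℝ) (R : Matrix (Fin d) (Fin d) ℝ) :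
    (Fin p → Fin d → ℝ) →ₗ[ℝ] (Fin p → Fin d → ℝ) where
  toFun β := M * Matrix.of β * Rᵀ
  map_add' β γ := by
    change M * (Matrix.of β + Matrix.of γ) * Rᵀ = _
    rw [Matrix.mul_add, Matrix.add_mul]; rfl
  map_smul' c β := by
    change M * (c • Matrix.of β) * Rᵀ = _
    rw [Matrix.mul_smul, Matrix.smul_mul]; rfl

lemma of_matConj (M : Matrix (Fin p) (Fin p) ℝ) (R : Matrix (Fin d) (Fin d) ℝ)
    (β : Fin p → Fin d → ℝ) : Matrix.of (matConj M R β) = M * Matrix.of β * Rᵀ := rfl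

/-- Matrices as vectors, by columns. -/
noncomputable def vecEquiv (p d : ℕ) : (Fin p → Fin d → ℝ) ≃ₗ[ℝ] (Fin d × Fin p → ℝ) where
  toFun β := Matrix.vec (Matrix.of β)
  invFun v i j := v (j, i)
  map_add' _ _ := rfl
  map_smul' _ _ := rfl
  left_inv _ := rfl
  right_inv _ := rfl

/-- The Jacobian of `β ↦ M β Rᵀ` on `p × d` matrices. -/
theorem det_matConj (M : Matrix (Fin p) (Fin p) ℝ) (R : Matrix (Fin d) (Fin d) ℝ) :
    LinearMap.det (matConj M R) = M.det ^ d * R.det ^ p := by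
  have h : (vecEquiv p d : _ →ₗ[ℝ] _) ∘ₗ matConj M R ∘ₗ ((vecEquiv p d).symm : _ →ₗ[ℝ] _) =
      Matrix.toLin' (Matrix.kroneckerMap (· * ·) R M) := by
    refine LinearMap.ext fun v => ?_
    obtain ⟨β, rfl⟩ := (vecEquiv p d).surjective v
    rw [Matrix.toLin'_apply]
    change _ = Matrix.kroneckerMap (· * ·) R M *ᵥ Matrix.vec (Matrix.of β)
    rw [Matrix.kronecker_mulVec_vec]
    simp
    rfl
  rw [← LinearMap.det_conj (matConj M R) (vecEquiv p d), h, LinearMap.det_toLin',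
    Matrix.det_kronecker, mul_comm]
  simp

lemma lintegral_comp_linearMap {E : Type*} [NormedAddCommGroup E] [NormedSpace ℝ E]
    [FiniteDimensional ℝ E] [MeasurableSpace E] [BorelSpace E] (μ : Measure E) [μ.IsAddHaarMeasure]
    {T : E →ₗ[ℝ] E} (hT : LinearMap.det T ≠ 0) {f : E → ℝ≥0∞} (hf : Measurable f) :
    ∫⁻ x, f x ∂μ = ENNReal.ofReal |LinearMap.det T| * ∫⁻ x, f (T x) ∂μ := by
  have h1 := Measure.map_linearMap_addHaar_eq_smul_addHaar μ hT
  have hTm : Measurable T := T.continuous_of_finiteDimensional.measurable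
  have h2 : ∫⁻ x, f (T x) ∂μ = ENNReal.ofReal |(LinearMap.det T)⁻¹| * ∫⁻ x, f x ∂μ := by
    rw [← lintegral_map hf hTm, h1, lintegral_smul_measure, smul_eq_mul]
  rw [h2, ← mul_assoc, ← ENNReal.ofReal_mul (abs_nonneg _), ← abs_mul, mul_inv_cancel₀ hT]
  simp

end Jacobian

/-! ### Measurability of matrix operations -/

section Measurability

variable {γ : Type*} [MeasurableSpace γ] {ι κ τ : Type*} [Fintype ι]

lemma measurable_mul_apply {A : γ → Matrix κ ι ℝ} {B : γ → Matrix ι τ ℝ}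
    (hA : ∀ i j, Measurable fun x => A x i j) (hB : ∀ i j, Measurable fun x => B x i j) (i : κ)
    (j : τ) : Measurable fun x => (A x * B x) i j := by
  simp only [Matrix.mul_apply]
  exact Finset.measurable_fun_sum _ fun k _ => (hA i k).mul (hB k j)

lemma measurable_trace {A : γ → Matrix ι ι ℝ} (hA : ∀ i j, Measurable fun x => A x i j) :
    Measurable fun x => (A x).trace := by
  simp only [Matrix.trace, Matrix.diag_apply]
  exact Finset.measurable_fun_sum _ fun k _ => hA k k

lemma measurable_det [DecidableEq ι] {A : γ → Matrix ι ι ℝ}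
    (hA : ∀ i j, Measurable fun x => A x i j) : Measurable fun x => (A x).det := by
  simp only [Matrix.det_apply']
  exact Finset.measurable_fun_sum _ fun k _ =>
    measurable_const.mul (Finset.measurable_fun_prod _ fun i _ => hA _ _)

lemma measurable_inv_apply [DecidableEq ι] {A : γ → Matrix ι ι ℝ}
    (hA : ∀ i j, Measurable fun x => A x i j) (i j : ι) : Measurable fun x => (A x)⁻¹ i j := by
  simp only [Matrix.inv_def, Ring.inverse_eq_inv', Matrix.smul_apply, Matrix.adjugate_apply,
    smul_eq_mul]
  refine (measurable_det hA).inv.mul (measurable_det fun k l => ?_)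
  simp only [Matrix.updateRow_apply]
  split_ifs
  · exact measurable_const
  · exact hA k l

end Measurability

/-! ### The cone of positive definite matrices -/

section PosDef

variable {d : ℕ}

lemma isClosed_setOf_posSemidef_symMat :
    IsClosed {σ : Sym2 (Fin d) → ℝ | (symMat σ).PosSemidef} := by
  have : {σ : Sym2 (Fin d) → ℝ | (symMat σ).PosSemidef} =
      ⋂ x : Fin d → ℝ, {σ | 0 ≤ x ⬝ᵥ (symMat σ *ᵥ x)} := by
    ext σ
    simp only [mem_ofPred_eq, mem_iInter, Matrix.posSemidef_iff_dotProduct_mulVec, star_trivial]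
    refine ⟨fun h => h.2, fun h => ⟨?_, h⟩⟩
    rw [Matrix.IsHermitian, Matrix.conjTranspose_eq_transpose_of_trivial, symMat_transpose]
  rw [this]
  refine isClosed_iInter fun x => isClosed_le continuous_const ?_
  simp only [dotProduct, Matrix.mulVec, symMat_apply]
  fun_prop

lemma measurableSet_posDef : MeasurableSet {σ : Sym2 (Fin d) → ℝ | (symMat σ).PosDef} := by
  have : {σ : Sym2 (Fin d) → ℝ | (symMat σ).PosDef} =
      {σ | (symMat σ).PosSemidef} ∩ {σ | (symMat σ).det ≠ 0} := by
    ext σ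
    exact ⟨fun h => ⟨h.posSemidef, h.det_pos.ne'⟩, fun h => (h.1.posDef_iff_det_ne_zero).2 h.2⟩
  rw [this]
  refine isClosed_setOf_posSemidef_symMat.measurableSet.inter ?_
  have hm : Measurable fun σ : Sym2 (Fin d) → ℝ => (symMat σ).det :=
    measurable_det fun i j => measurable_pi_apply _
  exact (hm (measurableSet_singleton 0)).compl

open scoped MatrixOrder in
-- The factor R supplies the substitutions that reduce integrals with scale matrix S to the identity
-- scale; |det R| then enters the Jacobian.
lemma exists_mul_transpose_eq {ι : Type*} [Fintype ι] [DecidableEq ι] {S : Matrix ι ι ℝ}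
    (hS : S.PosDef) : ∃ R : Matrix ι ι ℝ, S = R * Rᵀ ∧ R.det ≠ 0 ∧
      |R.det| = S.det ^ ((1 : ℝ) / 2) ∧ Rᵀ * S⁻¹ * R = 1 := by
  obtain ⟨B, hB⟩ := CStarAlgebra.nonneg_iff_eq_star_mul_self.mp hS.posSemidef.nonneg
  have hB' : S = Bᵀ * Bᵀᵀ := by
    rw [hB, Matrix.transpose_transpose, Matrix.star_eq_conjTranspose,
      Matrix.conjTranspose_eq_transpose_of_trivial]
  have hdet : S.det = (Bᵀ).det ^ 2 := by
    rw [hB', Matrix.det_mul, Matrix.det_transpose, sq]; simp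
  have hne : (Bᵀ).det ≠ 0 := by
    intro h
    have := hS.det_pos
    rw [hdet, h] at this
    simp at this
  refine ⟨Bᵀ, hB', hne, ?_, ?_⟩
  · rw [hdet, ← Real.sqrt_eq_rpow, Real.sqrt_sq_eq_abs]
  · have hu : IsUnit (Bᵀ).det := hne.isUnit
    have hu' : IsUnit (Bᵀᵀ).det := by rwa [Matrix.det_transpose]
    rw [hB', Matrix.mul_inv_rev, ← Matrix.mul_assoc, Matrix.mul_nonsing_inv _ hu', Matrix.one_mul,
      Matrix.nonsing_inv_mul _ hu]

end PosDef

/-! ### The matrix Gaussian integral -/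

section Gaussian

variable {p d : ℕ}

/-- `∫ exp (-½ tr (βᵀ β)) dβ` over `p × d` matrices. -/
noncomputable def gaussConst (p d : ℕ) : ℝ≥0∞ :=
  ∫⁻ β : Fin p → Fin d → ℝ, ENNReal.ofReal (Real.exp (-(1 / 2) *
    ((Matrix.of β)ᵀ * Matrix.of β).trace))

/-- Finiteness suffices; the value of the constant is not needed. The integrand is a product of
one-dimensional Gaussians over the entries. -/
lemma gaussConst_lt_top (p d : ℕ) : gaussConst p d < ∞ := by
  have h1 : Integrable fun x : ℝ => Real.exp (-(1 / 2) * x ^ 2) :=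
    integrable_exp_neg_mul_sq (by norm_num)
  have h2 : Integrable fun v : Fin d → ℝ => ∏ j, Real.exp (-(1 / 2) * v j ^ 2) :=
    Integrable.fintype_prod fun _ => h1
  have h3 : Integrable fun β : Fin p → Fin d → ℝ => ∏ i, ∏ j, Real.exp (-(1 / 2) * β i j ^ 2) :=
    Integrable.fintype_prod (f := fun _ (v : Fin d → ℝ) => ∏ j, Real.exp (-(1 / 2) * v j ^ 2))
      fun _ => h2
  refine lt_of_le_of_lt (le_of_eq ?_) h3.lintegral_lt_top
  refine lintegral_congr fun β => ?_
  simp_rw [← Real.exp_sum]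
  congr 2
  simp only [Matrix.trace, Matrix.diag_apply, Matrix.mul_apply, Matrix.transpose_apply,
    Matrix.of_apply, ← Finset.mul_sum]
  rw [Finset.sum_comm]
  simp [sq]

lemma measurable_gauss_integrand (A : Matrix (Fin d) (Fin d) ℝ) (N : Matrix (Fin p) (Fin p) ℝ) :
    Measurable fun β : Fin p → Fin d → ℝ => ENNReal.ofReal (Real.exp (-(1 / 2) *
      (A * ((Matrix.of β)ᵀ * N * Matrix.of β)).trace)) := by
  have hβ : ∀ i j, Measurable fun β : Fin p → Fin d → ℝ => (Matrix.of β) i j := fun i j =>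
    (measurable_pi_apply j).comp (measurable_pi_apply i)
  refine ENNReal.measurable_ofReal.comp (Real.measurable_exp.comp (measurable_const.mul ?_))
  refine measurable_trace (measurable_mul_apply (fun _ _ => measurable_const) ?_)
  exact measurable_mul_apply (measurable_mul_apply (fun i j => hβ j i)
    fun _ _ => measurable_const) hβ

/-- The matrix Gaussian integral. -/
theorem lintegral_matrix_gaussian {V : Matrix (Fin d) (Fin d) ℝ} (hV : V.PosDef)
    {N : Matrix (Fin p) (Fin p) ℝ} (hN : N.PosDef) (θ : Matrix (Fin p) (Fin d) ℝ) :
    ∫⁻ β : Fin p → Fin d → ℝ, ENNReal.ofReal (Real.exp (-(1 / 2) *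
      (V⁻¹ * ((Matrix.of β - θ)ᵀ * N * (Matrix.of β - θ))).trace)) =
    gaussConst p d * ENNReal.ofReal (V.det ^ ((p : ℝ) / 2) * N.det ^ (-(d : ℝ) / 2)) := by
  -- With V = R Rᵀ and N⁻¹ = M Mᵀ, the substitution β ↦ θ + M β Rᵀ turns the exponent into -½ tr(βᵀ
  -- β), since Mᵀ N M = 1 and Rᵀ V⁻¹ R = 1.
  obtain ⟨R, -, hR0, hRdet, hR1⟩ := exists_mul_transpose_eq hV
  obtain ⟨M, -, hM0, hMdet, hM1⟩ := exists_mul_transpose_eq hN.inv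
  rw [Matrix.nonsing_inv_nonsing_inv _ hN.det_pos.ne'.isUnit] at hM1
  have htrans := lintegral_sub_right_eq_self (μ := (volume : Measure (Fin p → Fin d → ℝ)))
    (fun β : Fin p → Fin d → ℝ => ENNReal.ofReal (Real.exp (-(1 / 2) *
      (V⁻¹ * ((Matrix.of β)ᵀ * N * Matrix.of β)).trace))) (fun i j => θ i j)
  have hdet : LinearMap.det (matConj M R) ≠ 0 := by
    rw [det_matConj]; positivity
  have hlin := lintegral_comp_linearMap (volume : Measure (Fin p → Fin d → ℝ)) hdet
    (measurable_gauss_integrand V⁻¹ N)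
  refine htrans.trans (hlin.trans ?_)
  rw [mul_comm, gaussConst, det_matConj]
  congr 1
  · refine lintegral_congr fun β => ?_
    congr 3
    rw [of_matConj]
    have : V⁻¹ * ((M * Matrix.of β * Rᵀ)ᵀ * N * (M * Matrix.of β * Rᵀ)) =
        V⁻¹ * R * ((Matrix.of β)ᵀ * (Mᵀ * N * M) * Matrix.of β) * Rᵀ := by
      simp only [Matrix.transpose_mul, Matrix.transpose_transpose, Matrix.mul_assoc]
    rw [this, hM1, Matrix.mul_one, Matrix.trace_mul_comm, ← Matrix.mul_assoc, ← Matrix.mul_assoc Rᵀ,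
      hR1, Matrix.one_mul]
  · congr 1
    rw [abs_mul, abs_pow, abs_pow, hRdet, hMdet, ← Real.rpow_mul_natCast hV.det_pos.le,
      ← Real.rpow_mul_natCast hN.inv.det_pos.le, Matrix.det_nonsing_inv, Ring.inverse_eq_inv',
      Real.inv_rpow hN.det_pos.le, ← Real.rpow_neg hN.det_pos.le, mul_comm]
    congr 2 <;> ring

end Gaussian

/-! ### The inverse Wishart integral as a function of its scale -/

section Wishart

variable {d : ℕ}

/-- The unnormalised inverse Wishart density with parameters `m` and `S⁻¹`. -/
noncomputable def wishartKernel (m : ℝ) (S V : Matrix (Fin d) (Fin d) ℝ) : ℝ :=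
  V.det ^ (-(m + d + 1) / 2) * Real.exp (-(1 / 2) * (V⁻¹ * S).trace)

/-- The integral of the unnormalised inverse Wishart density with scale the identity. -/
noncomputable def wishartConst (d : ℕ) (m : ℝ) : ℝ≥0∞ :=
  ∫⁻ σ in {σ : Sym2 (Fin d) → ℝ | (symMat σ).PosDef}, ENNReal.ofReal (wishartKernel m 1 (symMat σ))

lemma measurable_wishartKernel (m : ℝ) (S : Matrix (Fin d) (Fin d) ℝ) :
    Measurable fun σ : Sym2 (Fin d) → ℝ => wishartKernel m S (symMat σ) := by
  have hσ : ∀ i j, Measurable fun σ : Sym2 (Fin d) → ℝ => symMat σ i j := fun i j =>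
    measurable_pi_apply _
  exact ((measurable_det hσ).pow_const _).mul (Real.measurable_exp.comp (measurable_const.mul
    (measurable_trace (measurable_mul_apply (measurable_inv_apply hσ) fun _ _ =>
      measurable_const))))

lemma posDef_symMat_symConj_iff {R : Matrix (Fin d) (Fin d) ℝ} (hR : R.det ≠ 0)
    (σ : Sym2 (Fin d) → ℝ) : (symMat (symConj R σ)).PosDef ↔ (symMat σ).PosDef := by
  have hu : IsUnit R := (Matrix.isUnit_iff_isUnit_det R).2 hR.isUnit
  rw [symMat_symConj, ← Matrix.conjTranspose_eq_transpose_of_trivial,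
    ← Matrix.star_eq_conjTranspose]
  exact Matrix.IsUnit.posDef_star_right_conjugate_iff hu

/-- The inverse Wishart integral, as a function of the scale matrix. -/
theorem lintegral_wishartKernel (m : ℝ) {S : Matrix (Fin d) (Fin d) ℝ} (hS : S.PosDef) :
    ∫⁻ σ in {σ : Sym2 (Fin d) → ℝ | (symMat σ).PosDef},
      ENNReal.ofReal (wishartKernel m S (symMat σ)) =
    wishartConst d m * ENNReal.ofReal (S.det ^ (-m / 2)) := by
  -- Substitute Σ ↦ R Σ Rᵀ with S = R Rᵀ. The Jacobian |S|^((d+1)/2) times the factor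
  -- |S|^(-(m+d+1)/2) from the integrand leaves |S|^(-m/2).
  obtain ⟨R, hSR, hR0, hRdet, hR1⟩ := exists_mul_transpose_eq hS
  have hdet : LinearMap.det (symConj R) ≠ 0 := by
    rw [det_symConj]; positivity
  rw [wishartConst, ← lintegral_indicator measurableSet_posDef,
    ← lintegral_indicator measurableSet_posDef,
    lintegral_comp_linearMap volume hdet
      (((measurable_wishartKernel m S).ennreal_ofReal).indicator measurableSet_posDef),
    mul_comm, ← lintegral_mul_const' _ _ ENNReal.ofReal_ne_top,
    ← lintegral_mul_const' _ _ ENNReal.ofReal_ne_top]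
  refine lintegral_congr fun σ => ?_
  by_cases hσ : (symMat σ).PosDef
  · have hσ' := (posDef_symMat_symConj_iff hR0 σ).2 hσ
    rw [indicator_of_mem (by exact hσ'), indicator_of_mem (by exact hσ),
      ← ENNReal.ofReal_mul' (abs_nonneg _), ← ENNReal.ofReal_mul' (by have := hS.det_pos; positivity)]
    congr 1
    rw [wishartKernel, wishartKernel, symMat_symConj, det_symConj, Matrix.det_mul, Matrix.det_mul,
      Matrix.det_transpose]
    have hsd := hσ.det_pos
    have hSd := hS.det_pos
    have h1 : R.det * (symMat σ).det * R.det = S.det * (symMat σ).det := by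
      rw [hSR, Matrix.det_mul, Matrix.det_transpose]; ring
    have hu : IsUnit R.det := hR0.isUnit
    have hu' : IsUnit (Rᵀ).det := by rwa [Matrix.det_transpose]
    have h2 : ((R * symMat σ * Rᵀ)⁻¹ * S).trace = ((symMat σ)⁻¹ * 1).trace := by
      rw [Matrix.mul_inv_rev, Matrix.mul_inv_rev, hSR, Matrix.mul_one]
      have : Rᵀ⁻¹ * ((symMat σ)⁻¹ * R⁻¹) * (R * Rᵀ) = Rᵀ⁻¹ * ((symMat σ)⁻¹ * (R⁻¹ * R) * Rᵀ) := by
        simp only [Matrix.mul_assoc]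
      rw [this, Matrix.nonsing_inv_mul _ hu, Matrix.mul_one, Matrix.trace_mul_comm,
        Matrix.mul_assoc, Matrix.mul_nonsing_inv _ hu', Matrix.mul_one]
    rw [h1, h2, abs_pow, hRdet, Real.mul_rpow hSd.le hsd.le, ← Real.rpow_mul_natCast hSd.le]
    have h3 : S.det ^ (-m / 2) =
        S.det ^ (-(m + d + 1) / 2) * S.det ^ (1 / 2 * ((d + 1 : ℕ) : ℝ)) := by
      rw [← Real.rpow_add hSd]; congr 1; push_cast; ring
    rw [h3]; ring
  · have hσ' := fun h => hσ ((posDef_symMat_symConj_iff hR0 σ).1 h)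
    rw [indicator_of_notMem (by exact hσ'), indicator_of_notMem (by exact hσ), zero_mul, zero_mul]

end Wishart

/-! ### Bordered symmetric matrices and Schur complements -/

section SchurCoordinates

variable {d : ℕ}

/-- The symmetric matrix with diagonal blocks `V`, `s` and off-diagonal block `v`. -/
noncomputable def borderedMat (V : Matrix (Fin d) (Fin d) ℝ) (v : Fin d → ℝ) (s : ℝ) :
    Matrix (Fin d ⊕ Fin 1) (Fin d ⊕ Fin 1) ℝ :=
  Matrix.fromBlocks V (Matrix.replicateCol (Fin 1) v) (Matrix.replicateRow (Fin 1) v)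
    (Matrix.of fun _ _ => s)

lemma schurComplement_borderedMat (V : Matrix (Fin d) (Fin d) ℝ) (v : Fin d → ℝ) (s : ℝ) :
    (Matrix.of fun _ _ => s) - Matrix.replicateRow (Fin 1) v * V⁻¹ * Matrix.replicateCol (Fin 1) v =
      (Matrix.of fun _ _ => s - v ⬝ᵥ (V⁻¹ *ᵥ v) : Matrix (Fin 1) (Fin 1) ℝ) := by
  ext i j
  rw [Matrix.mul_assoc]
  simp [Matrix.mul_apply, dotProduct, Matrix.mulVec]

lemma det_borderedMat {V : Matrix (Fin d) (Fin d) ℝ} (hV : V.det ≠ 0) (v : Fin d → ℝ) (s : ℝ) :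
    (borderedMat V v s).det = V.det * (s - v ⬝ᵥ (V⁻¹ *ᵥ v)) := by
  have := Matrix.invertibleOfIsUnitDet V hV.isUnit
  rw [borderedMat, Matrix.det_fromBlocks₁₁, Matrix.invOf_eq_nonsing_inv,
    schurComplement_borderedMat, Matrix.det_fin_one, Matrix.of_apply]

/-- With Schur complement t, block inversion gives the diagonal blocks V⁻¹ + t⁻¹ (V⁻¹v)(V⁻¹v)ᵀ and
t⁻¹. -/
lemma trace_inv_borderedMat {V : Matrix (Fin d) (Fin d) ℝ} (hV : V.det ≠ 0) (hVs : Vᵀ = V)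
    (v : Fin d → ℝ) (s : ℝ) (hs : s - v ⬝ᵥ (V⁻¹ *ᵥ v) ≠ 0) :
    (borderedMat V v s)⁻¹.trace = V⁻¹.trace +
      (1 + (V⁻¹ *ᵥ v) ⬝ᵥ (V⁻¹ *ᵥ v)) / (s - v ⬝ᵥ (V⁻¹ *ᵥ v)) := by
  have hB : (borderedMat V v s).det ≠ 0 := by
    rw [det_borderedMat hV]; exact mul_ne_zero hV hs
  set t := s - v ⬝ᵥ (V⁻¹ *ᵥ v) with ht
  have i1 := Matrix.invertibleOfIsUnitDet V hV.isUnit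
  have hS := schurComplement_borderedMat V v s
  have i2 : Invertible ((Matrix.of fun _ _ => s : Matrix (Fin 1) (Fin 1) ℝ) -
      Matrix.replicateRow (Fin 1) v * ⅟V * Matrix.replicateCol (Fin 1) v) := by
    refine Matrix.invertibleOfIsUnitDet _ ?_
    rw [Matrix.invOf_eq_nonsing_inv, hS, Matrix.det_fin_one]
    exact hs.isUnit
  have i3 : Invertible (Matrix.fromBlocks V (Matrix.replicateCol (Fin 1) v)
      (Matrix.replicateRow (Fin 1) v) (Matrix.of fun _ _ => s)) :=
    Matrix.invertibleOfIsUnitDet _ hB.isUnit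
  have hT : (Matrix.of fun _ _ => t : Matrix (Fin 1) (Fin 1) ℝ)⁻¹ = Matrix.of fun _ _ => t⁻¹ := by
    refine Matrix.inv_eq_right_inv ?_
    ext i j
    fin_cases i; fin_cases j
    simp [Matrix.mul_apply, hs]
  have htrace : ∀ (A : Matrix (Fin d) (Fin d) ℝ) (B : Matrix (Fin d) (Fin 1) ℝ)
      (C : Matrix (Fin 1) (Fin d) ℝ) (D : Matrix (Fin 1) (Fin 1) ℝ),
      (Matrix.fromBlocks A B C D).trace = A.trace + D.trace := fun A B C D => by
    simp [Matrix.trace, Fintype.sum_sum_type]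
  rw [borderedMat, ← Matrix.invOf_eq_nonsing_inv, Matrix.invOf_fromBlocks₁₁_eq,
    htrace, Matrix.trace_add]
  simp only [Matrix.invOf_eq_nonsing_inv, hS]
  rw [← ht, hT]
  have h1 : (V⁻¹ * Matrix.replicateCol (Fin 1) v *
      (Matrix.of fun _ _ => t⁻¹ : Matrix (Fin 1) (Fin 1) ℝ) *
      Matrix.replicateRow (Fin 1) v * V⁻¹).trace = t⁻¹ * ((V⁻¹ *ᵥ v) ⬝ᵥ (V⁻¹ *ᵥ v)) := by
    have hr : Matrix.replicateRow (Fin 1) v * V⁻¹ = (Matrix.replicateRow (Fin 1) (V⁻¹ *ᵥ v)) := by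
      rw [← Matrix.replicateRow_vecMul, ← Matrix.mulVec_transpose, Matrix.transpose_nonsing_inv,
        hVs]
    rw [Matrix.mul_assoc, hr, ← Matrix.replicateCol_mulVec, Matrix.trace_mul_comm,
      ← Matrix.mul_assoc, Matrix.trace_fin_one]
    simp [Matrix.mul_apply, dotProduct, mul_comm]
  rw [h1, Matrix.trace_fin_one, Matrix.of_apply]
  field_simp
  ring

/-- The decomposition of the index set of symmetric matrices along the last row. -/
noncomputable def sym2SuccMap (d : ℕ) : (Sym2 (Fin d) ⊕ Fin d) ⊕ Fin 1 → Sym2 (Fin (d + 1)) :=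
  Sum.elim (Sum.elim (Sym2.map Fin.castSucc) fun i => s(Fin.castSucc i, Fin.last d))
    fun _ => s(Fin.last d, Fin.last d)

lemma sym2SuccMap_bijective (d : ℕ) : Function.Bijective (sym2SuccMap d) := by
  constructor
  · have h1 : ∀ (q : Sym2 (Fin d)) (i : Fin (d + 1)),
        q.map Fin.castSucc ≠ s(i, Fin.last d) := by
      intro q i h
      have : Fin.last d ∈ q.map Fin.castSucc := by rw [h]; simp
      obtain ⟨j, -, hj⟩ := Sym2.mem_map.1 this
      exact (Fin.castSucc_lt_last j).ne hj
    rintro ((q | i) | k) ((q' | i') | k') h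
    · exact congrArg _ (congrArg _ (Sym2.map.injective (Fin.castSucc_injective d) h))
    · exact absurd h (h1 _ _)
    · exact absurd h (h1 _ _)
    · exact absurd h.symm (h1 _ _)
    · simp only [sym2SuccMap, Sum.elim_inl, Sum.elim_inr] at h
      rw [Sym2.congr_left] at h
      rw [Fin.castSucc_injective d h]
    · simp only [sym2SuccMap, Sum.elim_inl, Sum.elim_inr] at h
      rw [Sym2.congr_left] at h
      exact absurd h (Fin.castSucc_lt_last i).ne
    · exact absurd h.symm (h1 _ _)
    · simp only [sym2SuccMap, Sum.elim_inl, Sum.elim_inr] at h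
      rw [Sym2.congr_left] at h
      exact absurd h.symm (Fin.castSucc_lt_last i').ne
    · rw [Subsingleton.elim k k']
  · intro q
    induction q with | _ i j =>
    induction i using Fin.lastCases with
    | last =>
      induction j using Fin.lastCases with
      | last => exact ⟨Sum.inr 0, rfl⟩
      | cast j => exact ⟨Sum.inl (Sum.inr j), Sym2.eq_swap⟩
    | cast i =>
      induction j using Fin.lastCases with
      | last => exact ⟨Sum.inl (Sum.inr i), rfl⟩
      | cast j => exact ⟨Sum.inl (Sum.inl s(i, j)), rfl⟩

/-- The index equivalence underlying `sym2SuccMap`. -/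
noncomputable def sym2SuccEquiv (d : ℕ) : (Sym2 (Fin d) ⊕ Fin d) ⊕ Fin 1 ≃ Sym2 (Fin (d + 1)) :=
  Equiv.ofBijective _ (sym2SuccMap_bijective d)

/-- The coordinates of a bordered symmetric matrix. -/
noncomputable def borderedCoord (w : ((Sym2 (Fin d) → ℝ) × (Fin d → ℝ)) × ℝ) : Sym2 (Fin (d + 1)) → ℝ :=
  fun q => Sum.elim (Sum.elim w.1.1 w.1.2) (fun _ => w.2) ((sym2SuccEquiv d).symm q)

/-- Bordering only relabels coordinates through `sym2SuccEquiv`, so product Lebesgue measure is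
preserved. -/
lemma measurePreserving_borderedCoord :
    MeasurePreserving (borderedCoord (d := d)) volume volume := by
  have h1 : MeasurePreserving (fun w : ((Sym2 (Fin d) → ℝ) × (Fin d → ℝ)) × ℝ =>
      (((MeasurableEquiv.sumPiEquivProdPi fun _ => ℝ).symm w.1,
        (MeasurableEquiv.funUnique (Fin 1) ℝ).symm w.2) :
          (Sym2 (Fin d) ⊕ Fin d → ℝ) × (Fin 1 → ℝ))) volume volume :=
    (volume_measurePreserving_sumPiEquivProdPi_symm fun _ => ℝ).prod
      ((volume_preserving_funUnique (Fin 1) ℝ).symm _)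
  have h2 := (volume_measurePreserving_sumPiEquivProdPi_symm
    fun _ : (Sym2 (Fin d) ⊕ Fin d) ⊕ Fin 1 => ℝ).comp h1
  have h3 := (volume_measurePreserving_piCongrLeft (fun _ => ℝ) (sym2SuccEquiv d)).comp h2
  convert h3 using 1
  funext w q
  obtain ⟨x, rfl⟩ := (sym2SuccEquiv d).surjective q
  rw [Function.comp_apply, MeasurableEquiv.coe_piCongrLeft, Equiv.piCongrLeft_apply_apply,
    borderedCoord, Equiv.symm_apply_apply]
  rcases x with (q | i) | k <;> rfl

lemma symMat_borderedCoord (w : ((Sym2 (Fin d) → ℝ) × (Fin d → ℝ)) × ℝ) :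
    (symMat (borderedCoord w)).submatrix finSumFinEquiv finSumFinEquiv =
      borderedMat (symMat w.1.1) w.1.2 w.2 := by
  have key : ∀ x, borderedCoord w (sym2SuccMap d x) =
      Sum.elim (Sum.elim w.1.1 w.1.2) (fun _ => w.2) x := by
    intro x
    rw [borderedCoord]
    exact congrArg _ ((sym2SuccEquiv d).symm_apply_apply x)
  have hlast : ∀ k : Fin 1, Fin.natAdd d k = Fin.last d := by
    intro k; rw [Subsingleton.elim k 0]; rfl
  ext i j
  rw [Matrix.submatrix_apply, symMat_apply]
  rcases i with i | i <;> rcases j with j | j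
  · exact key (Sum.inl (Sum.inl s(i, j)))
  · rw [finSumFinEquiv_apply_left, finSumFinEquiv_apply_right, hlast]
    exact key (Sum.inl (Sum.inr i))
  · rw [finSumFinEquiv_apply_left, finSumFinEquiv_apply_right, hlast, Sym2.eq_swap]
    exact key (Sum.inl (Sum.inr j))
  · rw [finSumFinEquiv_apply_right, finSumFinEquiv_apply_right, hlast, hlast]
    exact key (Sum.inr 0)

lemma det_submatrix_finSumFinEquiv (A : Matrix (Fin (d + 1)) (Fin (d + 1)) ℝ) :
    (A.submatrix (finSumFinEquiv (m := d) (n := 1)) finSumFinEquiv).det = A.det :=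
  Matrix.det_submatrix_equiv_self _ _

lemma trace_inv_submatrix_finSumFinEquiv (A : Matrix (Fin (d + 1)) (Fin (d + 1)) ℝ) :
    (A.submatrix (finSumFinEquiv (m := d) (n := 1)) finSumFinEquiv)⁻¹.trace = A⁻¹.trace := by
  rw [Matrix.inv_submatrix_equiv]
  exact Equiv.sum_comp (finSumFinEquiv (m := d) (n := 1)) fun i => A⁻¹ i i

end SchurCoordinates

/-! ### Finiteness of the inverse Wishart integral, by induction on the dimension -/

section WishartFinite

/-- `∫ exp (-½ |w|²) dw` over `ℝ ^ d`. -/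
noncomputable def vecGaussConst (d : ℕ) : ℝ≥0∞ :=
  ∫⁻ w : Fin d → ℝ, ENNReal.ofReal (Real.exp (-(1 / 2) * (w ⬝ᵥ w)))

lemma vecGaussConst_lt_top (d : ℕ) : vecGaussConst d < ∞ := by
  have h1 : Integrable fun x : ℝ => Real.exp (-(1 / 2) * x ^ 2) :=
    integrable_exp_neg_mul_sq (by norm_num)
  have h2 : Integrable fun v : Fin d → ℝ => ∏ j, Real.exp (-(1 / 2) * v j ^ 2) :=
    Integrable.fintype_prod fun _ => h1
  refine lt_of_le_of_lt (le_of_eq ?_) h2.lintegral_lt_top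
  refine lintegral_congr fun v => ?_
  simp_rw [← Real.exp_sum, ← Finset.mul_sum, dotProduct, sq]

/-- Substitute v = √t V w, whose Jacobian is t^(d/2) |V|. -/
lemma lintegral_vec_gaussian {d : ℕ} {V : Matrix (Fin d) (Fin d) ℝ} (hV : 0 < V.det) {t : ℝ}
    (ht : 0 < t) :
    ∫⁻ v : Fin d → ℝ, ENNReal.ofReal (Real.exp (-(1 / 2) * ((V⁻¹ *ᵥ v) ⬝ᵥ (V⁻¹ *ᵥ v) / t))) =
      vecGaussConst d * ENNReal.ofReal (V.det * t ^ ((d : ℝ) / 2)) := by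
  have hdet : LinearMap.det (Matrix.toLin' (Real.sqrt t • V)) = V.det * t ^ ((d : ℝ) / 2) := by
    rw [LinearMap.det_toLin', Matrix.det_smul, Fintype.card_fin, Real.sqrt_eq_rpow,
      ← Real.rpow_mul_natCast ht.le, mul_comm]
    congr 2; ring
  have hpos : 0 < V.det * t ^ ((d : ℝ) / 2) := by positivity
  rw [lintegral_comp_linearMap volume (T := Matrix.toLin' (Real.sqrt t • V))
    (by rw [hdet]; exact hpos.ne'), hdet, abs_of_pos hpos, mul_comm, vecGaussConst]
  · congr 1
    refine lintegral_congr fun w => ?_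
    have h1 : V⁻¹ *ᵥ (Matrix.toLin' (Real.sqrt t • V) w) = Real.sqrt t • w := by
      rw [Matrix.toLin'_apply, Matrix.mulVec_mulVec, Matrix.mul_smul,
        Matrix.nonsing_inv_mul _ hV.ne'.isUnit, Matrix.smul_mulVec, Matrix.one_mulVec]
    rw [h1, smul_dotProduct, dotProduct_smul, smul_eq_mul, smul_eq_mul, ← mul_assoc,
      Real.mul_self_sqrt ht.le, mul_div_cancel_left₀ _ ht.ne']
  · have : Continuous fun v : Fin d → ℝ =>
        Real.exp (-(1 / 2) * ((V⁻¹ *ᵥ v) ⬝ᵥ (V⁻¹ *ᵥ v) / t)) := by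
      simp only [dotProduct, Matrix.mulVec]
      fun_prop
    exact this.measurable.ennreal_ofReal

lemma integrableOn_rpow_mul_exp_neg_inv {m : ℝ} (hm : 0 < m) :
    IntegrableOn (fun t : ℝ => t ^ (-(m + 2) / 2) * Real.exp (-(1 / 2) * (1 / t))) (Ioi 0) := by
  have h1 : IntegrableOn (fun u : ℝ => u ^ (m / 2 - 1) * Real.exp (-(1 / 2) * u ^ (1 : ℝ)))
      (Ioi 0) :=
    integrableOn_rpow_mul_exp_neg_mul_rpow (by linarith) one_pos (by norm_num)
  -- The inversion u = 1/t reduces the claim to a Gamma integral of shape m/2.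
  have h2 := (integrableOn_Ioi_comp_rpow_iff _ (p := -1) (by norm_num)).2 h1
  refine h2.congr_fun (fun t (ht : 0 < t) => ?_) measurableSet_Ioi
  simp only [abs_neg, abs_one, one_mul, Real.rpow_one, smul_eq_mul]
  rw [← Real.rpow_mul ht.le, ← mul_assoc, ← Real.rpow_add ht, Real.rpow_neg_one, one_div t]
  congr 2
  ring

lemma wishartConst_zero_lt_top (m : ℝ) : wishartConst 0 m < ∞ := by
  rw [wishartConst]
  have h1 : ∀ σ : Sym2 (Fin 0) → ℝ, ENNReal.ofReal (wishartKernel m 1 (symMat σ)) = 1 := by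
    intro σ
    simp [wishartKernel, Matrix.trace]
  simp_rw [h1]
  rw [lintegral_const, one_mul]
  refine lt_of_le_of_lt (measure_mono (subset_univ _)) ?_
  have h2 : (volume : Measure (Sym2 (Fin 0) → ℝ)) = Measure.dirac isEmptyElim := by
    rw [volume_pi]; exact Measure.pi_of_empty _
  rw [h2]
  exact measure_lt_top _ _

/-- With t the Schur complement of V, |Σ| = |V| t and tr Σ⁻¹ = tr V⁻¹ + (1 + |V⁻¹v|²)/t. The kernel
thus splits into a function of V, a function of t and a Gaussian in v, which drives the induction.
-/
lemma wishartKernel_borderedCoord_le {d : ℕ} (m : ℝ)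
    (w : ((Sym2 (Fin d) → ℝ) × (Fin d → ℝ)) × ℝ)
    (hw : (symMat (borderedCoord w)).PosDef) :
    (symMat w.1.1).PosDef ∧ 0 < w.2 - w.1.2 ⬝ᵥ ((symMat w.1.1)⁻¹ *ᵥ w.1.2) ∧
    wishartKernel m 1 (symMat (borderedCoord w)) =
      ((symMat w.1.1).det ^ (-(m + d + 2) / 2) * Real.exp (-(1 / 2) * (symMat w.1.1)⁻¹.trace)) *
      ((w.2 - w.1.2 ⬝ᵥ ((symMat w.1.1)⁻¹ *ᵥ w.1.2)) ^ (-(m + d + 2) / 2) *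
        Real.exp (-(1 / 2) * (1 / (w.2 - w.1.2 ⬝ᵥ ((symMat w.1.1)⁻¹ *ᵥ w.1.2))))) *
      Real.exp (-(1 / 2) * (((symMat w.1.1)⁻¹ *ᵥ w.1.2) ⬝ᵥ ((symMat w.1.1)⁻¹ *ᵥ w.1.2) /
        (w.2 - w.1.2 ⬝ᵥ ((symMat w.1.1)⁻¹ *ᵥ w.1.2)))) := by
  have hB : (borderedMat (symMat w.1.1) w.1.2 w.2).PosDef := by
    rw [← symMat_borderedCoord]
    exact hw.submatrix finSumFinEquiv.injective
  have hV : (symMat w.1.1).PosDef := by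
    have := hB.submatrix (Sum.inl_injective (β := Fin 1) (α := Fin d))
    exact this
  have hdet := det_borderedMat hV.det_pos.ne' w.1.2 w.2
  have ht : 0 < w.2 - w.1.2 ⬝ᵥ ((symMat w.1.1)⁻¹ *ᵥ w.1.2) := by
    have := hB.det_pos
    rw [hdet] at this
    exact pos_of_mul_pos_right this hV.det_pos.le
  refine ⟨hV, ht, ?_⟩
  have htr := trace_inv_borderedMat hV.det_pos.ne' (symMat_transpose _) w.1.2 w.2 ht.ne'
  rw [← symMat_borderedCoord, det_submatrix_finSumFinEquiv] at hdet
  rw [← symMat_borderedCoord, trace_inv_submatrix_finSumFinEquiv] at htr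
  rw [wishartKernel, Matrix.mul_one, hdet, htr, Real.mul_rpow hV.det_pos.le ht.le]
  have h1 : -(m + ((d + 1 : ℕ) : ℝ) + 1) / 2 = -(m + d + 2) / 2 := by push_cast; ring
  rw [h1, add_div, mul_add, mul_add, Real.exp_add, Real.exp_add]
  ring

/-- Convergence of the inverse Wishart integral. -/
theorem wishartConst_lt_top (d : ℕ) : ∀ m : ℝ, (d : ℝ) - 1 < m → wishartConst d m < ∞ := by
  induction d with
  | zero => exact fun m _ => wishartConst_zero_lt_top m
  | succ d ih =>
    intro m hm
    push_cast at hm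
    have hm0 : 0 < m := by have : (0 : ℝ) ≤ d := Nat.cast_nonneg d; linarith
    let A : (Sym2 (Fin d) → ℝ) → ℝ≥0∞ := fun σ => ENNReal.ofReal
      ((symMat σ).det ^ (-(m + d + 2) / 2) * Real.exp (-(1 / 2) * (symMat σ)⁻¹.trace))
    let B : ℝ → ℝ≥0∞ := fun t => ENNReal.ofReal
      (t ^ (-(m + d + 2) / 2) * Real.exp (-(1 / 2) * (1 / t)))
    let G : (Sym2 (Fin d) → ℝ) → (Fin d → ℝ) → ℝ → ℝ≥0∞ := fun σ v t => ENNReal.ofReal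
      (Real.exp (-(1 / 2) * (((symMat σ)⁻¹ *ᵥ v) ⬝ᵥ ((symMat σ)⁻¹ *ᵥ v) / t)))
    let P : Set (Sym2 (Fin d) → ℝ) := {σ | (symMat σ).PosDef}
    have hBm : Measurable B := by
      refine Measurable.ennreal_ofReal ?_
      exact (measurable_id.pow_const _).mul (Real.measurable_exp.comp
        (measurable_const.mul (measurable_const.div measurable_id)))
    have hGm : ∀ σ, Measurable fun x : (Fin d → ℝ) × ℝ => G σ x.1 x.2 := by
      intro σ
      refine Measurable.ennreal_ofReal (Real.measurable_exp.comp
        (measurable_const.mul (Measurable.div ?_ measurable_snd)))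
      simp only [dotProduct, Matrix.mulVec]
      fun_prop
    set f : (Sym2 (Fin (d + 1)) → ℝ) → ℝ≥0∞ :=
      {σ : Sym2 (Fin (d + 1)) → ℝ | (symMat σ).PosDef}.indicator
        fun σ => ENNReal.ofReal (wishartKernel m 1 (symMat σ)) with hf
    have hfm : Measurable f :=
      ((measurable_wishartKernel m 1).ennreal_ofReal).indicator measurableSet_posDef
    have hpt : ∀ w : ((Sym2 (Fin d) → ℝ) × (Fin d → ℝ)) × ℝ, f (borderedCoord w) ≤
        P.indicator A w.1.1 *
          (Ioi (0 : ℝ)).indicator (fun t => B t * G w.1.1 w.1.2 t)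
            (w.2 - w.1.2 ⬝ᵥ ((symMat w.1.1)⁻¹ *ᵥ w.1.2)) := by
      intro w
      by_cases hw : (symMat (borderedCoord w)).PosDef
      · obtain ⟨h1, h2, h3⟩ := wishartKernel_borderedCoord_le m w hw
        rw [hf, indicator_of_mem (by exact hw), indicator_of_mem (by exact h1),
          indicator_of_mem (by exact h2), h3]
        have h4 := h1.det_pos
        rw [ENNReal.ofReal_mul (by positivity), ENNReal.ofReal_mul (by positivity), mul_assoc]
      · rw [hf, indicator_of_notMem (by exact hw)]
        exact zero_le
    -- For fixed V and v the Schur complement is a translate of the corner entry s, so t may replace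
    -- s as variable. The Gaussian integral in v then contributes |V| t^(d/2).
    have hinner : ∀ σ ∈ P, ∫⁻ v : Fin d → ℝ, ∫⁻ s : ℝ,
        (Ioi (0 : ℝ)).indicator (fun t => B t * G σ v t) (s - v ⬝ᵥ ((symMat σ)⁻¹ *ᵥ v)) =
        vecGaussConst d * (∫⁻ t in Ioi (0 : ℝ), B t * ENNReal.ofReal (t ^ ((d : ℝ) / 2))) *
          ENNReal.ofReal (symMat σ).det := by
      intro σ hσ
      have hdet : 0 < (symMat σ).det := Matrix.PosDef.det_pos hσ
      calc _ = ∫⁻ v : Fin d → ℝ, ∫⁻ t in Ioi (0 : ℝ), B t * G σ v t := by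
            refine lintegral_congr fun v => ?_
            rw [lintegral_sub_right_eq_self (fun s : ℝ => (Ioi (0 : ℝ)).indicator
              (fun t => B t * G σ v t) s), lintegral_indicator measurableSet_Ioi]
        _ = ∫⁻ t in Ioi (0 : ℝ), ∫⁻ v : Fin d → ℝ, B t * G σ v t :=
            lintegral_lintegral_swap
              ((hBm.comp measurable_snd).mul (hGm σ)).aemeasurable
        _ = ∫⁻ t in Ioi (0 : ℝ), (B t * ENNReal.ofReal (t ^ ((d : ℝ) / 2))) *
              (vecGaussConst d * ENNReal.ofReal (symMat σ).det) := by
            refine setLIntegral_congr_fun measurableSet_Ioi fun t ht => ?_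
            rw [lintegral_const_mul' _ _ ENNReal.ofReal_ne_top, lintegral_vec_gaussian hdet ht,
              ENNReal.ofReal_mul hdet.le]
            ring
        _ = _ := by
            rw [lintegral_mul_const' _ _
              (ENNReal.mul_ne_top (vecGaussConst_lt_top d).ne ENNReal.ofReal_ne_top)]
            ring
    -- The factor t^(d/2) raises the exponent of t to -(m+2)/2, which is integrable for m > 0.
    have hBfin : ∫⁻ t in Ioi (0 : ℝ), B t * ENNReal.ofReal (t ^ ((d : ℝ) / 2)) < ∞ := by
      refine lt_of_le_of_lt (le_of_eq ?_) (integrableOn_rpow_mul_exp_neg_inv hm0).lintegral_lt_top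
      refine setLIntegral_congr_fun measurableSet_Ioi fun t (ht : 0 < t) => ?_
      rw [← ENNReal.ofReal_mul (by positivity)]
      congr 1
      rw [mul_right_comm, ← Real.rpow_add ht]
      congr 2
      ring
    -- The extra factor |V| raises the exponent to -((m-1)+d+1)/2: the d-dimensional integral with
    -- parameter m - 1. The condition d < m becomes d - 1 < m - 1, as the induction requires.
    have hσint : ∫⁻ σ in P, A σ * ENNReal.ofReal (symMat σ).det = wishartConst d (m - 1) := by
      refine setLIntegral_congr_fun measurableSet_posDef fun σ (hσ : (symMat σ).PosDef) => ?_
      have hdet := hσ.det_pos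
      rw [← ENNReal.ofReal_mul' hdet.le]
      congr 1
      rw [wishartKernel, Matrix.mul_one, mul_right_comm, ← Real.rpow_add_one hdet.ne']
      congr 2
      ring
    calc wishartConst (d + 1) m = ∫⁻ σ, f σ := by
          rw [wishartConst, ← lintegral_indicator measurableSet_posDef]
      _ = ∫⁻ w, f (borderedCoord w) := (measurePreserving_borderedCoord.lintegral_comp hfm).symm
      _ = ∫⁻ σ, ∫⁻ v, ∫⁻ s, f (borderedCoord ((σ, v), s)) := by
          have hm1 : Measurable fun w => f (borderedCoord (d := d) w) :=
            hfm.comp measurePreserving_borderedCoord.measurable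
          rw [Measure.volume_eq_prod, lintegral_prod _ hm1.aemeasurable, Measure.volume_eq_prod,
            lintegral_prod _ hm1.lintegral_prod_right'.aemeasurable]
      _ ≤ ∫⁻ σ, ∫⁻ v, ∫⁻ s, P.indicator A σ *
            (Ioi (0 : ℝ)).indicator (fun t => B t * G σ v t)
              (s - v ⬝ᵥ ((symMat σ)⁻¹ *ᵥ v)) :=
          lintegral_mono fun σ => lintegral_mono fun v => lintegral_mono fun s => hpt ((σ, v), s)
      _ = ∫⁻ σ in P, A σ * ENNReal.ofReal (symMat σ).det *
            (vecGaussConst d * ∫⁻ t in Ioi (0 : ℝ), B t * ENNReal.ofReal (t ^ ((d : ℝ) / 2))) := by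
          rw [← lintegral_indicator measurableSet_posDef]
          refine lintegral_congr fun σ => ?_
          have hAfin : P.indicator A σ ≠ ∞ := by
            by_cases hσ : σ ∈ P
            · rw [indicator_of_mem hσ]; exact ENNReal.ofReal_ne_top
            · rw [indicator_of_notMem hσ]; exact ENNReal.zero_ne_top
          simp_rw [lintegral_const_mul' _ _ hAfin]
          by_cases hσ : σ ∈ P
          · rw [hinner σ hσ, indicator_of_mem hσ, indicator_of_mem (by exact hσ)]
            ring
          · rw [indicator_of_notMem hσ, indicator_of_notMem (by exact hσ), zero_mul]
      _ = wishartConst d (m - 1) *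
            (vecGaussConst d * ∫⁻ t in Ioi (0 : ℝ), B t * ENNReal.ofReal (t ^ ((d : ℝ) / 2))) := by
          rw [lintegral_mul_const' _ _ (ENNReal.mul_lt_top (vecGaussConst_lt_top d) hBfin).ne,
            hσint]
      _ < ∞ := ENNReal.mul_lt_top (ih (m - 1) (by linarith))
          (ENNReal.mul_lt_top (vecGaussConst_lt_top d) hBfin)

end WishartFinite

/-! ### Weighted least squares: Gram and residual matrices -/

section LinearModel

variable {n p d : ℕ} {X : Matrix (Fin n) (Fin p) ℝ} {y : Matrix (Fin n) (Fin d) ℝ}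

lemma inv_matQ {z : Fin n → ℝ} (hz : ∀ i, 0 < z i) : (matQ z)⁻¹ = Matrix.diagonal z := by
  refine Matrix.inv_eq_right_inv ?_
  rw [matQ, Matrix.diagonal_mul_diagonal, ← Matrix.diagonal_one]
  congr 1; ext i
  exact inv_mul_cancel₀ (hz i).ne'

/-- The weighted Gram matrix `Xᵀ diag(z) X`. -/
noncomputable def gramMat (X : Matrix (Fin n) (Fin p) ℝ) (z : Fin n → ℝ) : Matrix (Fin p) (Fin p) ℝ :=
  Xᵀ * (matQ z)⁻¹ * X

/-- The weighted residual matrix `yᵀ Q⁻¹ y - μᵀ Ω⁻¹ μ`. -/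
noncomputable def residMat (X : Matrix (Fin n) (Fin p) ℝ) (y : Matrix (Fin n) (Fin d) ℝ) (z : Fin n → ℝ) :
    Matrix (Fin d) (Fin d) ℝ :=
  yᵀ * (matQ z)⁻¹ * y - (matMu X y z)ᵀ * (matOmega X z)⁻¹ * matMu X y z

lemma mulVec_injective_of_rank (S1 : (Matrix.fromCols X y).rank = p + d) :
    Function.Injective (Matrix.fromCols X y).mulVec := by
  have h := (Matrix.fromCols X y).mulVecLin.finrank_range_add_finrank_ker
  rw [← Matrix.rank, S1] at h
  simp only [Module.finrank_pi, Fintype.card_sum, Fintype.card_fin] at h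
  have hker : LinearMap.ker (Matrix.fromCols X y).mulVecLin = ⊥ :=
    Submodule.finrank_eq_zero.1 (by omega)
  exact LinearMap.ker_eq_bot.1 hker

lemma posDef_gramMat (S1 : (Matrix.fromCols X y).rank = p + d) {z : Fin n → ℝ}
    (hz : ∀ i, 0 < z i) : (gramMat X z).PosDef := by
  have hinj : Function.Injective X.mulVec := by
    intro u v huv
    have := mulVec_injective_of_rank S1 (a₁ := Sum.elim u 0) (a₂ := Sum.elim v 0)
      (by simp only [Matrix.fromCols_mulVec_sumElim, huv])
    exact (Sum.elim_eq_iff.1 this).1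
  rw [gramMat, inv_matQ hz, ← Matrix.conjTranspose_eq_transpose_of_trivial]
  exact (Matrix.PosDef.diagonal hz).conjTranspose_mul_mul_same hinj

lemma inv_matOmega (S1 : (Matrix.fromCols X y).rank = p + d) {z : Fin n → ℝ}
    (hz : ∀ i, 0 < z i) : (matOmega X z)⁻¹ = gramMat X z :=
  Matrix.nonsing_inv_nonsing_inv _ (posDef_gramMat S1 hz).det_pos.ne'.isUnit

lemma gramMat_mul_matMu (S1 : (Matrix.fromCols X y).rank = p + d) {z : Fin n → ℝ}
    (hz : ∀ i, 0 < z i) : gramMat X z * matMu X y z = Xᵀ * Matrix.diagonal z * y := by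
  have h : matMu X y z = (gramMat X z)⁻¹ * (Xᵀ * (matQ z)⁻¹ * y) := by
    simp only [matMu, gramMat, Matrix.mul_assoc]
  rw [h, ← Matrix.mul_assoc, Matrix.mul_nonsing_inv _ (posDef_gramMat S1 hz).det_pos.ne'.isUnit,
    Matrix.one_mul, inv_matQ hz]

lemma gramMat_transpose {z : Fin n → ℝ} (hz : ∀ i, 0 < z i) :
    (gramMat X z)ᵀ = gramMat X z := by
  rw [gramMat, inv_matQ hz]
  simp [Matrix.transpose_mul, Matrix.mul_assoc]

/-- Completing the square in the regression coefficients. -/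
lemma residual_decomposition (S1 : (Matrix.fromCols X y).rank = p + d) {z : Fin n → ℝ}
    (hz : ∀ i, 0 < z i) (B : Matrix (Fin p) (Fin d) ℝ) :
    (X * B - y)ᵀ * Matrix.diagonal z * (X * B - y) =
      residMat X y z + (B - matMu X y z)ᵀ * gramMat X z * (B - matMu X y z) := by
  have h1 := gramMat_mul_matMu S1 hz
  have h2 : (matMu X y z)ᵀ * gramMat X z = yᵀ * Matrix.diagonal z * X := by
    have := congrArg Matrix.transpose h1
    rw [Matrix.transpose_mul, gramMat_transpose hz] at this
    rw [this]
    simp [Matrix.transpose_mul, Matrix.mul_assoc]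
  have h3 : Bᵀ * gramMat X z * B = Bᵀ * Xᵀ * Matrix.diagonal z * (X * B) := by
    rw [gramMat, inv_matQ hz]; simp only [Matrix.mul_assoc]
  rw [residMat, inv_matOmega S1 hz, inv_matQ hz, Matrix.transpose_sub, Matrix.transpose_sub,
    Matrix.transpose_mul]
  simp only [Matrix.sub_mul, Matrix.mul_sub]
  rw [h3, Matrix.mul_assoc Bᵀ (gramMat X z), h1, h2]
  simp only [Matrix.mul_assoc]
  abel

/-- Completing the square at B = μ exhibits the matrix as (Xμ - y)ᵀ diag(z) (Xμ - y). If (Xμ - y)u =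
0, the vector (μu, -u) lies in the kernel of (X : y), so u = 0 by full rank. -/
lemma posDef_residMat (S1 : (Matrix.fromCols X y).rank = p + d) {z : Fin n → ℝ}
    (hz : ∀ i, 0 < z i) : (residMat X y z).PosDef := by
  have h := residual_decomposition S1 hz (matMu X y z)
  rw [sub_self, Matrix.mul_zero, add_zero] at h
  rw [← h, ← Matrix.conjTranspose_eq_transpose_of_trivial]
  refine (Matrix.PosDef.diagonal hz).conjTranspose_mul_mul_same fun u v huv => ?_
  have := mulVec_injective_of_rank S1 (a₁ := Sum.elim (matMu X y z *ᵥ u) (-u))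
    (a₂ := Sum.elim (matMu X y z *ᵥ v) (-v)) (by
      simp only [Matrix.fromCols_mulVec_sumElim, Matrix.mulVec_neg, Matrix.mulVec_mulVec]
      have h3 : (X * matMu X y z - y) *ᵥ u = (X * matMu X y z - y) *ᵥ v := huv
      rwa [Matrix.sub_mulVec, Matrix.sub_mulVec, sub_eq_add_neg, sub_eq_add_neg] at h3)
  exact neg_injective (Sum.elim_eq_iff.1 this).2

lemma resid_eq (x : State p d) (i : Fin n) :
    resid X y x i = (X * State.beta x - y) i ⬝ᵥ ((State.scale x)⁻¹ *ᵥ (X * State.beta x - y) i) := by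
  have : (State.beta x)ᵀ *ᵥ X i - y i = (X * State.beta x - y) i := by
    ext j
    simp [Matrix.mulVec, Matrix.mul_apply, dotProduct, mul_comm]
  rw [resid, this]

lemma resid_nonneg {x : State p d} (hx : x ∈ stateSpace p d) (i : Fin n) : 0 ≤ resid X y x i := by
  have h : (State.scale x)⁻¹.PosSemidef := (Matrix.PosDef.inv hx).posSemidef
  simpa [resid] using h.dotProduct_mulVec_nonneg ((State.beta x)ᵀ *ᵥ X i - y i)

lemma sum_mul_resid (z : Fin n → ℝ) (x : State p d) :
    ∑ i, z i * resid X y x i = ((State.scale x)⁻¹ *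
      ((X * State.beta x - y)ᵀ * Matrix.diagonal z * (X * State.beta x - y))).trace := by
  rw [← Matrix.mul_assoc, Matrix.trace_mul_comm, ← Matrix.mul_assoc, ← Matrix.mul_assoc,
    Matrix.trace_mul_comm]
  simp only [resid_eq, Matrix.trace, Matrix.diag_apply, Matrix.diagonal_mul]
  refine Finset.sum_congr rfl fun i _ => ?_
  congr 1
  generalize X * State.beta x - y = E
  rw [Matrix.mul_assoc, Matrix.mul_apply]
  simp only [dotProduct]
  refine Finset.sum_congr rfl fun j _ => ?_
  congr 1

end LinearModel

/-! ### The normal-inverse-Wishart integral on the state space -/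

section StateKernel

variable {p d : ℕ}

/-- The unnormalised normal-inverse-Wishart density. -/
noncomputable def stateKernel (m : ℝ) (θ : Matrix (Fin p) (Fin d) ℝ) (N : Matrix (Fin p) (Fin p) ℝ)
    (S : Matrix (Fin d) (Fin d) ℝ) (x : State p d) : ℝ :=
  (State.scale x).det ^ (-(p : ℝ) / 2) * Real.exp (-(1 / 2) *
    ((State.scale x)⁻¹ * ((State.beta x - θ)ᵀ * N * (State.beta x - θ))).trace) *
    wishartKernel m S (State.scale x)

lemma measurable_beta_apply (i : Fin p) (j : Fin d) :
    Measurable fun x : State p d => State.beta x i j :=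
  (measurable_pi_apply j).comp ((measurable_pi_apply i).comp measurable_fst)

lemma measurable_scale_apply (i j : Fin d) : Measurable fun x : State p d => State.scale x i j :=
  (measurable_pi_apply s(i, j)).comp measurable_snd

lemma measurable_stateKernel (m : ℝ) (θ : Matrix (Fin p) (Fin d) ℝ)
    (N : Matrix (Fin p) (Fin p) ℝ) (S : Matrix (Fin d) (Fin d) ℝ) :
    Measurable (stateKernel m θ N S) := by
  have hb : ∀ i j, Measurable fun x : State p d => (State.beta x - θ) i j := fun i j =>
    (measurable_beta_apply i j).sub_const _
  refine Measurable.mul (((measurable_det measurable_scale_apply).pow_const _).mul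
    (Real.measurable_exp.comp (measurable_const.mul (measurable_trace (measurable_mul_apply
      (measurable_inv_apply measurable_scale_apply) (measurable_mul_apply
        (measurable_mul_apply (fun i j => hb j i) fun _ _ => measurable_const) hb))))))
    ((measurable_wishartKernel m S).comp measurable_snd)

lemma measurableSet_stateSpace : MeasurableSet (stateSpace p d) :=
  measurable_snd measurableSet_posDef

lemma lintegral_stateVolume {f : State p d → ℝ≥0∞} (hf : Measurable f) :
    ∫⁻ x, f x ∂(stateVolume p d) = ∫⁻ σ in {σ : Sym2 (Fin d) → ℝ | (symMat σ).PosDef},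
      ∫⁻ β : Fin p → Fin d → ℝ, f (β, σ) := by
  have h : stateSpace p d = univ ×ˢ {σ : Sym2 (Fin d) → ℝ | (symMat σ).PosDef} := by
    ext x; simp [stateSpace, State.scale]
  rw [stateVolume, h, Measure.volume_eq_prod, ← Measure.prod_restrict, Measure.restrict_univ,
    lintegral_prod_symm' _ hf]

/-- The normalising constant of `stateKernel`. -/
theorem lintegral_stateKernel (m : ℝ) (θ : Matrix (Fin p) (Fin d) ℝ)
    {N : Matrix (Fin p) (Fin p) ℝ} (hN : N.PosDef) {S : Matrix (Fin d) (Fin d) ℝ}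
    (hS : S.PosDef) :
    ∫⁻ x, ENNReal.ofReal (stateKernel m θ N S x) ∂(stateVolume p d) =
      gaussConst p d * wishartConst d m *
        ENNReal.ofReal (N.det ^ (-(d : ℝ) / 2) * S.det ^ (-m / 2)) := by
  have hNd := hN.det_pos
  have hSd := hS.det_pos
  rw [lintegral_stateVolume (measurable_stateKernel m θ N S).ennreal_ofReal]
  calc _ = ∫⁻ σ in {σ : Sym2 (Fin d) → ℝ | (symMat σ).PosDef},
        (gaussConst p d * ENNReal.ofReal (N.det ^ (-(d : ℝ) / 2))) *
          ENNReal.ofReal (wishartKernel m S (symMat σ)) := by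
        refine setLIntegral_congr_fun measurableSet_posDef fun σ (hσ : (symMat σ).PosDef) => ?_
        have hV := hσ.det_pos
        have hw : 0 ≤ wishartKernel m S (symMat σ) := by unfold wishartKernel; positivity
        have h1 : ∀ β : Fin p → Fin d → ℝ, ENNReal.ofReal (stateKernel m θ N S (β, σ)) =
            ENNReal.ofReal ((symMat σ).det ^ (-(p : ℝ) / 2)) *
              ENNReal.ofReal (wishartKernel m S (symMat σ)) *
            ENNReal.ofReal (Real.exp (-(1 / 2) * ((symMat σ)⁻¹ *
              ((Matrix.of β - θ)ᵀ * N * (Matrix.of β - θ))).trace)) := by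
          intro β
          rw [← ENNReal.ofReal_mul (by positivity), ← ENNReal.ofReal_mul (by positivity)]
          congr 1
          rw [stateKernel]
          simp only [State.scale, State.beta]
          ring
        simp only [h1]
        rw [lintegral_const_mul' _ _ (ENNReal.mul_ne_top ENNReal.ofReal_ne_top
          ENNReal.ofReal_ne_top), lintegral_matrix_gaussian hσ hN θ,
          ENNReal.ofReal_mul (by positivity)]
        -- The power of |Σ| produced by integrating out β cancels the one in the normal density,
        -- leaving the inverse Wishart kernel.
        have h2 : ENNReal.ofReal ((symMat σ).det ^ (-(p : ℝ) / 2)) *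
            ENNReal.ofReal ((symMat σ).det ^ ((p : ℝ) / 2)) = 1 := by
          rw [← ENNReal.ofReal_mul (by positivity), ← Real.rpow_add hV]
          norm_num [neg_div]
        calc _ = (ENNReal.ofReal ((symMat σ).det ^ (-(p : ℝ) / 2)) *
              ENNReal.ofReal ((symMat σ).det ^ ((p : ℝ) / 2))) * (gaussConst p d *
              ENNReal.ofReal (N.det ^ (-(d : ℝ) / 2)) *
              ENNReal.ofReal (wishartKernel m S (symMat σ))) := by ring
          _ = _ := by rw [h2, one_mul]
    _ = _ := by
        rw [lintegral_const_mul' _ _ (ENNReal.mul_ne_top (gaussConst_lt_top p d).ne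
          ENNReal.ofReal_ne_top), lintegral_wishartKernel m hS,
          ENNReal.ofReal_mul (by positivity)]
        ring

/-- In terms of the observations, `stateKernel` is a power of `|Σ|` times
`exp (-½ ∑ z_i r_i)`. -/
lemma stateKernel_smul_eq {n : ℕ} {X : Matrix (Fin n) (Fin p) ℝ} {y : Matrix (Fin n) (Fin d) ℝ}
    (S1 : (Matrix.fromCols X y).rank = p + d) {z : Fin n → ℝ} (hz : ∀ i, 0 < z i) (m c : ℝ)
    {x : State p d} (hx : x ∈ stateSpace p d) :
    stateKernel m (matMu X y z) (c • gramMat X z) (c • residMat X y z) x =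
      (State.scale x).det ^ (-(p + m + d + 1) / 2) *
        Real.exp (-(c / 2) * ∑ i, z i * resid X y x i) := by
  have hV : 0 < (State.scale x).det := Matrix.PosDef.det_pos hx
  rw [sum_mul_resid, residual_decomposition S1 hz, Matrix.mul_add, Matrix.trace_add, stateKernel,
    wishartKernel]
  simp only [Matrix.mul_smul, Matrix.smul_mul, Matrix.trace_smul, smul_eq_mul]
  have h1 : (State.scale x).det ^ (-(p + m + d + 1) / 2) =
      (State.scale x).det ^ (-(p : ℝ) / 2) * (State.scale x).det ^ (-(m + d + 1) / 2) := by
    rw [← Real.rpow_add hV]; congr 1; ring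
  have h2 : ∀ s t : ℝ, Real.exp (-(c / 2) * (s + t)) =
      Real.exp (-(1 / 2) * (c * t)) * Real.exp (-(1 / 2) * (c * s)) := by
    intro s t; rw [← Real.exp_add]; congr 1; ring
  rw [h1, h2]
  ring

/-- The parameter c serves two purposes: c = 1 gives the conditional density itself, and c = 2 - ζ
the dominating integral of the trace bound. Rescaling both matrices by c costs only a power of c
free of z. -/
lemma lintegral_stateKernel_smul {n : ℕ} {X : Matrix (Fin n) (Fin p) ℝ}
    {y : Matrix (Fin n) (Fin d) ℝ} (S1 : (Matrix.fromCols X y).rank = p + d) {z : Fin n → ℝ}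
    (hz : ∀ i, 0 < z i) (m : ℝ) {c : ℝ} (hc : 0 < c) :
    ∫⁻ x, ENNReal.ofReal ((State.scale x).det ^ (-(p + m + d + 1) / 2) *
        Real.exp (-(c / 2) * ∑ i, z i * resid X y x i)) ∂(stateVolume p d) =
      gaussConst p d * wishartConst d m * ENNReal.ofReal (c ^ (-(d * (p + m)) / 2) *
        ((gramMat X z).det ^ (-(d : ℝ) / 2) * (residMat X y z).det ^ (-m / 2))) := by
  have hN := posDef_gramMat S1 hz
  have hS := posDef_residMat S1 hz
  have h := lintegral_stateKernel m (matMu X y z) (hN.smul hc) (hS.smul hc)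
  rw [lintegral_congr_ae (g := fun x => ENNReal.ofReal (stateKernel m (matMu X y z)
    (c • gramMat X z) (c • residMat X y z) x)), h]
  · congr 2
    rw [Matrix.det_smul, Matrix.det_smul, Fintype.card_fin, Fintype.card_fin,
      Real.mul_rpow (by positivity) hN.det_pos.le, Real.mul_rpow (by positivity) hS.det_pos.le,
      ← Real.rpow_natCast_mul hc.le, ← Real.rpow_natCast_mul hc.le]
    have : c ^ (-(d * (p + m)) / 2) = c ^ ((p : ℝ) * (-(d : ℝ) / 2)) * c ^ ((d : ℝ) * (-m / 2)) := by
      rw [← Real.rpow_add hc]; congr 1; ring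
    rw [this]; ring
  · filter_upwards [ae_restrict_mem measurableSet_stateSpace] with x hx
    rw [stateKernel_smul_eq S1 hz m c hx]

end StateKernel

/-! ### The densities ψ(·; s) -/

section Mixing

variable {d : ℕ} {h : ℝ → ℝ}

lemma integrableOn_psi_integrand (hh : IsMixingDensity h)
    (S3 : IntegrableOn (fun u : ℝ => u ^ ((d : ℝ) / 2) * h u) (Ioi 0)) {s : ℝ} (hs : 0 ≤ s) :
    IntegrableOn (fun u : ℝ => u ^ ((d : ℝ) / 2) * Real.exp (-(s * u) / 2) * h u) (Ioi 0) := by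
  refine Integrable.mono S3 ?_ ?_
  · exact (((measurable_id.pow_const _).mul (Real.measurable_exp.comp
      (((measurable_const.mul measurable_id).neg).div_const _))).mul
        hh.measurable).aestronglyMeasurable
  · filter_upwards [ae_restrict_mem measurableSet_Ioi] with u hu
    have hu0 : (0 : ℝ) < u := hu
    have h1 : Real.exp (-(s * u) / 2) ≤ 1 := Real.exp_le_one_iff.2 (by
      have := mul_nonneg hs hu0.le; linarith)
    have h2 := hh.nonneg u hu0
    have h3 : 0 ≤ u ^ ((d : ℝ) / 2) := by positivity
    rw [Real.norm_of_nonneg (by positivity), Real.norm_of_nonneg (by positivity)]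
    exact mul_le_mul_of_nonneg_right (mul_le_of_le_one_right h3 h1) h2

/-- If the integral vanished, h would vanish almost everywhere on (0, ∞), contradicting total mass
one. -/
lemma psi_integral_pos (hh : IsMixingDensity h)
    (S3 : IntegrableOn (fun u : ℝ => u ^ ((d : ℝ) / 2) * h u) (Ioi 0)) {s : ℝ} (hs : 0 ≤ s) :
    0 < ∫ u in Ioi (0 : ℝ), u ^ ((d : ℝ) / 2) * Real.exp (-(s * u) / 2) * h u := by
  have hnn : 0 ≤ᵐ[volume.restrict (Ioi (0 : ℝ))]
      fun u : ℝ => u ^ ((d : ℝ) / 2) * Real.exp (-(s * u) / 2) * h u := by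
    filter_upwards [ae_restrict_mem measurableSet_Ioi] with u hu
    have hu0 : (0 : ℝ) < u := hu
    have h2 := hh.nonneg u hu0
    simp only [Pi.zero_apply]
    positivity
  refine (integral_nonneg_of_ae hnn).lt_of_ne fun h0 => ?_
  have h1 := (integral_eq_zero_iff_of_nonneg_ae hnn (integrableOn_psi_integrand hh S3 hs)).1 h0.symm
  have h2 : ∫ u in Ioi (0 : ℝ), h u = 0 := by
    refine integral_eq_zero_of_ae ?_
    filter_upwards [h1, ae_restrict_mem measurableSet_Ioi] with u hu hu0
    have hu0' : (0 : ℝ) < u := hu0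
    have h3 : u ^ ((d : ℝ) / 2) * Real.exp (-(s * u) / 2) ≠ 0 := by positivity
    exact (mul_eq_zero.1 hu).resolve_left h3
  exact one_ne_zero (hh.integral_eq_one.symm.trans h2)

lemma psiConst_pos (hh : IsMixingDensity h)
    (S3 : IntegrableOn (fun u : ℝ => u ^ ((d : ℝ) / 2) * h u) (Ioi 0)) {s : ℝ} (hs : 0 ≤ s) :
    0 < psiConst d h s := inv_pos.2 (psi_integral_pos hh S3 hs)

lemma psi_eq (u s : ℝ) : psi d h u s =
    psiConst d h s * (u ^ ((d : ℝ) / 2) * Real.exp (-(s * u) / 2) * h u) := by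
  rw [psi]; ring

lemma psi_nonneg (hh : IsMixingDensity h)
    (S3 : IntegrableOn (fun u : ℝ => u ^ ((d : ℝ) / 2) * h u) (Ioi 0)) {u s : ℝ} (hu : 0 < u)
    (hs : 0 ≤ s) : 0 ≤ psi d h u s := by
  have h1 := (psiConst_pos hh S3 hs).le
  have h2 := hh.nonneg u hu
  rw [psi]; positivity

lemma integrableOn_psi (hh : IsMixingDensity h)
    (S3 : IntegrableOn (fun u : ℝ => u ^ ((d : ℝ) / 2) * h u) (Ioi 0)) {s : ℝ} (hs : 0 ≤ s) :
    IntegrableOn (fun u => psi d h u s) (Ioi 0) := by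
  simp_rw [psi_eq]
  exact (integrableOn_psi_integrand hh S3 hs).const_mul _

lemma integral_psi (hh : IsMixingDensity h)
    (S3 : IntegrableOn (fun u : ℝ => u ^ ((d : ℝ) / 2) * h u) (Ioi 0)) {s : ℝ} (hs : 0 ≤ s) :
    ∫ u in Ioi (0 : ℝ), psi d h u s = 1 := by
  simp_rw [psi_eq]
  rw [integral_const_mul]
  exact inv_mul_cancel₀ (psi_integral_pos hh S3 hs).ne'

lemma measurable_psiConst (hh : IsMixingDensity h) : Measurable (psiConst d h) := by
  have h1 : StronglyMeasurable fun w : ℝ × ℝ =>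
      w.2 ^ ((d : ℝ) / 2) * Real.exp (-(w.1 * w.2) / 2) * h w.2 := by
    refine Measurable.stronglyMeasurable ?_
    exact ((measurable_snd.pow_const _).mul (Real.measurable_exp.comp
      (((measurable_fst.mul measurable_snd).neg).div_const _))).mul
        (hh.measurable.comp measurable_snd)
  exact h1.integral_prod_right'.measurable.inv

lemma measurable_psi (hh : IsMixingDensity h) :
    Measurable fun w : ℝ × ℝ => psi d h w.1 w.2 := by
  unfold psi
  exact ((((measurable_psiConst hh).comp measurable_snd).mul (measurable_fst.pow_const _)).mul
    (Real.measurable_exp.comp (((measurable_snd.mul measurable_fst).neg).div_const _))).mul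
      (hh.measurable.comp measurable_fst)

end Mixing

/-! ### Joint density of parameters and latent variables -/

section Latent

/-- Lebesgue measure on `(0, ∞)^n`. -/
noncomputable def orthantVolume (n : ℕ) : Measure (Fin n → ℝ) := Measure.pi fun _ => volume.restrict (Ioi 0)

instance (n : ℕ) : SigmaFinite (orthantVolume n) := by
  unfold orthantVolume; infer_instance

instance (p d : ℕ) : SigmaFinite (stateVolume p d) := by
  unfold stateVolume; infer_instance

lemma restrict_orthant (n : ℕ) :
    (volume : Measure (Fin n → ℝ)).restrict {z | ∀ i, 0 < z i} = orthantVolume n := by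
  have : {z : Fin n → ℝ | ∀ i, 0 < z i} = univ.pi fun _ => Ioi 0 := by
    ext z; simp [mem_pi]
  rw [this, volume_pi, Measure.restrict_pi_pi, orthantVolume]

lemma ae_orthantVolume_pos (n : ℕ) : ∀ᵐ z ∂(orthantVolume n), ∀ i, 0 < z i := by
  rw [← restrict_orthant]
  have : {z : Fin n → ℝ | ∀ i, 0 < z i} = univ.pi fun _ => Ioi 0 := by
    ext z; simp [mem_pi]
  have hm : MeasurableSet {z : Fin n → ℝ | ∀ i, 0 < z i} := by
    rw [this]
    exact MeasurableSet.univ_pi fun _ => measurableSet_Ioi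
  exact ae_restrict_mem hm

variable {n p d : ℕ} {X : Matrix (Fin n) (Fin p) ℝ} {y : Matrix (Fin n) (Fin d) ℝ} {h : ℝ → ℝ}

lemma measurable_resid (i : Fin n) : Measurable fun x : State p d => resid X y x i := by
  have h1 : ∀ j, Measurable fun x : State p d => (X * State.beta x - y) i j := by
    intro j
    exact (measurable_mul_apply (A := fun _ => X) (fun _ _ => measurable_const)
      measurable_beta_apply i j).sub_const (y i j)
  simp only [resid_eq, dotProduct, Matrix.mulVec]
  exact Finset.measurable_fun_sum _ fun j _ => (h1 j).mul (Finset.measurable_fun_sum _ fun k _ =>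
    (measurable_inv_apply measurable_scale_apply j k).mul (h1 k))

lemma measurable_condZ (hh : IsMixingDensity h) :
    Measurable fun w : State p d × (Fin n → ℝ) => condZ X y h w.2 w.1 := by
  have h1 : ∀ i, Measurable fun w : State p d × (Fin n → ℝ) =>
      psi d h (w.2 i) (resid X y w.1 i) := by
    intro i
    have hr : Measurable fun x : State p d => resid X y x i := measurable_resid i
    have h2 : Measurable fun w : State p d × (Fin n → ℝ) => (w.2 i, resid X y w.1 i) :=
      Measurable.prodMk ((measurable_pi_apply i).comp measurable_snd) (hr.comp measurable_fst)
    have h3 := (measurable_psi (d := d) hh).comp h2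
    exact h3
  exact Finset.measurable_fun_prod _ fun i _ => h1 i

lemma condZ_nonneg (hh : IsMixingDensity h)
    (S3 : IntegrableOn (fun u : ℝ => u ^ ((d : ℝ) / 2) * h u) (Ioi 0)) {z : Fin n → ℝ}
    (hz : ∀ i, 0 < z i) {x : State p d} (hx : x ∈ stateSpace p d) : 0 ≤ condZ X y h z x :=
  Finset.prod_nonneg fun i _ => psi_nonneg hh S3 (hz i) (resid_nonneg hx i)

lemma integrable_condZ (hh : IsMixingDensity h)
    (S3 : IntegrableOn (fun u : ℝ => u ^ ((d : ℝ) / 2) * h u) (Ioi 0)) {x : State p d}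
    (hx : x ∈ stateSpace p d) : Integrable (fun z => condZ X y h z x) (orthantVolume n) :=
  Integrable.fintype_prod (f := fun i u => psi d h u (resid X y x i)) fun i =>
    integrableOn_psi hh S3 (resid_nonneg hx i)

lemma integral_condZ (hh : IsMixingDensity h)
    (S3 : IntegrableOn (fun u : ℝ => u ^ ((d : ℝ) / 2) * h u) (Ioi 0)) {x : State p d}
    (hx : x ∈ stateSpace p d) : ∫ z, condZ X y h z x ∂(orthantVolume n) = 1 := by
  have := integral_fintype_prod_eq_prod (μ := fun _ : Fin n => volume.restrict (Ioi (0 : ℝ)))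
    (fun i u => psi d h u (resid X y x i))
  refine this.trans (Finset.prod_eq_one fun i _ => ?_)
  exact integral_psi hh S3 (resid_nonneg hx i)

/-- `|Σ| ^ (-(p + m + d + 1) / 2) * exp (-½ ∑ z_i r_i)`, the part of the joint density of parameters
and latent variables that involves both. -/
noncomputable def expKernel (X : Matrix (Fin n) (Fin p) ℝ) (y : Matrix (Fin n) (Fin d) ℝ) (m : ℝ)
    (x : State p d) (z : Fin n → ℝ) : ℝ :=
  (State.scale x).det ^ (-(p + m + d + 1) / 2) * Real.exp (-(1 / 2) * ∑ i, z i * resid X y x i)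

/-- The part of the joint density of parameters and latent variables that involves only the latter.
-/
noncomputable def latentWeight (d : ℕ) (h : ℝ → ℝ) (z : Fin n → ℝ) : ℝ :=
  ∏ i, (((2 * Real.pi) ^ ((d : ℝ) / 2))⁻¹ * (z i ^ ((d : ℝ) / 2) * h (z i)))

/-- The numerical factor of the conditional density of the parameters. -/
noncomputable def condConst (p d : ℕ) (m : ℝ) : ℝ :=
  1 / (2 * Real.pi) ^ ((p : ℝ) * d / 2) *
    (1 / ((2 : ℝ) ^ (m * d / 2) * Real.pi ^ ((d : ℝ) * (d - 1) / 4) *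
      ∏ i ∈ Finset.Icc 1 d, Real.Gamma ((m + 1 - i) / 2)))

lemma condConst_pos {m : ℝ} (hm : (d : ℝ) - 1 < m) : 0 < condConst p d m := by
  have : 0 < ∏ i ∈ Finset.Icc 1 d, Real.Gamma ((m + 1 - i) / 2) := by
    refine Finset.prod_pos fun i hi => Real.Gamma_pos_of_pos ?_
    have : (i : ℝ) ≤ d := by exact_mod_cast (Finset.mem_Icc.1 hi).2
    linarith
  have hpi := Real.pi_pos
  unfold condConst
  positivity

/-- The normalising factor of the conditional density of the parameters. -/
noncomputable def condNorm (X : Matrix (Fin n) (Fin p) ℝ) (y : Matrix (Fin n) (Fin d) ℝ) (m : ℝ)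
    (z : Fin n → ℝ) : ℝ :=
  condConst p d m * ((gramMat X z).det ^ ((d : ℝ) / 2) * (residMat X y z).det ^ (m / 2))

lemma condNorm_pos (S1 : (Matrix.fromCols X y).rank = p + d) {z : Fin n → ℝ}
    (hz : ∀ i, 0 < z i) {m : ℝ} (hm : (d : ℝ) - 1 < m) : 0 < condNorm X y m z := by
  have h1 := (posDef_gramMat S1 hz).det_pos
  have h2 := (posDef_residMat S1 hz).det_pos
  have h3 := condConst_pos (p := p) hm
  unfold condNorm
  positivity

lemma expKernel_pos (m : ℝ) {x : State p d} (hx : x ∈ stateSpace p d) (z : Fin n → ℝ) :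
    0 < expKernel X y m x z := by
  have := Matrix.PosDef.det_pos hx
  unfold expKernel
  positivity

lemma measurable_expKernel (m : ℝ) :
    Measurable fun w : State p d × (Fin n → ℝ) => expKernel X y m w.1 w.2 := by
  unfold expKernel
  refine (((measurable_det measurable_scale_apply).comp measurable_fst).pow_const _).mul
    (Real.measurable_exp.comp (measurable_const.mul (Finset.measurable_fun_sum _ fun i _ => ?_)))
  exact ((measurable_pi_apply i).comp measurable_snd).mul ((measurable_resid i).comp measurable_fst)

lemma measurable_latentWeight (hh : IsMixingDensity h) :
    Measurable (latentWeight (n := n) d h) := by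
  unfold latentWeight
  exact Finset.measurable_fun_prod _ fun i _ => measurable_const.mul
    (((measurable_pi_apply i).pow_const _).mul (hh.measurable.comp (measurable_pi_apply i)))

lemma measurable_condNorm (m : ℝ) : Measurable (condNorm X y m) := by
  have hQ : ∀ i j, Measurable fun z : Fin n → ℝ => (matQ z)⁻¹ i j := by
    refine measurable_inv_apply fun i j => ?_
    rw [show (fun z : Fin n → ℝ => matQ z i j) = fun z => if i = j then (z i)⁻¹ else 0 from by
      ext z; rw [matQ, Matrix.diagonal_apply]]
    split_ifs
    · exact (measurable_pi_apply i).inv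
    · exact measurable_const
  have hc : ∀ {k l : ℕ} (A : Matrix (Fin k) (Fin l) ℝ) (i j),
      Measurable fun _ : Fin n → ℝ => A i j := fun _ _ _ => measurable_const
  have hN : ∀ i j, Measurable fun z : Fin n → ℝ => gramMat X z i j :=
    measurable_mul_apply (measurable_mul_apply (hc _) hQ) (hc _)
  have hOm : ∀ i j, Measurable fun z : Fin n → ℝ => matOmega X z i j := measurable_inv_apply hN
  have hmu : ∀ i j, Measurable fun z : Fin n → ℝ => matMu X y z i j :=
    measurable_mul_apply (measurable_mul_apply (measurable_mul_apply hOm (hc _)) hQ) (hc _)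
  have hS : ∀ i j, Measurable fun z : Fin n → ℝ => residMat X y z i j := by
    intro i j
    exact (measurable_mul_apply (measurable_mul_apply (hc _) hQ) (hc _) i j).sub
      (measurable_mul_apply (measurable_mul_apply (fun i j => hmu j i)
        (measurable_inv_apply hOm)) hmu i j)
  unfold condNorm
  exact measurable_const.mul (((measurable_det hN).pow_const _).mul
    ((measurable_det hS).pow_const _))

lemma latentWeight_nonneg (hh : IsMixingDensity h) {z : Fin n → ℝ} (hz : ∀ i, 0 < z i) :
    0 ≤ latentWeight d h z := by
  have hpi := Real.pi_pos
  refine Finset.prod_nonneg fun i _ => ?_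
  have h1 := hh.nonneg _ (hz i)
  have h2 := hz i
  positivity

/-- The conditional density of the parameters given the latent variables. -/
lemma condBeta_mul_condScale (S1 : (Matrix.fromCols X y).rank = p + d) (a : ℝ) {z : Fin n → ℝ}
    (hz : ∀ i, 0 < z i) {x : State p d} (hx : x ∈ stateSpace p d) :
    condBeta X y x z * condScale a X y x z =
      condNorm X y ((n : ℝ) - p + 2 * a - d - 1) z *
        expKernel X y ((n : ℝ) - p + 2 * a - d - 1) x z := by
  have hN := posDef_gramMat S1 hz
  have hS := posDef_residMat S1 hz
  have hNd := hN.det_pos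
  have hSd := hS.det_pos
  have hV : 0 < (State.scale x).det := Matrix.PosDef.det_pos hx
  generalize hm : (n : ℝ) - p + 2 * a - d - 1 = m
  have hker := stateKernel_smul_eq S1 hz m 1 hx
  rw [one_smul, one_smul] at hker
  have hE : expKernel X y m x z = stateKernel m (matMu X y z) (gramMat X z) (residMat X y z) x :=
    hker.symm
  have hΩ : (matOmega X z).det = (gramMat X z).det⁻¹ := by
    rw [matOmega, Matrix.det_nonsing_inv, Ring.inverse_eq_inv']; rfl
  have hΘ : ((residMat X y z)⁻¹).det = (residMat X y z).det⁻¹ := by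
    rw [Matrix.det_nonsing_inv, Ring.inverse_eq_inv']
  have htr : ((matOmega X z)⁻¹ * (State.beta x - matMu X y z) * (State.scale x)⁻¹ *
      (State.beta x - matMu X y z)ᵀ).trace = ((State.scale x)⁻¹ *
      ((State.beta x - matMu X y z)ᵀ * gramMat X z * (State.beta x - matMu X y z))).trace := by
    rw [inv_matOmega S1 hz, Matrix.mul_assoc (gramMat X z * _), Matrix.trace_mul_comm,
      Matrix.mul_assoc, Matrix.mul_assoc]
  have hVp : (State.scale x).det ^ (-(p : ℝ) / 2) = ((State.scale x).det ^ ((p : ℝ) / 2))⁻¹ := by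
    rw [neg_div, Real.rpow_neg hV.le]
  have hscale : condScale a X y x z = invWishartPDF m (residMat X y z)⁻¹ (State.scale x) := by
    rw [condScale, hm]; rfl
  rw [hscale, invWishartPDF, indicator_of_mem (by exact hx), condBeta, matrixNormalPDF, htr, hΩ, hΘ,
    Matrix.nonsing_inv_nonsing_inv _ hSd.ne'.isUnit, hE, stateKernel, wishartKernel, condNorm,
    condConst, Real.inv_rpow hNd.le, Real.inv_rpow hSd.le, hVp,
    Matrix.trace_mul_comm (residMat X y z)]
  simp only [mul_inv, inv_inv, div_eq_mul_inv]
  ring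

/-- The joint density of parameters and latent variables. -/
lemma likelihood_mul_prior_mul_condZ (hh : IsMixingDensity h)
    (S3 : IntegrableOn (fun u : ℝ => u ^ ((d : ℝ) / 2) * h u) (Ioi 0)) (a : ℝ) (z : Fin n → ℝ)
    {x : State p d} (hx : x ∈ stateSpace p d) :
    likelihood X y h x * prior a x * condZ X y h z x =
      latentWeight d h z * expKernel X y ((n : ℝ) - p + 2 * a - d - 1) x z := by
  have hV : 0 < (State.scale x).det := Matrix.PosDef.det_pos hx
  have hpi := Real.pi_pos
  -- The constant b(r_i) inside ψ is the inverse of the mixing integral in the i-th likelihood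
  -- factor, so the two cancel.
  have h1 : ∀ i, (∫ u in Ioi (0 : ℝ),
      u ^ ((d : ℝ) / 2) / ((2 * Real.pi) ^ ((d : ℝ) / 2) * (State.scale x).det ^ ((1 : ℝ) / 2)) *
        Real.exp (-(u / 2) * resid X y x i) * h u) * psi d h (z i) (resid X y x i) =
      (((2 * Real.pi) ^ ((d : ℝ) / 2))⁻¹ * (z i ^ ((d : ℝ) / 2) * h (z i))) *
        ((State.scale x).det ^ (-(1 : ℝ) / 2) * Real.exp (-(1 / 2) * (z i * resid X y x i))) := by
    intro i
    have hI := psi_integral_pos hh S3 (resid_nonneg (X := X) (y := y) hx i)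
    have h2 : (fun u : ℝ => u ^ ((d : ℝ) / 2) / ((2 * Real.pi) ^ ((d : ℝ) / 2) *
        (State.scale x).det ^ ((1 : ℝ) / 2)) * Real.exp (-(u / 2) * resid X y x i) * h u) =
        fun u => ((2 * Real.pi) ^ ((d : ℝ) / 2) * (State.scale x).det ^ ((1 : ℝ) / 2))⁻¹ *
          (u ^ ((d : ℝ) / 2) * Real.exp (-(resid X y x i * u) / 2) * h u) := by
      ext u
      rw [show -(u / 2) * resid X y x i = -(resid X y x i * u) / 2 by ring]
      ring
    have h3 : (State.scale x).det ^ (-(1 : ℝ) / 2) = ((State.scale x).det ^ ((1 : ℝ) / 2))⁻¹ := by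
      rw [neg_div, Real.rpow_neg hV.le]
    rw [h2, integral_const_mul, psi, psiConst, h3]
    generalize (∫ u in Ioi (0 : ℝ),
      u ^ ((d : ℝ) / 2) * Real.exp (-(resid X y x i * u) / 2) * h u) = I at hI ⊢
    rw [show -(1 / 2) * (z i * resid X y x i) = -(resid X y x i * z i) / 2 by ring]
    field_simp
  have h3 : likelihood X y h x * condZ X y h z x =
      latentWeight d h z * (((State.scale x).det ^ (-(1 : ℝ) / 2)) ^ n *
        Real.exp (-(1 / 2) * ∑ i, z i * resid X y x i)) := by
    rw [likelihood, condZ, ← Finset.prod_mul_distrib, Finset.prod_congr rfl fun i _ => h1 i,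
      Finset.prod_mul_distrib, latentWeight]
    congr 1
    rw [Finset.prod_mul_distrib, ← Real.exp_sum, Finset.mul_sum, Finset.prod_const,
      Finset.card_univ, Fintype.card_fin]
  rw [mul_right_comm, h3, expKernel, prior, ← Real.rpow_mul_natCast hV.le]
  -- For m = n - p + 2a - d - 1 one has p + m + d + 1 = n + 2a: each observation contributes -1/2 to
  -- the exponent of |Σ| and the prior -a.
  have h4 : (State.scale x).det ^ (-((p : ℝ) + ((n : ℝ) - p + 2 * a - d - 1) + d + 1) / 2) =
      (State.scale x).det ^ (-(1 : ℝ) / 2 * n) * (State.scale x).det ^ (-a) := by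
    rw [← Real.rpow_add hV]; congr 1; ring
  rw [h4]; ring

lemma lintegral_expKernel (S1 : (Matrix.fromCols X y).rank = p + d) {z : Fin n → ℝ}
    (hz : ∀ i, 0 < z i) (m : ℝ) :
    ∫⁻ x, ENNReal.ofReal (expKernel X y m x z) ∂(stateVolume p d) =
      gaussConst p d * wishartConst d m * ENNReal.ofReal
        ((gramMat X z).det ^ (-(d : ℝ) / 2) * (residMat X y z).det ^ (-m / 2)) := by
  have := lintegral_stateKernel_smul S1 hz m one_pos
  rwa [Real.one_rpow, one_mul] at this

end Latent

/-! ### Factorisation of the transition density and the trace bound -/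

section Chain

variable {n p d : ℕ} {X : Matrix (Fin n) (Fin p) ℝ} {y : Matrix (Fin n) (Fin d) ℝ} {h : ℝ → ℝ}

lemma measurable_likelihood_mul_prior (hh : IsMixingDensity h) (a : ℝ) :
    Measurable fun x : State p d => likelihood X y h x * prior a x := by
  have hV : Measurable fun x : State p d => (State.scale x).det :=
    measurable_det measurable_scale_apply
  refine Measurable.mul (Finset.measurable_fun_prod _ fun i _ => ?_) (hV.pow_const _)
  have hr : Measurable fun x : State p d => resid X y x i := measurable_resid i
  have h1 : Measurable fun w : State p d × ℝ =>
      w.2 ^ ((d : ℝ) / 2) / ((2 * Real.pi) ^ ((d : ℝ) / 2) *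
        (State.scale w.1).det ^ ((1 : ℝ) / 2)) * Real.exp (-(w.2 / 2) * resid X y w.1 i) * h w.2 :=
    (((measurable_snd.pow_const _).div (measurable_const.mul ((hV.comp measurable_fst).pow_const
      _))).mul (Real.measurable_exp.comp (((measurable_snd.div_const _).neg).mul
        (hr.comp measurable_fst)))).mul (hh.measurable.comp measurable_snd)
  exact (h1.stronglyMeasurable.integral_prod_right' (ν := volume.restrict (Ioi 0))).measurable

lemma likelihood_mul_prior_pos (hh : IsMixingDensity h)
    (S3 : IntegrableOn (fun u : ℝ => u ^ ((d : ℝ) / 2) * h u) (Ioi 0)) (a : ℝ) {x : State p d}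
    (hx : x ∈ stateSpace p d) : 0 < likelihood X y h x * prior a x := by
  have hV : 0 < (State.scale x).det := Matrix.PosDef.det_pos hx
  have hpi := Real.pi_pos
  refine mul_pos (Finset.prod_pos fun i _ => ?_) (Real.rpow_pos_of_pos hV _)
  have hI := psi_integral_pos hh S3 (resid_nonneg (X := X) (y := y) hx i)
  have h2 : (fun u : ℝ => u ^ ((d : ℝ) / 2) / ((2 * Real.pi) ^ ((d : ℝ) / 2) *
      (State.scale x).det ^ ((1 : ℝ) / 2)) * Real.exp (-(u / 2) * resid X y x i) * h u) =
      fun u => ((2 * Real.pi) ^ ((d : ℝ) / 2) * (State.scale x).det ^ ((1 : ℝ) / 2))⁻¹ *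
        (u ^ ((d : ℝ) / 2) * Real.exp (-(resid X y x i * u) / 2) * h u) := by
    ext u
    rw [show -(u / 2) * resid X y x i = -(resid X y x i * u) / 2 by ring]
    ring
  rw [h2, integral_const_mul]
  positivity

/-- A square root of the transition density with respect to the posterior. -/
noncomputable def chainFactor (a : ℝ) (X : Matrix (Fin n) (Fin p) ℝ) (y : Matrix (Fin n) (Fin d) ℝ) (h : ℝ → ℝ)
    (w : State p d × (Fin n → ℝ)) : ℝ :=
  condZ X y h w.2 w.1 / Real.sqrt (latentWeight d h w.2 /
    condNorm X y ((n : ℝ) - p + 2 * a - d - 1) w.2 / (marginal a X y h).toReal)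

lemma measurable_chainFactor (hh : IsMixingDensity h) (a : ℝ) :
    Measurable (chainFactor a X y h) := by
  have h1 : Measurable fun z : Fin n → ℝ => Real.sqrt (latentWeight d h z /
      condNorm X y ((n : ℝ) - p + 2 * a - d - 1) z / (marginal a X y h).toReal) :=
    (((measurable_latentWeight hh).div (measurable_condNorm _)).div_const _).sqrt
  have h2 : Measurable fun w : State p d × (Fin n → ℝ) => condZ X y h w.2 w.1 :=
    measurable_condZ hh
  exact h2.div (h1.comp measurable_snd)

lemma posteriorDensity_eq (a : ℝ) (hM0 : marginal a X y h ≠ 0) (hM : marginal a X y h ≠ ∞)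
    (x : State p d) : posteriorDensity a X y h x =
      ENNReal.ofReal (likelihood X y h x * prior a x / (marginal a X y h).toReal) := by
  rw [posteriorDensity, ENNReal.ofReal_div_of_pos (ENNReal.toReal_pos hM0 hM),
    ENNReal.ofReal_toReal hM]

/-- This is Bayes' rule: the quantity under the square root in `chainFactor` is the marginal density
of z up to a constant, and the joint density determines π(x'|z) from π(z|x'). -/
lemma chainFactor_mul_chainFactor (hh : IsMixingDensity h)
    (S1 : (Matrix.fromCols X y).rank = p + d)
    (S3 : IntegrableOn (fun u : ℝ => u ^ ((d : ℝ) / 2) * h u) (Ioi 0)) {a : ℝ}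
    (hm : (d : ℝ) - 1 < (n : ℝ) - p + 2 * a - d - 1) (hM0 : marginal a X y h ≠ 0)
    (hM : marginal a X y h ≠ ∞) {z : Fin n → ℝ} (hz : ∀ i, 0 < z i) {x x' : State p d}
    (hx : x ∈ stateSpace p d) (hx' : x' ∈ stateSpace p d) :
    condBeta X y x' z * condScale a X y x' z * condZ X y h z x =
      chainFactor a X y h (x, z) * chainFactor a X y h (x', z) *
        (likelihood X y h x' * prior a x' / (marginal a X y h).toReal) := by
  have hMp := ENNReal.toReal_pos hM0 hM
  have hL := likelihood_mul_prior_pos (X := X) (y := y) hh S3 a hx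
  have hj := likelihood_mul_prior_mul_condZ (X := X) (y := y) hh S3 a z hx
  have hj' := likelihood_mul_prior_mul_condZ (X := X) (y := y) hh S3 a z hx'
  have hk := condNorm_pos S1 hz hm
  have hw := latentWeight_nonneg (d := d) hh hz
  rw [condBeta_mul_condScale S1 a hz hx', chainFactor, chainFactor, div_mul_div_comm]
  dsimp only
  rw [Real.mul_self_sqrt (by positivity)]
  -- Where the weight of z vanishes, the quotients on the right are 0 by convention. The left side
  -- vanishes too: the joint density is 0 while likelihood times prior is positive, so `condZ` is 0.
  rcases hw.eq_or_lt with hw0 | hw0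
  · rw [← hw0, zero_mul] at hj
    have hq : condZ X y h z x = 0 := (mul_eq_zero.1 hj).resolve_left hL.ne'
    rw [hq]; simp
  · have h1 : likelihood X y h x' * prior a x' * condZ X y h z x' / latentWeight d h z =
        expKernel X y ((n : ℝ) - p + 2 * a - d - 1) x' z := by
      rw [hj', mul_div_cancel_left₀ _ hw0.ne']
    rw [← h1]
    field_simp

/-- The factor `condNorm` cancels exactly the determinants produced by the integral, so the result
does not depend on z, whatever c is. The uniformity of the trace bound rests on this. -/
lemma lintegral_condNorm_mul_expKernel (S1 : (Matrix.fromCols X y).rank = p + d) {m : ℝ}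
    (hm : (d : ℝ) - 1 < m) {z : Fin n → ℝ} (hz : ∀ i, 0 < z i) {c : ℝ} (hc : 0 < c) :
    ∫⁻ x, ENNReal.ofReal (condNorm X y m z * ((State.scale x).det ^ (-(p + m + d + 1) / 2) *
        Real.exp (-(c / 2) * ∑ i, z i * resid X y x i))) ∂(stateVolume p d) =
      gaussConst p d * wishartConst d m *
        ENNReal.ofReal (condConst p d m * c ^ (-(d * (p + m)) / 2)) := by
  have hk := condNorm_pos S1 hz hm
  have hN := (posDef_gramMat S1 hz).det_pos
  have hS := (posDef_residMat S1 hz).det_pos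
  simp_rw [ENNReal.ofReal_mul hk.le]
  rw [lintegral_const_mul' _ _ ENNReal.ofReal_ne_top, lintegral_stateKernel_smul S1 hz m hc,
    mul_left_comm, ← ENNReal.ofReal_mul hk.le]
  congr 2
  have hd : (gramMat X z).det ^ (-(d : ℝ) / 2) = ((gramMat X z).det ^ ((d : ℝ) / 2))⁻¹ := by
    rw [neg_div, Real.rpow_neg hN.le]
  have hs : (residMat X y z).det ^ (-m / 2) = ((residMat X y z).det ^ (m / 2))⁻¹ := by
    rw [neg_div, Real.rpow_neg hS.le]
  rw [condNorm, hd, hs]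
  field_simp

/-- The total mass of the conditional density of the parameters. -/
noncomputable def condMass (p d : ℕ) (m : ℝ) : ℝ :=
  (gaussConst p d * wishartConst d m * ENNReal.ofReal (condConst p d m)).toReal

lemma integrable_condNorm_mul_expKernel (S1 : (Matrix.fromCols X y).rank = p + d) {m : ℝ}
    (hm : (d : ℝ) - 1 < m) {z : Fin n → ℝ} (hz : ∀ i, 0 < z i) :
    Integrable (fun x => condNorm X y m z * expKernel X y m x z) (stateVolume p d) ∧
      ∫ x, condNorm X y m z * expKernel X y m x z ∂(stateVolume p d) = condMass p d m := by
  have h1 := lintegral_condNorm_mul_expKernel S1 hm hz one_pos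
  rw [Real.one_rpow, mul_one] at h1
  have hk := condNorm_pos S1 hz hm
  have hmeas : Measurable fun x : State p d => condNorm X y m z * expKernel X y m x z := by
    have h2 : Measurable fun w : State p d × (Fin n → ℝ) => expKernel X y m w.1 w.2 :=
      measurable_expKernel m
    exact measurable_const.mul (h2.comp (measurable_id.prodMk measurable_const))
  have hnn : 0 ≤ᵐ[stateVolume p d] fun x => condNorm X y m z * expKernel X y m x z := by
    filter_upwards [ae_restrict_mem measurableSet_stateSpace] with x hx
    exact mul_nonneg hk.le (expKernel_pos m hx z).le
  refine ⟨⟨hmeas.aestronglyMeasurable, ?_⟩, ?_⟩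
  · rw [hasFiniteIntegral_iff_ofReal hnn]
    refine lt_of_eq_of_lt h1 ?_
    exact ENNReal.mul_lt_top (ENNReal.mul_lt_top (gaussConst_lt_top p d)
      (wishartConst_lt_top d m hm)) ENNReal.ofReal_lt_top
  · rw [integral_eq_lintegral_of_nonneg_ae hnn hmeas.aestronglyMeasurable]
    exact congrArg ENNReal.toReal h1

lemma measurable_psi_left (hh : IsMixingDensity h) (s : ℝ) :
    Measurable fun u : ℝ => psi d h u s := by
  unfold psi
  exact (((measurable_const).mul (measurable_id.pow_const _)).mul
    (Real.measurable_exp.comp (((measurable_const.mul measurable_id).neg).div_const _))).mul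
      hh.measurable

lemma measurable_condZ_left (hh : IsMixingDensity h) (x : State p d) :
    Measurable fun z : Fin n → ℝ => condZ X y h z x := by
  unfold condZ
  generalize resid X y x = s
  refine Finset.measurable_fun_prod _ fun i _ => ?_
  exact (measurable_psi_left hh (s i)).comp (measurable_pi_apply i)

/-- Integrating over x' first gives a mass independent of z; what remains is a density in z of total
mass one. -/
lemma integrable_condNorm_mul_expKernel_mul_condZ (hh : IsMixingDensity h)
    (S1 : (Matrix.fromCols X y).rank = p + d)
    (S3 : IntegrableOn (fun u : ℝ => u ^ ((d : ℝ) / 2) * h u) (Ioi 0)) {m : ℝ}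
    (hm : (d : ℝ) - 1 < m) {x : State p d} (hx : x ∈ stateSpace p d) :
    Integrable (fun w : State p d × (Fin n → ℝ) =>
        condNorm X y m w.2 * expKernel X y m w.1 w.2 * condZ X y h w.2 x)
      ((stateVolume p d).prod (orthantVolume n)) ∧
    ∫ x', ∫ z, condNorm X y m z * expKernel X y m x' z * condZ X y h z x ∂(orthantVolume n)
      ∂(stateVolume p d) = condMass p d m := by
  have hZ : Measurable fun w : State p d × (Fin n → ℝ) => condZ X y h w.2 x :=
    (measurable_condZ_left hh x).comp measurable_snd
  have hmeas : Measurable fun w : State p d × (Fin n → ℝ) =>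
      condNorm X y m w.2 * expKernel X y m w.1 w.2 * condZ X y h w.2 x := by
    have h2 : Measurable fun w : State p d × (Fin n → ℝ) => expKernel X y m w.1 w.2 :=
      measurable_expKernel m
    have h3 : Measurable fun z : Fin n → ℝ => condNorm X y m z := measurable_condNorm m
    have h4 : Measurable fun w : State p d × (Fin n → ℝ) => condNorm X y m w.2 :=
      h3.comp measurable_snd
    exact (h4.mul h2).mul hZ
  have hint : Integrable (fun w : State p d × (Fin n → ℝ) =>
        condNorm X y m w.2 * expKernel X y m w.1 w.2 * condZ X y h w.2 x)
      ((stateVolume p d).prod (orthantVolume n)) := by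
    rw [integrable_prod_iff' hmeas.aestronglyMeasurable]
    constructor
    · filter_upwards [ae_orthantVolume_pos n] with z hz
      exact (integrable_condNorm_mul_expKernel S1 hm hz).1.mul_const _
    · refine ((integrable_condZ (X := X) (y := y) hh S3 hx).const_mul (condMass p d m)).congr ?_
      filter_upwards [ae_orthantVolume_pos n] with z hz
      have hq := condZ_nonneg (X := X) (y := y) hh S3 hz hx
      rw [← (integrable_condNorm_mul_expKernel S1 hm hz).2, ← integral_mul_const]
      refine integral_congr_ae ?_
      filter_upwards [ae_restrict_mem measurableSet_stateSpace] with x' hx'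
      have hk := condNorm_pos S1 hz hm
      have hE := expKernel_pos (X := X) (y := y) m hx' z
      rw [Real.norm_of_nonneg (by positivity)]
  refine ⟨hint, ?_⟩
  rw [integral_integral_swap hint]
  calc _ = ∫ z, condMass p d m * condZ X y h z x ∂(orthantVolume n) := by
        refine integral_congr_ae ?_
        filter_upwards [ae_orthantVolume_pos n] with z hz
        rw [integral_mul_const, (integrable_condNorm_mul_expKernel S1 hm hz).2]
    _ = _ := by rw [integral_const_mul, integral_condZ hh S3 hx, mul_one]

lemma mtd_eq (hh : IsMixingDensity h) (S1 : (Matrix.fromCols X y).rank = p + d)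
    (S3 : IntegrableOn (fun u : ℝ => u ^ ((d : ℝ) / 2) * h u) (Ioi 0)) {a : ℝ}
    (hm : (d : ℝ) - 1 < (n : ℝ) - p + 2 * a - d - 1) (hM0 : marginal a X y h ≠ 0)
    (hM : marginal a X y h ≠ ∞) {x x' : State p d}
    (hx : x ∈ stateSpace p d) (hx' : x' ∈ stateSpace p d) :
    mtd a X y h x' x = symmKernel (orthantVolume n) (chainFactor a X y h) x x' *
      (likelihood X y h x' * prior a x' / (marginal a X y h).toReal) := by
  rw [mtd, restrict_orthant, symmKernel, ← integral_mul_const]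
  refine integral_congr_ae ?_
  filter_upwards [ae_orthantVolume_pos n] with z hz
  exact chainFactor_mul_chainFactor hh S1 S3 hm hM0 hM hz hx hx'

lemma integral_mtd (hh : IsMixingDensity h) (S1 : (Matrix.fromCols X y).rank = p + d)
    (S3 : IntegrableOn (fun u : ℝ => u ^ ((d : ℝ) / 2) * h u) (Ioi 0)) {a : ℝ}
    (hm : (d : ℝ) - 1 < (n : ℝ) - p + 2 * a - d - 1) {x : State p d} (hx : x ∈ stateSpace p d) :
    ∫ x', mtd a X y h x' x ∂(stateVolume p d) = condMass p d ((n : ℝ) - p + 2 * a - d - 1) := by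
  rw [← (integrable_condNorm_mul_expKernel_mul_condZ (X := X) (y := y) hh S1 S3 hm hx).2]
  refine integral_congr_ae ?_
  filter_upwards [ae_restrict_mem measurableSet_stateSpace] with x' hx'
  rw [mtd, restrict_orthant]
  refine integral_congr_ae ?_
  filter_upwards [ae_orthantVolume_pos n] with z hz
  rw [condBeta_mul_condScale S1 a hz hx']

lemma measurable_posteriorDensity (hh : IsMixingDensity h) (a : ℝ) :
    Measurable (posteriorDensity a X y h) :=
  (measurable_likelihood_mul_prior hh a).ennreal_ofReal.div_const _

lemma toReal_posteriorDensity (hh : IsMixingDensity h)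
    (S3 : IntegrableOn (fun u : ℝ => u ^ ((d : ℝ) / 2) * h u) (Ioi 0)) {a : ℝ}
    (hM0 : marginal a X y h ≠ 0) (hM : marginal a X y h ≠ ∞) {x : State p d}
    (hx : x ∈ stateSpace p d) : (posteriorDensity a X y h x).toReal =
      likelihood X y h x * prior a x / (marginal a X y h).toReal := by
  rw [posteriorDensity_eq a hM0 hM, ENNReal.toReal_ofReal]
  exact div_nonneg (likelihood_mul_prior_pos hh S3 a hx).le ENNReal.toReal_nonneg

lemma ae_posterior_mem (a : ℝ) : ∀ᵐ x ∂(posterior a X y h), x ∈ stateSpace p d :=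
  (withDensity_absolutelyContinuous _ _).ae_le (ae_restrict_mem measurableSet_stateSpace)

lemma integrable_mul_mtd_iff (hh : IsMixingDensity h) (S1 : (Matrix.fromCols X y).rank = p + d)
    (S3 : IntegrableOn (fun u : ℝ => u ^ ((d : ℝ) / 2) * h u) (Ioi 0)) {a : ℝ}
    (hm : (d : ℝ) - 1 < (n : ℝ) - p + 2 * a - d - 1) (hM0 : marginal a X y h ≠ 0)
    (hM : marginal a X y h ≠ ∞) {x : State p d} (hx : x ∈ stateSpace p d) (f : State p d → ℝ) :
    (Integrable (fun x' => f x' * mtd a X y h x' x) (stateVolume p d) ↔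
      Integrable (fun x' => f x' * symmKernel (orthantVolume n) (chainFactor a X y h) x x')
        (posterior a X y h)) ∧
    ∫ x', f x' * symmKernel (orthantVolume n) (chainFactor a X y h) x x' ∂(posterior a X y h) =
      ∫ x', f x' * mtd a X y h x' x ∂(stateVolume p d) := by
  have hlt : ∀ᵐ x' ∂(stateVolume p d), posteriorDensity a X y h x' < ∞ :=
    Filter.Eventually.of_forall fun x' => by
      rw [posteriorDensity_eq a hM0 hM]; exact ENNReal.ofReal_lt_top
  have hae : (fun x' => (posteriorDensity a X y h x').toReal •
      (f x' * symmKernel (orthantVolume n) (chainFactor a X y h) x x')) =ᵐ[stateVolume p d]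
      fun x' => f x' * mtd a X y h x' x := by
    filter_upwards [ae_restrict_mem measurableSet_stateSpace] with x' hx'
    rw [mtd_eq hh S1 S3 hm hM0 hM hx hx', toReal_posteriorDensity hh S3 hM0 hM hx', smul_eq_mul]
    ring
  constructor
  · rw [posterior, integrable_withDensity_iff_integrable_smul' (measurable_posteriorDensity hh a)
      hlt, integrable_congr hae]
  · rw [posterior, integral_withDensity_eq_integral_toReal_smul
      (measurable_posteriorDensity hh a) hlt, integral_congr_ae hae]

lemma isFiniteMeasure_posterior (a : ℝ) (hM0 : marginal a X y h ≠ 0) :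
    IsFiniteMeasure (posterior a X y h) := by
  refine ⟨?_⟩
  rw [posterior, withDensity_apply _ MeasurableSet.univ, Measure.restrict_univ]
  simp only [posteriorDensity, div_eq_mul_inv]
  rw [lintegral_mul_const' _ _ (ENNReal.inv_ne_top.2 hM0)]
  exact ENNReal.mul_inv_le_one _ |>.trans_lt ENNReal.one_lt_top

/-- The heart of the argument. The hypothesis on ψ weakens the exponential decay from ½ to ½(2-ζ),
still positive, at the price of the factor ∏ ν(z_i). The remaining integral over x is the one with c
= 2 - ζ, whose value is free of z. -/
lemma lintegral_condNorm_mul_expKernel_mul_condZ_le (hh : IsMixingDensity h)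
    (S1 : (Matrix.fromCols X y).rank = p + d)
    (S3 : IntegrableOn (fun u : ℝ => u ^ ((d : ℝ) / 2) * h u) (Ioi 0)) {m : ℝ}
    (hm : (d : ℝ) - 1 < m) {ζ : ℝ} (hζ : ζ < 2) {ν : ℝ → ℝ} (hν : ∀ u, 0 < u → 0 ≤ ν u)
    (hpsi : ∀ u, 0 < u → ∀ s, 0 ≤ s → psi d h u s ≤ Real.exp ((ζ - 1) * u * s / 2) * ν u)
    {z : Fin n → ℝ} (hz : ∀ i, 0 < z i) :
    ∫⁻ x, ENNReal.ofReal (condNorm X y m z * expKernel X y m x z * condZ X y h z x)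
        ∂(stateVolume p d) ≤
      gaussConst p d * wishartConst d m *
        ENNReal.ofReal (condConst p d m * (2 - ζ) ^ (-(d * (p + m)) / 2)) *
        ENNReal.ofReal (∏ i, ν (z i)) := by
  have hk := condNorm_pos S1 hz hm
  have hνz : 0 ≤ ∏ i, ν (z i) := Finset.prod_nonneg fun i _ => hν _ (hz i)
  rw [← lintegral_condNorm_mul_expKernel S1 hm hz (sub_pos.2 hζ),
    ← lintegral_mul_const' _ _ ENNReal.ofReal_ne_top]
  refine lintegral_mono_ae ?_
  filter_upwards [ae_restrict_mem measurableSet_stateSpace] with x hx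
  rw [← ENNReal.ofReal_mul' hνz]
  refine ENNReal.ofReal_le_ofReal ?_
  have hV : 0 < (State.scale x).det := Matrix.PosDef.det_pos hx
  have h1 : condZ X y h z x ≤
      Real.exp ((ζ - 1) / 2 * ∑ i, z i * resid X y x i) * ∏ i, ν (z i) := by
    rw [Finset.mul_sum, Real.exp_sum, ← Finset.prod_mul_distrib]
    refine Finset.prod_le_prod (fun i _ => psi_nonneg hh S3 (hz i) (resid_nonneg hx i))
      fun i _ => ?_
    refine (hpsi _ (hz i) _ (resid_nonneg hx i)).trans_eq ?_
    congr 2; ring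
  have h2 : Real.exp (-((2 - ζ) / 2) * ∑ i, z i * resid X y x i) =
      Real.exp (-(1 / 2) * ∑ i, z i * resid X y x i) *
        Real.exp ((ζ - 1) / 2 * ∑ i, z i * resid X y x i) := by
    rw [← Real.exp_add]; congr 1; ring
  have hE := expKernel_pos (X := X) (y := y) m hx z
  calc _ ≤ condNorm X y m z * expKernel X y m x z *
        (Real.exp ((ζ - 1) / 2 * ∑ i, z i * resid X y x i) * ∏ i, ν (z i)) := by gcongr
    _ = _ := by rw [h2, expKernel]; ring

/-- On the diagonal x' = x the factorisation identifies F² times the posterior density with the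
integrand of k(x|x). The inner integral over x is bounded by a constant times ∏ ν(z_i), a product of
integrable functions. -/
lemma integrable_sq_chainFactor (hh : IsMixingDensity h)
    (S1 : (Matrix.fromCols X y).rank = p + d)
    (S3 : IntegrableOn (fun u : ℝ => u ^ ((d : ℝ) / 2) * h u) (Ioi 0)) {a : ℝ}
    (hm : (d : ℝ) - 1 < (n : ℝ) - p + 2 * a - d - 1) (hM0 : marginal a X y h ≠ 0)
    (hM : marginal a X y h ≠ ∞) {ζ : ℝ} (hζ : ζ < 2) {ν : ℝ → ℝ} (hν : ∀ u, 0 < u → 0 ≤ ν u)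
    (hνint : IntegrableOn ν (Ioi 0))
    (hpsi : ∀ u, 0 < u → ∀ s, 0 ≤ s → psi d h u s ≤ Real.exp ((ζ - 1) * u * s / 2) * ν u) :
    Integrable (fun w => chainFactor a X y h w ^ 2)
      ((posterior a X y h).prod (orthantVolume n)) := by
  have hFm : Measurable fun w : State p d × (Fin n → ℝ) => chainFactor a X y h w ^ 2 :=
    (measurable_chainFactor hh a).pow_const 2
  have := isFiniteMeasure_posterior (X := X) (y := y) (h := h) a hM0
  refine ⟨hFm.aestronglyMeasurable, ?_⟩
  rw [hasFiniteIntegral_iff_ofReal (Filter.Eventually.of_forall fun w => sq_nonneg _),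
    lintegral_prod_symm' _ hFm.ennreal_ofReal]
  set m := (n : ℝ) - p + 2 * a - d - 1 with hmdef
  have hinner : ∀ z : Fin n → ℝ, (∀ i, 0 < z i) →
      ∫⁻ x, ENNReal.ofReal (chainFactor a X y h (x, z) ^ 2) ∂(posterior a X y h) ≤
        gaussConst p d * wishartConst d m *
          ENNReal.ofReal (condConst p d m * (2 - ζ) ^ (-(d * (p + m)) / 2)) *
          ENNReal.ofReal (∏ i, ν (z i)) := by
    intro z hz
    refine le_trans (le_of_eq ?_)
      (lintegral_condNorm_mul_expKernel_mul_condZ_le hh S1 S3 hm hζ hν hpsi hz)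
    have hFz : Measurable fun x : State p d =>
        ENNReal.ofReal (chainFactor a X y h (x, z) ^ 2) :=
      hFm.ennreal_ofReal.comp (measurable_id.prodMk measurable_const)
    rw [posterior, lintegral_withDensity_eq_lintegral_mul _ (measurable_posteriorDensity hh a) hFz]
    refine lintegral_congr_ae ?_
    filter_upwards [ae_restrict_mem measurableSet_stateSpace] with x hx
    rw [Pi.mul_apply, posteriorDensity_eq a hM0 hM, ← ENNReal.ofReal_mul' (sq_nonneg _),
      ← condBeta_mul_condScale S1 a hz hx, chainFactor_mul_chainFactor hh S1 S3 hm hM0 hM hz hx hx]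
    congr 1; ring
  have hνprod : Integrable (fun z : Fin n → ℝ => ∏ i, ν (z i)) (orthantVolume n) :=
    Integrable.fintype_prod fun _ => hνint
  calc _ ≤ ∫⁻ z, gaussConst p d * wishartConst d m *
          ENNReal.ofReal (condConst p d m * (2 - ζ) ^ (-(d * (p + m)) / 2)) *
          ENNReal.ofReal (∏ i, ν (z i)) ∂(orthantVolume n) := by
        refine lintegral_mono_ae ?_
        filter_upwards [ae_orthantVolume_pos n] with z hz
        exact hinner z hz
    _ < ∞ := by
        have hfin : gaussConst p d * wishartConst d m *
            ENNReal.ofReal (condConst p d m * (2 - ζ) ^ (-(d * (p + m)) / 2)) < ∞ :=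
          ENNReal.mul_lt_top (ENNReal.mul_lt_top (gaussConst_lt_top p d)
            (wishartConst_lt_top d m hm)) ENNReal.ofReal_lt_top
        rw [lintegral_const_mul' _ _ hfin.ne]
        exact ENNReal.mul_lt_top hfin hνprod.lintegral_lt_top

/-- The theorem for a proper posterior. -/
theorem exists_isDAOperator_of_marginal_ne_top (hh : IsMixingDensity h)
    (S1 : (Matrix.fromCols X y).rank = p + d)
    (S3 : IntegrableOn (fun u : ℝ => u ^ ((d : ℝ) / 2) * h u) (Ioi 0)) {a : ℝ}
    (hm : (d : ℝ) - 1 < (n : ℝ) - p + 2 * a - d - 1) (hM0 : marginal a X y h ≠ 0)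
    (hM : marginal a X y h ≠ ∞) {ζ : ℝ} (hζ : ζ < 2) {ν : ℝ → ℝ} (hν : ∀ u, 0 < u → 0 ≤ ν u)
    (hνint : IntegrableOn ν (Ioi 0))
    (hpsi : ∀ u, 0 < u → ∀ s, 0 ≤ s → psi d h u s ≤ Real.exp ((ζ - 1) * u * s / 2) * ν u) :
    ∃ K : L2Zero (posterior a X y h) →L[ℝ] L2Zero (posterior a X y h),
      IsDAOperator a X y h K ∧ IsPositiveTraceClass K := by
  have := isFiniteMeasure_posterior (X := X) (y := y) (h := h) a hM0
  obtain ⟨K, hK, hK'⟩ := exists_isPositiveTraceClass_symmKernel (measurable_chainFactor hh a)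
    (integrable_sq_chainFactor hh S1 S3 hm hM0 hM hζ hν hνint hpsi)
    -- The mass of the transition density does not depend on the starting point; that it equals one
    -- is not needed.
    (C := condMass p d ((n : ℝ) - p + 2 * a - d - 1)) (by
      filter_upwards [ae_posterior_mem a] with x hx
      have h1 := (integrable_mul_mtd_iff hh S1 S3 hm hM0 hM hx fun _ => 1).2
      simp only [one_mul] at h1
      rw [h1, integral_mtd hh S1 S3 hm hx])
  refine ⟨K, fun f => ⟨?_, ?_⟩, hK⟩
  · filter_upwards [(hK' f).1, ae_posterior_mem a] with x h1 hx
    exact (integrable_mul_mtd_iff hh S1 S3 hm hM0 hM hx _).1.2 h1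
  · filter_upwards [(hK' f).2, ae_posterior_mem a] with x h1 hx
    rw [h1, (integrable_mul_mtd_iff hh S1 S3 hm hM0 hM hx _).2]

end Chain

/-! ### Determinant bounds by monomials in the latent variables -/

section Determinants

/-- For a unit eigenvector v of 1 + A the eigenvalue is 1 + vᵀAv ≥ 1. -/
lemma one_le_det_one_add {ι : Type*} [Fintype ι] [DecidableEq ι] {A : Matrix ι ι ℝ}
    (hA : A.PosSemidef) : 1 ≤ (1 + A).det := by
  have hH : (1 + A).IsHermitian := Matrix.isHermitian_one.add hA.isHermitian
  rw [hH.det_eq_prod_eigenvalues]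
  refine Finset.prod_const_one.symm.trans_le
    (Finset.prod_le_prod (fun _ _ => zero_le_one) fun i _ => ?_)
  have h1 := hH.mulVec_eigenvectorBasis i
  have h2 := hA.dotProduct_mulVec_nonneg (hH.eigenvectorBasis i).ofLp
  have h3 : (hH.eigenvectorBasis i).ofLp ⬝ᵥ (hH.eigenvectorBasis i).ofLp = 1 := by
    have h4 := hH.eigenvectorBasis.orthonormal.1 i
    have h5 := EuclideanSpace.real_norm_sq_eq (hH.eigenvectorBasis i)
    rw [h4] at h5
    simp only [dotProduct, ← sq]
    linarith
  rw [Matrix.add_mulVec, Matrix.one_mulVec] at h1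
  rw [eq_sub_of_add_eq' h1, star_trivial, dotProduct_sub, dotProduct_smul, h3, smul_eq_mul] at h2
  simp only [RCLike.ofReal_real_eq_id, id_eq]
  linarith

lemma det_le_det_add {ι : Type*} [Fintype ι] [DecidableEq ι] {S A : Matrix ι ι ℝ}
    (hS : S.PosDef) (hA : A.PosSemidef) : S.det ≤ (S + A).det := by
  obtain ⟨R, hR, hR0, -, -⟩ := exists_mul_transpose_eq hS
  have hu : IsUnit R.det := hR0.isUnit
  have hu' : IsUnit Rᵀ.det := by rwa [Matrix.det_transpose]
  have h1 : S + A = R * (1 + R⁻¹ * A * (R⁻¹)ᵀ) * Rᵀ := by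
    rw [Matrix.mul_add, Matrix.add_mul, Matrix.mul_one, ← hR, Matrix.transpose_nonsing_inv]
    simp only [← Matrix.mul_assoc]
    rw [Matrix.mul_nonsing_inv _ hu, Matrix.one_mul, Matrix.mul_assoc A,
      Matrix.nonsing_inv_mul _ hu', Matrix.mul_one]
  have h2 : (R⁻¹ * A * (R⁻¹)ᵀ).PosSemidef := by
    rw [← Matrix.conjTranspose_eq_transpose_of_trivial]
    exact hA.mul_mul_conjTranspose_same _
  have h3 := one_le_det_one_add h2
  rw [h1, hR, Matrix.det_mul, Matrix.det_mul, Matrix.det_mul, Matrix.det_transpose]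
  nlinarith [mul_self_pos.2 hR0]

/-- Row i of the product is ∑_k A_ki z_k A_k, with A_k the rows of A; the determinant is expanded
multilinearly in the rows. -/
lemma det_transpose_mul_diagonal_mul {N q : ℕ} (A : Matrix (Fin N) (Fin q) ℝ) (z : Fin N → ℝ) :
    (Aᵀ * Matrix.diagonal z * A).det =
      ∑ f : Fin q → Fin N, (∏ i, A (f i) i) * (A.submatrix f id).det * ∏ i, z (f i) := by
  have h1 : Aᵀ * Matrix.diagonal z * A =
      Matrix.of fun i => ∑ k, (A k i * z k) • A k := by
    ext i j
    simp [Matrix.mul_apply, Matrix.diagonal_apply]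
  rw [h1]
  have h2 := (Matrix.detRowAlternating : (Fin q → ℝ) [⋀^Fin q]→ₗ[ℝ] ℝ).toMultilinearMap.map_sum
    (fun (i : Fin q) (k : Fin N) => (A k i * z k) • A k)
  refine h2.trans (Finset.sum_congr rfl fun f _ => ?_)
  refine (MultilinearMap.map_smul_univ _ (fun i => A (f i) i * z (f i)) fun i => A (f i)).trans ?_
  rw [Finset.prod_mul_distrib, smul_eq_mul, mul_right_comm]
  rfl

/-- Non-injective selections repeat a row and contribute nothing. The others give square-free
monomials in z, each at most the largest ∏_{i ∈ T} z_i over all subsets T. The set T depends on z,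
the constant does not. -/
lemma exists_det_gramMat_le {N q : ℕ} (A : Matrix (Fin N) (Fin q) ℝ) :
    ∃ C : ℝ, 0 ≤ C ∧ ∀ z : Fin N → ℝ, (∀ i, 0 < z i) →
      ∃ T : Finset (Fin N), (gramMat A z).det ≤ C * ∏ i ∈ T, z i := by
  refine ⟨∑ f : Fin q → Fin N, |(∏ i, A (f i) i) * (A.submatrix f id).det|,
    Finset.sum_nonneg fun _ _ => abs_nonneg _, fun z hz => ?_⟩
  obtain ⟨T, hT⟩ := Finite.exists_max fun T : Finset (Fin N) => ∏ i ∈ T, z i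
  refine ⟨T, ?_⟩
  rw [gramMat, inv_matQ hz, det_transpose_mul_diagonal_mul, Finset.sum_mul]
  refine Finset.sum_le_sum fun f _ => ?_
  by_cases hf : Function.Injective f
  · have h1 : ∏ i, z (f i) = ∏ i ∈ Finset.univ.image f, z i :=
      (Finset.prod_image fun i _ j _ hij => hf hij).symm
    rw [h1]
    exact mul_le_mul (le_abs_self _) (hT _) (Finset.prod_nonneg fun i _ => (hz i).le)
      (abs_nonneg _)
  · obtain ⟨i, j, hij, hne⟩ : ∃ i j, f i = f j ∧ i ≠ j := by
      simpa [Function.Injective] using hf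
    have h0 : (A.submatrix f id).det = 0 :=
      Matrix.det_zero_of_row_eq hne (by ext k; simp [hij])
    simp [h0]

variable {n p d : ℕ} {X : Matrix (Fin n) (Fin p) ℝ} {y : Matrix (Fin n) (Fin d) ℝ}

lemma det_residMat_le (S1 : (Matrix.fromCols X y).rank = p + d) {z : Fin n → ℝ}
    (hz : ∀ i, 0 < z i) : (residMat X y z).det ≤ (gramMat y z).det := by
  have hA : ((matMu X y z)ᵀ * gramMat X z * matMu X y z).PosSemidef := by
    rw [← Matrix.conjTranspose_eq_transpose_of_trivial]
    exact (posDef_gramMat S1 hz).posSemidef.conjTranspose_mul_mul_same _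
  have h := det_le_det_add (posDef_residMat S1 hz) hA
  have h1 : residMat X y z + (matMu X y z)ᵀ * gramMat X z * matMu X y z = gramMat y z := by
    rw [residMat, inv_matOmega S1 hz, sub_add_cancel, gramMat]
  rwa [h1] at h

/-- The residual matrix is the Schur complement of the Gram block in the weighted Gram matrix of (X
: y). -/
lemma det_gramMat_mul_det_residMat (S1 : (Matrix.fromCols X y).rank = p + d) {z : Fin n → ℝ}
    (hz : ∀ i, 0 < z i) : (gramMat X z).det * (residMat X y z).det =
      ((Matrix.fromCols X y)ᵀ * Matrix.diagonal z * Matrix.fromCols X y).det := by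
  have hN := (posDef_gramMat S1 hz).det_pos.ne'
  have hdet : IsUnit (gramMat X z).det := hN.isUnit
  have := Matrix.invertibleOfIsUnitDet _ hdet
  have hmu : matMu X y z = (gramMat X z)⁻¹ * (Xᵀ * Matrix.diagonal z * y) := by
    rw [← gramMat_mul_matMu S1 hz, ← Matrix.mul_assoc, Matrix.nonsing_inv_mul _ hdet,
      Matrix.one_mul]
  have h1 : (Matrix.fromCols X y)ᵀ * Matrix.diagonal z * Matrix.fromCols X y =
      Matrix.fromBlocks (gramMat X z) (Xᵀ * Matrix.diagonal z * y) (yᵀ * Matrix.diagonal z * X)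
        (yᵀ * Matrix.diagonal z * y) := by
    rw [Matrix.transpose_fromCols, Matrix.fromRows_mul, Matrix.fromRows_mul_fromCols, gramMat,
      inv_matQ hz]
  have h2 : (matMu X y z)ᵀ * gramMat X z = yᵀ * Matrix.diagonal z * X := by
    have := congrArg Matrix.transpose (gramMat_mul_matMu S1 hz)
    rw [Matrix.transpose_mul, gramMat_transpose hz] at this
    rw [this]
    simp [Matrix.transpose_mul, Matrix.mul_assoc]
  rw [h1, Matrix.det_fromBlocks₁₁, Matrix.invOf_eq_nonsing_inv, residMat, inv_matOmega S1 hz, h2,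
    hmu, inv_matQ hz]
  simp only [Matrix.mul_assoc]

/-- A choice of `p + d` linearly independent observations. -/
lemma exists_rank_submatrix (S1 : (Matrix.fromCols X y).rank = p + d) :
    ∃ e : Fin (p + d) → Fin n, Function.Injective e ∧
      (Matrix.fromCols (X.submatrix e id) (y.submatrix e id)).rank = p + d := by
  obtain ⟨f, hf, hli⟩ : ∃ f : Fin (p + d) → Fin p ⊕ Fin d → ℝ,
      (∀ i, f i ∈ Set.range (Matrix.fromCols X y).row) ∧ LinearIndependent ℝ f := by
    rw [← S1, Matrix.rank_eq_finrank_span_row]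
    obtain ⟨f, hf, -, hli⟩ :=
      Submodule.exists_fun_fin_finrank_span_eq ℝ (Set.range (Matrix.fromCols X y).row)
    exact ⟨f, hf, hli⟩
  choose e he using hf
  have h1 : Matrix.fromCols (X.submatrix e id) (y.submatrix e id) = Matrix.of f := by
    ext i j
    rw [Matrix.of_apply, ← he i]
    cases j <;> rfl
  refine ⟨e, fun i j hij => hli.injective ?_, ?_⟩
  · rw [← he i, ← he j, hij]
  · rw [h1]
    exact (LinearIndependent.rank_matrix (M := Matrix.of f) hli).trans (Fintype.card_fin _)

lemma prod_rpow_mul_prod_rpow {ι : Type*} [Fintype ι] [DecidableEq ι] {z : ι → ℝ}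
    (hz : ∀ i, 0 < z i) (T : Finset ι) (α γ : ℝ) :
    (∏ j, z j) ^ α * (∏ j ∈ T, z j) ^ γ = ∏ j, z j ^ (if j ∈ T then α + γ else α) := by
  rw [← Real.finsetProd_rpow _ _ fun i _ => (hz i).le,
    ← Real.finsetProd_rpow _ _ fun i _ => (hz i).le, ← Finset.univ_inter T,
    ← Finset.prod_ite_mem, ← Finset.prod_mul_distrib]
  refine Finset.prod_congr rfl fun j _ => ?_
  rw [Finset.univ_inter]
  split_ifs
  · rw [Real.rpow_add (hz j)]
  · rw [mul_one]

/-- With exactly p + d observations (X : y) is square, so its weighted Gram determinant is det² ∏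
z_i. Evaluating at z = 1, where both factors are positive, shows det² ≠ 0. -/
lemma exists_det_mul_det_eq {X : Matrix (Fin (p + d)) (Fin p) ℝ}
    {y : Matrix (Fin (p + d)) (Fin d) ℝ} (S1 : (Matrix.fromCols X y).rank = p + d) :
    ∃ c : ℝ, 0 < c ∧ ∀ z : Fin (p + d) → ℝ, (∀ i, 0 < z i) →
      (gramMat X z).det * (residMat X y z).det = c * ∏ i, z i := by
  have key : ∀ z : Fin (p + d) → ℝ, (∀ i, 0 < z i) →
      (gramMat X z).det * (residMat X y z).det =
        ((Matrix.fromCols X y).submatrix finSumFinEquiv id).det ^ 2 * ∏ i, z i := by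
    intro z hz
    have h1 : (Matrix.fromCols X y)ᵀ * Matrix.diagonal z * Matrix.fromCols X y =
        ((Matrix.fromCols X y).submatrix finSumFinEquiv id)ᵀ *
          Matrix.diagonal (z ∘ finSumFinEquiv) *
            (Matrix.fromCols X y).submatrix finSumFinEquiv id := by
      rw [Matrix.transpose_submatrix, ← Matrix.submatrix_diagonal_equiv,
        Matrix.submatrix_mul_equiv, Matrix.submatrix_mul_equiv, Matrix.submatrix_id_id]
    rw [det_gramMat_mul_det_residMat S1 hz, h1, Matrix.det_mul, Matrix.det_mul,
      Matrix.det_transpose, Matrix.det_diagonal]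
    have h2 : ∏ i, (z ∘ finSumFinEquiv) i = ∏ i, z i := Equiv.prod_comp finSumFinEquiv z
    rw [h2]; ring
  refine ⟨_, (sq_nonneg _).lt_of_ne' fun h0 => ?_, key⟩
  have h1 := key (fun _ => 1) fun _ => one_pos
  rw [h0, zero_mul] at h1
  exact (mul_pos (posDef_gramMat S1 fun _ => one_pos).det_pos
    (posDef_residMat S1 fun _ => one_pos).det_pos).ne' h1

/-- Since the product of the two determinants is known exactly, they can be given the common
exponent -max(d, m)/2. What remains is a nonnegative power, |m-d|/2, of one determinant, and this is
bounded above by a monomial over T. -/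
lemma exists_det_rpow_le {X : Matrix (Fin (p + d)) (Fin p) ℝ}
    {y : Matrix (Fin (p + d)) (Fin d) ℝ} (S1 : (Matrix.fromCols X y).rank = p + d) (m : ℝ) :
    ∃ C : ℝ, 0 ≤ C ∧ ∀ z : Fin (p + d) → ℝ, (∀ i, 0 < z i) →
      ∃ T : Finset (Fin (p + d)),
        (gramMat X z).det ^ (-(d : ℝ) / 2) * (residMat X y z).det ^ (-m / 2) ≤
          C * ∏ j, z j ^ (if j ∈ T then -(d : ℝ) / 2 else -m / 2) := by
  obtain ⟨c, hc, hcz⟩ := exists_det_mul_det_eq S1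
  rcases le_total (d : ℝ) m with hdm | hdm
  · obtain ⟨C, hC, hCz⟩ := exists_det_gramMat_le X
    refine ⟨c ^ (-m / 2) * C ^ ((m - d) / 2), by positivity, fun z hz => ?_⟩
    obtain ⟨T, hT⟩ := hCz z hz
    refine ⟨T, ?_⟩
    have hN := (posDef_gramMat S1 hz).det_pos
    have hS := (posDef_residMat S1 hz).det_pos
    have hP : 0 < ∏ i, z i := Finset.prod_pos fun i _ => hz i
    have hPT : 0 < ∏ i ∈ T, z i := Finset.prod_pos fun i _ => hz i
    have h1 : (gramMat X z).det ^ (-(d : ℝ) / 2) =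
        (gramMat X z).det ^ (-m / 2) * (gramMat X z).det ^ ((m - d) / 2) := by
      rw [← Real.rpow_add hN]; congr 1; ring
    have h2 : -(d : ℝ) / 2 = -m / 2 + (m - d) / 2 := by ring
    rw [h1, mul_right_comm, ← Real.mul_rpow hN.le hS.le, hcz z hz, h2,
      ← prod_rpow_mul_prod_rpow hz, Real.mul_rpow hc.le hP.le]
    have h3 : (gramMat X z).det ^ ((m - d) / 2) ≤
        C ^ ((m - d) / 2) * (∏ i ∈ T, z i) ^ ((m - d) / 2) := by
      rw [← Real.mul_rpow hC hPT.le]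
      exact Real.rpow_le_rpow hN.le hT (by linarith)
    calc _ ≤ c ^ (-m / 2) * (∏ i, z i) ^ (-m / 2) *
          (C ^ ((m - d) / 2) * (∏ i ∈ T, z i) ^ ((m - d) / 2)) := by gcongr
      _ = _ := by ring
  · obtain ⟨C, hC, hCz⟩ := exists_det_gramMat_le y
    refine ⟨c ^ (-(d : ℝ) / 2) * C ^ ((d - m) / 2), by positivity, fun z hz => ?_⟩
    obtain ⟨T, hT⟩ := hCz z hz
    -- Here the indices in T receive the exponent -d/2 + (d-m)/2 = -m/2, so the roles of T and its
    -- complement are exchanged.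
    refine ⟨Tᶜ, ?_⟩
    have hN := (posDef_gramMat S1 hz).det_pos
    have hS := (posDef_residMat S1 hz).det_pos
    have hP : 0 < ∏ i, z i := Finset.prod_pos fun i _ => hz i
    have hPT : 0 < ∏ i ∈ T, z i := Finset.prod_pos fun i _ => hz i
    have h1 : (residMat X y z).det ^ (-m / 2) =
        (residMat X y z).det ^ (-(d : ℝ) / 2) * (residMat X y z).det ^ ((d - m) / 2) := by
      rw [← Real.rpow_add hS]; congr 1; ring
    have h2 : -m / 2 = -(d : ℝ) / 2 + (d - m) / 2 := by ring
    simp only [Finset.mem_compl, ite_not]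
    rw [h1, ← mul_assoc, ← Real.mul_rpow hN.le hS.le, hcz z hz, h2,
      ← prod_rpow_mul_prod_rpow hz, Real.mul_rpow hc.le hP.le]
    have h3 : (residMat X y z).det ^ ((d - m) / 2) ≤
        C ^ ((d - m) / 2) * (∏ i ∈ T, z i) ^ ((d - m) / 2) := by
      rw [← Real.mul_rpow hC hPT.le]
      exact Real.rpow_le_rpow hS.le ((det_residMat_le S1 hz).trans hT) (by linarith)
    calc _ ≤ c ^ (-(d : ℝ) / 2) * (∏ i, z i) ^ (-(d : ℝ) / 2) *
          (C ^ ((d - m) / 2) * (∏ i ∈ T, z i) ^ ((d - m) / 2)) := by gcongr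
      _ = _ := by ring

end Determinants

/-! ### Propriety of the posterior -/

section Propriety

variable {n p d : ℕ} {X : Matrix (Fin n) (Fin p) ℝ} {y : Matrix (Fin n) (Fin d) ℝ} {h : ℝ → ℝ}

/-- The exponents of the latent variables in the bound on the mass of `expKernel`. -/
noncomputable def latentExponent (d : ℕ) (m : ℝ) : Fin 3 → ℝ := ![0, -(d : ℝ) / 2, -m / 2]

/-- Discarding observations removes nonnegative terms z_i r_i from the exponent. -/
lemma expKernel_le_submatrix {N : ℕ} {e : Fin N → Fin n} (he : Function.Injective e) (m : ℝ)
    {x : State p d} (hx : x ∈ stateSpace p d) {z : Fin n → ℝ} (hz : ∀ i, 0 < z i) :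
    expKernel X y m x z ≤ expKernel (X.submatrix e id) (y.submatrix e id) m x (z ∘ e) := by
  have hV : 0 < (State.scale x).det := Matrix.PosDef.det_pos hx
  have h1 : ∑ j, (z ∘ e) j * resid (X.submatrix e id) (y.submatrix e id) x j ≤
      ∑ i, z i * resid X y x i := by
    have h2 : ∑ j, (z ∘ e) j * resid (X.submatrix e id) (y.submatrix e id) x j =
        ∑ i ∈ Finset.univ.map ⟨e, he⟩, z i * resid X y x i := by
      rw [Finset.sum_map]; rfl
    rw [h2]
    exact Finset.sum_le_univ_sum_of_nonneg fun i =>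
      mul_nonneg (hz i).le (resid_nonneg hx i)
  unfold expKernel
  gcongr ?_ * Real.exp ?_
  linarith

lemma exists_lintegral_expKernel_le (S1 : (Matrix.fromCols X y).rank = p + d) (m : ℝ) :
    ∃ C : ℝ, 0 ≤ C ∧ ∀ z : Fin n → ℝ, (∀ i, 0 < z i) → ∃ ε : Fin n → Fin 3,
      ∫⁻ x, ENNReal.ofReal (expKernel X y m x z) ∂(stateVolume p d) ≤
        gaussConst p d * wishartConst d m *
          ENNReal.ofReal (C * ∏ i, z i ^ latentExponent d m (ε i)) := by
  obtain ⟨e, he, hr⟩ := exists_rank_submatrix S1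
  obtain ⟨C, hC, hCz⟩ := exists_det_rpow_le hr m
  refine ⟨C, hC, fun z hz => ?_⟩
  obtain ⟨T, hT⟩ := hCz (z ∘ e) fun i => hz _
  -- Discarded observations receive the code 0, that is, the exponent 0.
  refine ⟨Function.extend e (fun j => if j ∈ T then 1 else 2) fun _ => 0, ?_⟩
  have hprod : ∏ j, (z ∘ e) j ^ (if j ∈ T then -(d : ℝ) / 2 else -m / 2) =
      ∏ i, z i ^ latentExponent d m
        (Function.extend e (fun j => if j ∈ T then 1 else 2) (fun _ => 0) i) := by
    refine Fintype.prod_of_injective e he _ _ (fun i hi => ?_) fun j => ?_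
    · rw [Function.extend_apply' _ _ _ (by simpa using hi)]
      simp [latentExponent]
    · rw [he.extend_apply]
      split_ifs <;> simp [latentExponent]
  rw [← hprod]
  calc _ ≤ ∫⁻ x, ENNReal.ofReal (expKernel (X.submatrix e id) (y.submatrix e id) m x (z ∘ e))
        ∂(stateVolume p d) := by
        refine lintegral_mono_ae ?_
        filter_upwards [ae_restrict_mem measurableSet_stateSpace] with x hx
        exact ENNReal.ofReal_le_ofReal (expKernel_le_submatrix he m hx hz)
    _ ≤ _ := by
        rw [lintegral_expKernel hr (z := z ∘ e) (fun i => hz _) m]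
        gcongr

/-- The integrand is a product over observations. The factor u^(d/2) h(u) multiplied by u to the
power 0, -d/2 or -m/2 is integrable by (S3), by integrability of h, or by (S4) respectively. -/
lemma integrable_prod_latentExponent (hh : IsMixingDensity h)
    (S3 : IntegrableOn (fun u : ℝ => u ^ ((d : ℝ) / 2) * h u) (Ioi 0)) {m : ℝ}
    (S4 : IntegrableOn (fun u : ℝ => u ^ (((d : ℝ) - m) / 2) * h u) (Ioi 0))
    (ε : Fin n → Fin 3) :
    Integrable (fun z => latentWeight d h z * ∏ i, z i ^ latentExponent d m (ε i))
      (orthantVolume n) := by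
  simp_rw [latentWeight, ← Finset.prod_mul_distrib]
  refine Integrable.fintype_prod (f := fun i u =>
    ((2 * Real.pi) ^ ((d : ℝ) / 2))⁻¹ * (u ^ ((d : ℝ) / 2) * h u) * u ^ latentExponent d m (ε i))
    fun i => ?_
  have key : ∀ k : Fin 3,
      IntegrableOn (fun u : ℝ => u ^ ((d : ℝ) / 2 + latentExponent d m k) * h u) (Ioi 0) := by
    intro k
    fin_cases k
    · simpa [latentExponent] using S3
    · have h1 : (d : ℝ) / 2 + -(d : ℝ) / 2 = 0 := by ring
      simpa [latentExponent, h1] using hh.integrable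
    · have h1 : (d : ℝ) / 2 + -m / 2 = (d - m) / 2 := by ring
      simpa [latentExponent, h1] using S4
  refine ((key (ε i)).const_mul ((2 * Real.pi) ^ ((d : ℝ) / 2))⁻¹).congr ?_
  filter_upwards [ae_restrict_mem measurableSet_Ioi] with u hu
  rw [Real.rpow_add hu]
  ring

lemma likelihood_mul_prior_eq_lintegral (hh : IsMixingDensity h)
    (S3 : IntegrableOn (fun u : ℝ => u ^ ((d : ℝ) / 2) * h u) (Ioi 0)) (a : ℝ) {x : State p d}
    (hx : x ∈ stateSpace p d) : ENNReal.ofReal (likelihood X y h x * prior a x) =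
      ∫⁻ z, ENNReal.ofReal (latentWeight d h z *
        expKernel X y ((n : ℝ) - p + 2 * a - d - 1) x z) ∂(orthantVolume n) := by
  have h1 : likelihood X y h x * prior a x = ∫ z, latentWeight d h z *
      expKernel X y ((n : ℝ) - p + 2 * a - d - 1) x z ∂(orthantVolume n) := by
    simp_rw [← likelihood_mul_prior_mul_condZ hh S3 a _ hx]
    rw [integral_const_mul, integral_condZ hh S3 hx, mul_one]
  rw [h1, ofReal_integral_eq_lintegral_ofReal]
  · simp_rw [← likelihood_mul_prior_mul_condZ hh S3 a _ hx]
    exact (integrable_condZ hh S3 hx).const_mul _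
  · filter_upwards [ae_orthantVolume_pos n] with z hz
    exact mul_nonneg (latentWeight_nonneg hh hz) (expKernel_pos _ hx z).le

/-- The posterior is proper. -/
theorem marginal_ne_top (hh : IsMixingDensity h) (S1 : (Matrix.fromCols X y).rank = p + d)
    (S3 : IntegrableOn (fun u : ℝ => u ^ ((d : ℝ) / 2) * h u) (Ioi 0)) {a : ℝ}
    (hm : (d : ℝ) - 1 < (n : ℝ) - p + 2 * a - d - 1)
    (S4 : IntegrableOn (fun u : ℝ => u ^ (((d : ℝ) - ((n : ℝ) - p + 2 * a - d - 1)) / 2) * h u)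
      (Ioi 0)) : marginal a X y h ≠ ∞ := by
  have h0 : marginal a X y h = ∫⁻ x, ∫⁻ z, ENNReal.ofReal (latentWeight d h z *
      expKernel X y ((n : ℝ) - p + 2 * a - d - 1) x z) ∂(orthantVolume n) ∂(stateVolume p d) := by
    refine lintegral_congr_ae ?_
    filter_upwards [ae_restrict_mem measurableSet_stateSpace] with x hx
    exact likelihood_mul_prior_eq_lintegral hh S3 a hx
  generalize (n : ℝ) - p + 2 * a - d - 1 = m at *
  have hlw : Measurable fun w : State p d × (Fin n → ℝ) => latentWeight d h w.2 :=
    (measurable_latentWeight hh).comp measurable_snd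
  have hE : Measurable fun w : State p d × (Fin n → ℝ) => expKernel X y m w.1 w.2 :=
    measurable_expKernel m
  rw [h0, lintegral_lintegral_swap (hlw.mul hE).ennreal_ofReal.aemeasurable]
  obtain ⟨C, hC, hCz⟩ := exists_lintegral_expKernel_le S1 m
  have hfin : gaussConst p d * wishartConst d m < ∞ :=
    ENNReal.mul_lt_top (gaussConst_lt_top p d) (wishartConst_lt_top d m hm)
  -- The exponent pattern ε depends on z, possibly in a non-measurable way; summing over all the
  -- finitely many patterns gives a bound independent of that choice.
  have hint : Integrable (fun z => C * ∑ ε : Fin n → Fin 3,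
      latentWeight d h z * ∏ i, z i ^ latentExponent d m (ε i)) (orthantVolume n) :=
    (integrable_finsetSum _ fun ε _ => integrable_prod_latentExponent hh S3 S4 ε).const_mul C
  refine ne_of_lt (lt_of_le_of_lt (b := ∫⁻ z, gaussConst p d * wishartConst d m *
    ENNReal.ofReal (C * ∑ ε : Fin n → Fin 3,
      latentWeight d h z * ∏ i, z i ^ latentExponent d m (ε i)) ∂(orthantVolume n)) ?_ ?_)
  · refine lintegral_mono_ae ?_
    filter_upwards [ae_orthantVolume_pos n] with z hz
    obtain ⟨ε, hε⟩ := hCz z hz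
    have hw := latentWeight_nonneg (d := d) hh hz
    simp_rw [ENNReal.ofReal_mul hw]
    rw [lintegral_const_mul' _ _ ENNReal.ofReal_ne_top]
    refine (mul_le_mul_right hε _).trans ?_
    rw [mul_left_comm, ← ENNReal.ofReal_mul hw]
    gcongr _ * ENNReal.ofReal ?_
    have h1 := Finset.single_le_sum (f := fun ε : Fin n → Fin 3 =>
      latentWeight d h z * ∏ i, z i ^ latentExponent d m (ε i)) (fun ε _ => mul_nonneg hw
        (Finset.prod_nonneg fun i _ => Real.rpow_nonneg (hz i).le _)) (Finset.mem_univ ε)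
    calc _ = C * (latentWeight d h z * ∏ i, z i ^ latentExponent d m (ε i)) := by ring
      _ ≤ _ := by exact mul_le_mul_of_nonneg_left h1 hC
  · rw [lintegral_const_mul' _ _ hfin.ne]
    exact ENNReal.mul_lt_top hfin hint.lintegral_lt_top

/-- |vᵀΣv| ≤ (∑ |Σ_ij|) |v|², because |v_i v_j| ≤ |v|². -/
lemma posDef_symMat_add_smul_one {σ : Sym2 (Fin d) → ℝ} {c : ℝ}
    (hc : ∑ i, ∑ j, |symMat σ i j| < c) : (symMat σ + c • 1).PosDef := by
  refine Matrix.PosDef.of_dotProduct_mulVec_pos ?_ fun v hv => ?_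
  · refine Matrix.IsHermitian.add ?_ (Matrix.isHermitian_one.smul (by simp [IsSelfAdjoint]))
    rw [Matrix.IsHermitian, Matrix.conjTranspose_eq_transpose_of_trivial, symMat_transpose]
  · have hv2 : 0 < v ⬝ᵥ v := by
      rw [← star_trivial v]
      simpa using Matrix.dotProduct_star_self_pos_iff.2 hv
    have hle : ∀ i, v i * v i ≤ v ⬝ᵥ v := fun i =>
      Finset.single_le_sum (f := fun i => v i * v i) (fun i _ => mul_self_nonneg _)
        (Finset.mem_univ i)
    have hb : -((∑ i, ∑ j, |symMat σ i j|) * (v ⬝ᵥ v)) ≤ v ⬝ᵥ (symMat σ *ᵥ v) := by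
      generalize v ⬝ᵥ v = q at hle
      simp only [dotProduct, Matrix.mulVec, Finset.mul_sum, Finset.sum_mul]
      rw [← Finset.sum_neg_distrib]
      refine Finset.sum_le_sum fun i _ => ?_
      rw [← Finset.sum_neg_distrib]
      refine Finset.sum_le_sum fun j _ => ?_
      have h1 : |v i * v j| ≤ q := by
        rw [abs_le]
        constructor <;> nlinarith [hle i, hle j, sq_nonneg (v i + v j), sq_nonneg (v i - v j)]
      have h2 : |symMat σ i j * (v i * v j)| ≤ |symMat σ i j| * q := by
        rw [abs_mul]
        exact mul_le_mul_of_nonneg_left h1 (abs_nonneg _)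
      calc _ ≤ symMat σ i j * (v i * v j) := (abs_le.1 h2).1
        _ = _ := by ring
    rw [star_trivial, Matrix.add_mulVec, Matrix.smul_mulVec, Matrix.one_mulVec, dotProduct_add,
      dotProduct_smul, smul_eq_mul]
    nlinarith

/-- Adding a large multiple of the identity makes any symmetric matrix positive definite, so
countably many translates of the cone cover the space; a null cone would make the whole space null.
-/
lemma volume_posDef_ne_zero (d : ℕ) :
    (volume : Measure (Sym2 (Fin d) → ℝ)) {σ | (symMat σ).PosDef} ≠ 0 := by
  intro h0
  have hone : symMat (symCoord (1 : Matrix (Fin d) (Fin d) ℝ)) = 1 :=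
    symMat_symCoord Matrix.transpose_one
  have hadd : ∀ (σ : Sym2 (Fin d) → ℝ) (c : ℝ), symMat (σ + c • symCoord 1) = symMat σ + c • 1 := by
    intro σ c
    conv_rhs => rw [← hone]
    rfl
  have hcover : (univ : Set (Sym2 (Fin d) → ℝ)) ⊆
      ⋃ k : ℕ, (fun σ => σ + (k : ℝ) • symCoord 1) ⁻¹' {σ | (symMat σ).PosDef} := by
    intro σ _
    obtain ⟨k, hk⟩ := exists_nat_gt (∑ i, ∑ j, |symMat σ i j|)
    refine mem_iUnion.2 ⟨k, ?_⟩
    rw [mem_preimage, mem_ofPred_eq, hadd]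
    exact posDef_symMat_add_smul_one hk
  refine isOpen_univ.measure_ne_zero (volume : Measure (Sym2 (Fin d) → ℝ)) univ_nonempty
    (measure_mono_null hcover (measure_iUnion_null fun k => ?_))
  rw [measure_preimage_add_right, h0]

lemma marginal_ne_zero (hh : IsMixingDensity h)
    (S3 : IntegrableOn (fun u : ℝ => u ^ ((d : ℝ) / 2) * h u) (Ioi 0)) (a : ℝ) :
    marginal a X y h ≠ 0 := by
  intro h0
  rw [marginal, lintegral_eq_zero_iff (measurable_likelihood_mul_prior hh a).ennreal_ofReal] at h0
  have h1 : ∀ᵐ _ ∂(stateVolume p d), False := by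
    filter_upwards [h0, ae_restrict_mem measurableSet_stateSpace] with x hx0 hx
    exact (ENNReal.ofReal_pos.2 (likelihood_mul_prior_pos hh S3 a hx)).ne' hx0
  have h2 : (volume : Measure (State p d)) (stateSpace p d) = 0 := by
    rw [← Measure.restrict_eq_zero]
    exact ae_eq_bot.1 (Filter.eventually_false_iff_eq_bot.1 h1)
  have h3 : stateSpace p d = univ ×ˢ {σ : Sym2 (Fin d) → ℝ | (symMat σ).PosDef} := by
    ext x; simp [stateSpace, State.scale]
  rw [h3, Measure.volume_eq_prod, Measure.prod_prod] at h2
  exact (mul_ne_zero (isOpen_univ.measure_ne_zero (volume : Measure (Fin p → Fin d → ℝ))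
    univ_nonempty) (volume_posDef_ne_zero d)) h2

end Propriety

end DAReg

theorem lemma1 {n p d : ℕ} (a : ℝ) (X : Matrix (Fin n) (Fin p) ℝ) (y : Matrix (Fin n) (Fin d) ℝ)
    (h : ℝ → ℝ) (hh : DAReg.IsMixingDensity h)
    (S1 : (Matrix.fromCols X y).rank = p + d)
    (S2 : (n : ℝ) > p + 2 * d - 2 * a)
    (S3 : IntegrableOn (fun u : ℝ => u ^ ((d : ℝ) / 2) * h u) (Ioi 0))
    (S4 : IntegrableOn (fun u : ℝ => u ^ (-((n : ℝ) - p + 2 * a - 2 * d - 1) / 2) * h u) (Ioi 0))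
    (hpsi : ∃ ζ : ℝ, ζ < 2 ∧ ∃ ν : ℝ → ℝ, (∀ u, 0 < u → 0 ≤ ν u) ∧ IntegrableOn ν (Ioi 0) ∧
      ∀ u, 0 < u → ∀ s, 0 ≤ s →
        DAReg.psi d h u s ≤ Real.exp ((ζ - 1) * u * s / 2) * ν u) :
    ∃ K : DAReg.L2Zero (DAReg.posterior a X y h) →L[ℝ] DAReg.L2Zero (DAReg.posterior a X y h),
      DAReg.IsDAOperator a X y h K ∧ DAReg.IsPositiveTraceClass K := by
  obtain ⟨ζ, hζ, ν, hν, hνint, hpsi⟩ := hpsi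
  -- (S2) says exactly that the degrees of freedom of the inverse Wishart law exceed d - 1.
  have hm : (d : ℝ) - 1 < (n : ℝ) - p + 2 * a - d - 1 := by linarith
  have S4' : IntegrableOn
      (fun u : ℝ => u ^ (((d : ℝ) - ((n : ℝ) - p + 2 * a - d - 1)) / 2) * h u) (Ioi 0) := by
    convert S4 using 4
    ring
  exact DAReg.exists_isDAOperator_of_marginal_ne_top hh S1 S3 hm (DAReg.marginal_ne_zero hh S3 a)
    (DAReg.marginal_ne_top hh S1 S3 hm S4') hζ hν hνint hpsi
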